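/- Let $d\ge 3$ and let $\mathbb T$ be the infinite rooted tree in which every vertex has exactly $d$ neighbours (so the root $\rho$ has $d$ children and every other vertex has $d-1$ children and one parent). Let $|v|$ be the level of a vertex $v$, i.e. its distance from $\rho$, and write $\overleftarrow v$ for the parent of $v\neq\rho$. Let $X$ be a real random variable such that - $X$ is essentially bounded; - there is $\beta_0>0$ (fixed from now on) with $E[e^{\beta_0X}f(X)]=E[f(-X)]$ for all bounded measurable $f:\mathbb R\to\mathbb R$; - $\inf_{\beta\ge 0}\Lambda(\beta)>0$, where $\Lambda(\beta)=\log E[e^{\beta X}]+\log(d-1)$. Let $h:[0,\infty)\to[0,1]$ be nondecreasing, Lipschitz continuous, continuously differentiable on $(0,1)\cup(1,\infty)$, with $h(0)=0$, $\lim_{x\to\infty}h(x)=1$, and $h(x)=x\,h(1/x)$ for all $x>0$. Attach to the edges $(\overleftarrow v,v)$ of $\mathbb T$ i.i.d. marks $X(\overleftarrow v,v)$ with the law of $X$, set $X(v,\overleftarrow v)=-X(\overleftarrow v,v)$, and call this collection of marks the environment $\omega$. For $\beta\in\mathbb R$ and given $\omega$, let $(V_n)_{n\ge0}$ be the Markov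 chain on the vertices of $\mathbb T$ started at $V_0=\rho$ with transition probabilities $$P_\beta(v,w)=\tfrac1d\,h\bigl(e^{(\beta_0+\beta)X(v,w)}\bigr)\quad (w\sim v),\qquad P_\beta(v,v)=1-\sum_{w\sim v}P_\beta(v,w),$$ and let $\mathbb P_\beta$ be the annealed law, i.e. the joint law of $\omega$ and $(V_n)_{n\ge0}$. Define the level regeneration times by $\tau_0=0$ and $$\tau_{m+1}=\inf\bigl\{k>\tau_m:\ |V_j|\ne|V_k|\ \forall j<k,\ \ |V_{k+1}|=|V_k|+1,\ \ |V_j|\neq|V_k|\ \forall j>k\bigr\}$$ (with $\inf\emptyset=\infty$): the first time after $\tau_m$ at which the chain hits some level for the first time, then immediately jumps to the next level and never gets back to that level. Then for each $K>0$ there are $a=a(K)>0$ and $n_a=n_a(K)>0$ such that for all integers $n>n_a$ and all $\beta\in\mathbb R$ with $|\beta|\le K$, $$\mathbb P_\beta(\tau_1>n)\le e^{-n^a}\qquad\text{and}\qquad \mathbb P_\beta(\tau_2-\tau_1>n)\le e^{-n^a}.$$ -/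

import Mathlib

open MeasureTheory ProbabilityTheory

namespace MetropolisTree

/-! ### The `d`-regular rooted tree -/

/-- The non-root vertices of the `d`-regular rooted tree, identified with the edges
`(parent v, v)`.  The root has `d` children and every other vertex has `d - 1` children (and one
parent).  The pair `(i, [])` is the `i`-th child of the root; `(i, j :: l)` is the `j`-th child of
the vertex `(i, l)`. -/
abbrev Edge (d : ℕ) : Type := Fin d × List (Fin (d - 1))

/-- The vertices of the `d`-regular rooted tree; `none` is the root. -/
abbrev Vertex (d : ℕ) : Type := Option (Edge d)

variable {d : ℕ}

instance : MeasurableSpace (Vertex d) := ⊤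

instance : DiscreteMeasurableSpace (Vertex d) := ⟨fun _ => trivial⟩

/-- The root of the tree. -/
def root : Vertex d := none

/-- The parent of a vertex, with the convention that the root is its own parent. -/
def parent : Vertex d → Vertex d
  | none => none
  | some (_, []) => none
  | some (i, _ :: l) => some (i, l)

/-- The level (depth) of a vertex. -/
def level : Vertex d → ℕ
  | none => 0
  | some (_, l) => l.length + 1

/-- The children of a vertex. -/
def children : Vertex d → Finset (Vertex d)
  | none => Finset.univ.image fun i : Fin d => some (i, [])
  | some (i, l) => Finset.univ.image fun j : Fin (d - 1) => some (i, j :: l)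

/-- The neighbours of a vertex: its children and, unless it is the root, its parent. -/
def neighbors : Vertex d → Finset (Vertex d)
  | none => children none
  | some e => insert (parent (some e)) (children (some e))

theorem mem_children {v w : Vertex d} : w ∈ children v ↔ w ≠ root ∧ parent w = v := by
  rcases v with _ | ⟨i, l⟩ <;> rcases w with _ | ⟨i', _ | ⟨j', l'⟩⟩ <;>
    simp [children, root, parent, eq_comm]

theorem mem_neighbors {v w : Vertex d} :
    w ∈ neighbors v ↔ (w ≠ root ∧ parent w = v) ∨ (v ≠ root ∧ parent v = w) := by
  rcases v with _ | e
  · simp [neighbors, mem_children, root]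
  · simp [neighbors, mem_children, root, or_comm, eq_comm]

theorem card_neighbors (v : Vertex d) : (neighbors v).card = d := by
  rcases v with _ | ⟨i, l⟩
  · simp only [neighbors, children]
    rw [Finset.card_image_of_injective _ (fun a b h => by simpa using h)]
    simp
  · have hd : 0 < d := i.pos
    simp only [neighbors]
    rw [Finset.card_insert_of_notMem]
    · simp only [children]
      rw [Finset.card_image_of_injective _ (fun a b h => by simpa using h)]
      simp
      omega
    · rcases l with _ | ⟨j, l⟩
      · simp [mem_children, root, parent]
      · simp only [mem_children, parent]
        rintro ⟨-, h⟩
        rcases l with _ | ⟨k, l⟩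
        · simp at h
        · have := congrArg level h
          simp [level] at this

theorem notMem_neighbors_self (v : Vertex d) : v ∉ neighbors v := by
  have key : ∀ v : Vertex d, v ≠ root → parent v ≠ v := by
    intro v hv h
    rcases v with _ | ⟨i, _ | ⟨j, l⟩⟩
    · exact hv rfl
    · simp [parent] at h
    · have := congrArg level h
      simp [parent, level] at this
  rw [mem_neighbors]
  rintro (⟨h, h'⟩ | ⟨h, h'⟩) <;> exact key v h h'

/-! ### The environment -/

/-- An environment: a real mark `X(parent v, v)` on every edge `(parent v, v)`. -/
abbrev Env (d : ℕ) : Type := Edge d → ℝ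

/-- The mark `X(v, w)` of the oriented edge from `v` to a neighbour `w`: it is the mark of the
edge if `v` is the parent of `w`, and minus the mark of the edge if `w` is the parent of `v`.
(The value is `0` if `v` and `w` are not neighbours.) -/
def mark (ω : Env d) : Vertex d → Vertex d → ℝ
  | none, none => 0
  | none, some e => if parent (some e) = none then ω e else 0
  | some e, none => if parent (some e) = none then -ω e else 0
  | some e, some e' =>
      if parent (some e') = some e then ω e'
      else if parent (some e) = some e' then -ω e else 0

/-- The law of the environment (of the branching random walk): the marks of the edges
`(parent v, v)` are i.i.d. with law `μ`. -/
noncomputable def envLaw (d : ℕ) (μ : Measure ℝ) [IsProbabilityMeasure μ] : Measure (Env d) :=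
  Measure.infinitePi fun _ : Edge d => μ

instance (μ : Measure ℝ) [IsProbabilityMeasure μ] : IsProbabilityMeasure (envLaw d μ) := by
  unfold envLaw; infer_instance

/-! ### Assumptions on the law of the marks -/

/-- The law `μ` of `X` has compact support: `X` is essentially bounded. -/
def EssBounded (μ : Measure ℝ) : Prop := ∃ M : ℝ, ∀ᵐ x ∂μ, |x| ≤ M

/-- `E[exp (β₀ X) f(X)] = E[f(-X)]` for all bounded measurable functions `f`. -/
def ReversibleAt (μ : Measure ℝ) (β₀ : ℝ) : Prop :=
  ∀ f : ℝ → ℝ, Measurable f → (∃ C : ℝ, ∀ x, |f x| ≤ C) →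
    ∫ x, Real.exp (β₀ * x) * f x ∂μ = ∫ x, f (-x) ∂μ

/-- `Λ(β) = log E[exp (β X)] + log (d - 1)`. -/
noncomputable def logLaplace (d : ℕ) (μ : Measure ℝ) (β : ℝ) : ℝ :=
  Real.log (∫ x, Real.exp (β * x) ∂μ) + Real.log ((d : ℝ) - 1)

/-! ### The Metropolis algorithm -/

/-- The acceptance functions `h : [0, ∞) → [0, 1]` of the Metropolis algorithm.  Only the values
of `h` on `[0, ∞)` matter. -/
structure AcceptanceFunction where
  /-- the underlying function -/
  toFun : ℝ → ℝ
  mem_Icc : ∀ x, 0 ≤ x → toFun x ∈ Set.Icc (0 : ℝ) 1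
  monotoneOn : MonotoneOn toFun (Set.Ici 0)
  map_zero : toFun 0 = 0
  tendsto_one : Filter.Tendsto toFun Filter.atTop (nhds 1)
  lipschitz : ∃ C : NNReal, LipschitzOnWith C toFun (Set.Ici 0)
  contDiffOn : ContDiffOn ℝ 1 toFun (Set.Ioo 0 1 ∪ Set.Ioi 1)
  map_inv : ∀ x, 0 ≤ x → toFun x = x * toFun (1 / x)

variable (h : AcceptanceFunction) (β₀ β : ℝ)

/-- `p_β(x) = h(exp ((β₀ + β) x)) / d`. -/
noncomputable def jumpProb (d : ℕ) (x : ℝ) : ℝ := 1 / d * h.toFun (Real.exp ((β₀ + β) * x))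

/-- The transition probabilities `P_β(v, w)` of the Metropolis algorithm in the environment `ω`. -/
noncomputable def transProb (ω : Env d) (v w : Vertex d) : ℝ :=
  if w ∈ neighbors v then jumpProb h β₀ β d (mark ω v w)
  else if w = v then 1 - ∑ u ∈ neighbors v, jumpProb h β₀ β d (mark ω v u)
  else 0

theorem jumpProb_nonneg (x : ℝ) : 0 ≤ jumpProb h β₀ β d x :=
  mul_nonneg (by positivity) (h.mem_Icc _ (Real.exp_pos _).le).1

theorem jumpProb_le (x : ℝ) : jumpProb h β₀ β d x ≤ 1 / d :=
  mul_le_of_le_one_right (by positivity) (h.mem_Icc _ (Real.exp_pos _).le).2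

theorem sum_jumpProb_le_one (ω : Env d) (v : Vertex d) :
    ∑ u ∈ neighbors v, jumpProb h β₀ β d (mark ω v u) ≤ 1 := by
  calc ∑ u ∈ neighbors v, jumpProb h β₀ β d (mark ω v u)
      ≤ ∑ _u ∈ neighbors v, (1 / d : ℝ) := Finset.sum_le_sum fun u _ => jumpProb_le h β₀ β _
    _ ≤ 1 := by
      rw [Finset.sum_const, card_neighbors, nsmul_eq_mul]
      rcases Nat.eq_zero_or_pos d with rfl | hd
      · simp
      · have : (0 : ℝ) < d := by exact_mod_cast hd
        exact (mul_one_div_cancel this.ne').le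

theorem transProb_nonneg (ω : Env d) (v w : Vertex d) : 0 ≤ transProb h β₀ β ω v w := by
  unfold transProb
  split_ifs
  · exact jumpProb_nonneg h β₀ β _
  · linarith [sum_jumpProb_le_one h β₀ β ω v]
  · exact le_rfl

theorem sum_transProb (ω : Env d) (v : Vertex d) :
    ∑ w ∈ insert v (neighbors v), ENNReal.ofReal (transProb h β₀ β ω v w) = 1 := by
  rw [← ENNReal.ofReal_sum_of_nonneg fun w _ => transProb_nonneg h β₀ β ω v w,
    Finset.sum_insert (notMem_neighbors_self v)]
  have h1 : ∑ w ∈ neighbors v, transProb h β₀ β ω v w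
      = ∑ u ∈ neighbors v, jumpProb h β₀ β d (mark ω v u) :=
    Finset.sum_congr rfl fun w hw => by simp [transProb, hw]
  rw [h1]
  simp [transProb, notMem_neighbors_self]

/-- The law of the next position of the Metropolis algorithm at `v` in the environment `ω`. -/
noncomputable def stepPMF (ω : Env d) (v : Vertex d) : PMF (Vertex d) :=
  PMF.ofFinset (fun w => ENNReal.ofReal (transProb h β₀ β ω v w)) (insert v (neighbors v))
    (sum_transProb h β₀ β ω v) (fun w hw => by
      rw [Finset.mem_insert, not_or] at hw
      simp [transProb, hw.1, hw.2])

/-- The one-step transition kernel of the Metropolis algorithm in the environment `ω`. -/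
noncomputable def stepKernel (ω : Env d) : Kernel (Vertex d) (Vertex d) :=
  Kernel.ofFunOfCountable fun v => (stepPMF h β₀ β ω v).toMeasure

instance (ω : Env d) : IsMarkovKernel (stepKernel h β₀ β ω) :=
  ⟨fun v => PMF.toMeasure.isProbabilityMeasure (stepPMF h β₀ β ω v)⟩

/-- The quenched law of the Metropolis algorithm `(V_n)` in the environment `ω`: the law, on
`ℕ → Vertex d`, of the Markov chain with transition probabilities `transProb h β₀ β ω` started
from the vertex `v`. -/
noncomputable def quenchedLaw (v : Vertex d) (ω : Env d) : Measure (ℕ → Vertex d) :=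
  Kernel.trajMeasure (X := fun _ => Vertex d) (Measure.dirac v) fun n =>
    (stepKernel h β₀ β ω).comap (fun x => x ⟨n, Finset.mem_Iic.2 le_rfl⟩) (measurable_pi_apply _)

instance (v : Vertex d) (ω : Env d) : IsProbabilityMeasure (quenchedLaw h β₀ β v ω) := by
  unfold quenchedLaw; infer_instance

theorem stepKernel_singleton (ω : Env d) (v w : Vertex d) :
    stepKernel h β₀ β ω v {w} = ENNReal.ofReal (transProb h β₀ β ω v w) := by
  change (stepPMF h β₀ β ω v).toMeasure {w} = _
  rw [PMF.toMeasure_apply_singleton _ _ (measurableSet_singleton w)]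
  rfl

/-- The set of trajectories that agree with `x` up to time `n`. -/
def pathCylinder (n : ℕ) (x : ℕ → Vertex d) : Set (ℕ → Vertex d) := {y | ∀ i ≤ n, y i = x i}

theorem frestrictLe_preimage_singleton (n : ℕ) (x : ℕ → Vertex d) :
    Preorder.frestrictLe (π := fun _ => Vertex d) n ⁻¹' {Preorder.frestrictLe n x}
      = pathCylinder n x := by
  ext y
  simp only [Set.mem_preimage, Set.mem_singleton_iff, pathCylinder, Set.mem_ofPred_eq]
  constructor
  · intro hy i hi
    exact congrFun hy ⟨i, Finset.mem_Iic.2 hi⟩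
  · intro hy
    funext i
    exact hy i.1 (Finset.mem_Iic.1 i.2)

theorem quenchedLaw_pathCylinder_zero (v : Vertex d) (ω : Env d) (x : ℕ → Vertex d) :
    quenchedLaw h β₀ β v ω (pathCylinder 0 x) = Measure.dirac v {x 0} := by
  have hm : (quenchedLaw h β₀ β v ω).map (Preorder.frestrictLe (π := fun _ => Vertex d) 0)
      = (Measure.dirac v).map
          (MeasurableEquiv.piUnique (fun _ : Finset.Iic 0 => Vertex d)).symm := by
    rw [quenchedLaw, Kernel.trajMeasure, Measure.map_comp _ _ (by fun_prop),
      Kernel.traj_map_frestrictLe, Kernel.partialTraj_self, Measure.id_comp]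
  rw [← frestrictLe_preimage_singleton, ← Measure.map_apply (by fun_prop)
    (measurableSet_singleton _), hm, Measure.map_apply (MeasurableEquiv.measurable _)
    (measurableSet_singleton _)]
  congr 1
  ext y
  simp only [Set.mem_preimage, Set.mem_singleton_iff]
  constructor
  · intro hy
    exact congrFun hy ⟨0, Finset.mem_Iic.2 le_rfl⟩
  · rintro rfl
    funext i
    obtain ⟨i, hi⟩ := i
    obtain rfl : i = 0 := by simpa using hi
    change x 0 = x 0
    rfl

theorem quenchedLaw_pathCylinder_succ (v : Vertex d) (ω : Env d) (n : ℕ) (x : ℕ → Vertex d) :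
    quenchedLaw h β₀ β v ω (pathCylinder (n + 1) x)
      = quenchedLaw h β₀ β v ω (pathCylinder n x)
        * ENNReal.ofReal (transProb h β₀ β ω (x n) (x (n + 1))) := by
  set κ : (n : ℕ) → Kernel (Finset.Iic n → Vertex d) (Vertex d) := fun n =>
    (stepKernel h β₀ β ω).comap (fun x => x ⟨n, Finset.mem_Iic.2 le_rfl⟩)
      (measurable_pi_apply _) with hκ
  have key := Kernel.map_frestrictLe_trajMeasure_compProd_eq_map_trajMeasure
    (X := fun _ => Vertex d) (κ := κ) (μ₀ := Measure.dirac v) (a := n)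
  have key2 := congrArg
    (fun m => m ({Preorder.frestrictLe n x} ×ˢ {x (n + 1)})) key
  have hset : (fun y : ℕ → Vertex d => (Preorder.frestrictLe (π := fun _ => Vertex d) n y,
      y (n + 1))) ⁻¹' ({Preorder.frestrictLe n x} ×ˢ {x (n + 1)}) = pathCylinder (n + 1) x := by
    ext y
    have := Set.ext_iff.1 (frestrictLe_preimage_singleton n x) y
    simp only [Set.mem_preimage, Set.mem_singleton_iff] at this
    simp only [Set.mem_preimage, Set.mem_prod, Set.mem_singleton_iff, this]
    simp only [pathCylinder, Set.mem_ofPred_eq]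
    constructor
    · rintro ⟨h1, h2⟩ i hi
      rcases Nat.le_succ_iff.1 hi with hi | rfl
      exacts [h1 i hi, h2]
    · intro hy
      exact ⟨fun i hi => hy i (by omega), hy _ le_rfl⟩
  rw [Measure.map_apply (by fun_prop) ((measurableSet_singleton _).prod
      (measurableSet_singleton _)), hset,
    Measure.compProd_apply_prod (measurableSet_singleton _) (measurableSet_singleton _),
    lintegral_singleton, Measure.map_apply (by fun_prop) (measurableSet_singleton _),
    frestrictLe_preimage_singleton] at key2
  have hstep : κ n (Preorder.frestrictLe n x) {x (n + 1)}
      = ENNReal.ofReal (transProb h β₀ β ω (x n) (x (n + 1))) := by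
    rw [hκ]
    exact stepKernel_singleton h β₀ β ω (x n) (x (n + 1))
  rw [hstep, mul_comm] at key2
  exact key2.symm

/-- The finite-dimensional distributions of the Metropolis algorithm. -/
theorem quenchedLaw_pathCylinder (v : Vertex d) (ω : Env d) (n : ℕ) (x : ℕ → Vertex d) :
    quenchedLaw h β₀ β v ω (pathCylinder n x)
      = Measure.dirac v {x 0}
        * ∏ i ∈ Finset.range n, ENNReal.ofReal (transProb h β₀ β ω (x i) (x (i + 1))) := by
  induction n with
  | zero => simp [quenchedLaw_pathCylinder_zero]
  | succ n ih => rw [quenchedLaw_pathCylinder_succ, ih, Finset.prod_range_succ, mul_assoc]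

theorem measurable_mark (v w : Vertex d) : Measurable fun ω : Env d => mark ω v w := by
  rcases v with _ | e <;> rcases w with _ | e' <;> simp only [mark] <;>
    (try split_ifs) <;> fun_prop

theorem measurable_jumpProb : Measurable (jumpProb h β₀ β d) := by
  have h1 : Monotone fun y : ℝ => h.toFun (Real.exp y) := fun a b hab =>
    h.monotoneOn (Real.exp_pos a).le (Real.exp_pos b).le (Real.exp_le_exp.2 hab)
  exact (h1.measurable.comp (measurable_const_mul (β₀ + β))).const_mul (1 / d : ℝ)

theorem measurable_transProb (v w : Vertex d) :
    Measurable fun ω : Env d => transProb h β₀ β ω v w := by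
  have h1 : ∀ u, Measurable fun ω : Env d => jumpProb h β₀ β d (mark ω v u) := fun u =>
    (measurable_jumpProb h β₀ β).comp (measurable_mark v u)
  unfold transProb
  split_ifs
  · exact h1 w
  · exact measurable_const.sub (Finset.measurable_sum _ fun u _ => h1 u)
  · exact measurable_const

theorem isPiSystem_pathCylinder :
    IsPiSystem {s : Set (ℕ → Vertex d) | ∃ n x, s = pathCylinder n x} := by
  rintro _ ⟨n, x, rfl⟩ _ ⟨m, y, rfl⟩ ⟨z, hz1, hz2⟩
  refine ⟨max n m, z, ?_⟩
  ext w
  simp only [pathCylinder, Set.mem_inter_iff, Set.mem_ofPred_eq] at hz1 hz2 ⊢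
  constructor
  · rintro ⟨h1, h2⟩ i hi
    rcases le_max_iff.1 hi with hi | hi
    · rw [h1 i hi, hz1 i hi]
    · rw [h2 i hi, hz2 i hi]
  · intro hw
    exact ⟨fun i hi => by rw [hw i (le_max_of_le_left hi), hz1 i hi],
      fun i hi => by rw [hw i (le_max_of_le_right hi), hz2 i hi]⟩

theorem measurableSet_pathCylinder (n : ℕ) (x : ℕ → Vertex d) :
    MeasurableSet (pathCylinder n x) := by
  rw [← frestrictLe_preimage_singleton]
  exact (measurableSet_singleton _).preimage (by fun_prop)

theorem generateFrom_pathCylinder :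
    (MeasurableSpace.pi : MeasurableSpace (ℕ → Vertex d))
      = MeasurableSpace.generateFrom {s | ∃ n x, s = pathCylinder n x} := by
  refine le_antisymm ?_ (MeasurableSpace.generateFrom_le ?_)
  · refine iSup_le fun n => ?_
    rintro _ ⟨S, -, rfl⟩
    let ext' : (Fin (n + 1) → Vertex d) → ℕ → Vertex d := fun u i =>
      if hi : i < n + 1 then u ⟨i, hi⟩ else root
    have hS : (fun y : ℕ → Vertex d => y n) ⁻¹' S
        = ⋃ u : {u : Fin (n + 1) → Vertex d // u (Fin.last n) ∈ S},
            pathCylinder n (ext' u.1) := by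
      ext y
      simp only [Set.mem_preimage, Set.mem_iUnion, pathCylinder, Set.mem_ofPred_eq]
      constructor
      · intro hy
        refine ⟨⟨fun i => y i, hy⟩, fun i hi => ?_⟩
        have hi' : i < n + 1 := Nat.lt_succ_of_le hi
        simp only [ext', dif_pos hi']
      · rintro ⟨⟨u, hu⟩, hy⟩
        have := hy n le_rfl
        rw [this]
        simpa [ext', Fin.last] using hu
    rw [hS]
    exact MeasurableSet.iUnion fun u =>
      MeasurableSpace.measurableSet_generateFrom ⟨n, _, rfl⟩
  · rintro _ ⟨n, x, rfl⟩
    exact measurableSet_pathCylinder n x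

theorem measurable_quenchedLaw (v : Vertex d) : Measurable (quenchedLaw h β₀ β v) := by
  refine Measurable.measure_of_isPiSystem_of_isProbabilityMeasure generateFrom_pathCylinder
    isPiSystem_pathCylinder ?_
  rintro _ ⟨n, x, rfl⟩
  simp only [quenchedLaw_pathCylinder]
  exact (Finset.measurable_prod _ fun i _ =>
    (measurable_transProb h β₀ β _ _).ennreal_ofReal).const_mul _

/-- The quenched laws `P_{ω,β}^v`, as a kernel from environments to trajectories. -/
noncomputable def quenchedKernel (v : Vertex d) : Kernel (Env d) (ℕ → Vertex d) where
  toFun := quenchedLaw h β₀ β v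
  measurable' := measurable_quenchedLaw h β₀ β v

instance (v : Vertex d) : IsMarkovKernel (quenchedKernel h β₀ β v) :=
  ⟨fun ω => inferInstanceAs (IsProbabilityMeasure (quenchedLaw h β₀ β v ω))⟩

/-- The annealed law `P(dω) P_{ω,β}^root(dV)` on pairs (environment, trajectory) of the Metropolis
algorithm started from the root. -/
noncomputable def annealedLaw (d : ℕ) (μ : Measure ℝ) [IsProbabilityMeasure μ] :
    Measure (Env d × (ℕ → Vertex d)) :=
  envLaw d μ ⊗ₘ quenchedKernel h β₀ β root

/-! ### Level regeneration times -/

/-- At time `k` the trajectory `V` hits a level for the first time, then immediately jumps to the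
next level and never gets back. -/
def IsLevelRegeneration (V : ℕ → Vertex d) (k : ℕ) : Prop :=
  (∀ j < k, level (V j) ≠ level (V k)) ∧ level (V (k + 1)) = level (V k) + 1 ∧
    ∀ j > k, level (V j) ≠ level (V k)

/-- The level regeneration times: `τ₀ = 0`, and `τ_{m+1}` is the first time strictly after `τ_m`
at which a level regeneration occurs (`⊤` if there is none). -/
noncomputable def regenTime (V : ℕ → Vertex d) : ℕ → ℕ∞
  | 0 => 0
  | m + 1 => ⨅ (k : ℕ) (_ : regenTime V m < (k : ℕ∞) ∧ IsLevelRegeneration V k), (k : ℕ∞)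

end MetropolisTree

/-!
Along an edge the two acceptance probabilities have ratio `exp ((β₀ + β) X)`, so the quenched walk
is reversible, and the weight with which it escapes through a subtree obeys the series and parallel
laws of electrical networks. Under the law of `X` tilted by `exp (β₀ x / 2)` the mark is symmetric,
and `Λ (β₀ / 2) > 0` says that the tilted branching random walk has mean offspring larger than one.
A cosine on a wide strip is then subharmonic for it, which bounds the escape weight from below
with a probability that depends on neither the depth nor `|β| ≤ K`; as the subtrees are
independent, very small escape weights have a stretched-exponential tail.

Under the annealed law, the subtree below a vertex which is visited for the first time is
independent of the past, so estimates for a fresh tree can be used again and again along the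
trajectory. With `t` of order `n ^ (1/5)`, outside an event of probability `exp (-c t ^ a)` a vertex
is visited at most `t` times, a level has at most `t` visited vertices, the walk does not backtrack
over `t` levels, and `t` attempts to regenerate do not all fail. On this event a regeneration takes
place within `t² (t² + 1) < n` steps.
-/

namespace MetropolisTree

open MeasureTheory ProbabilityTheory

/-! ### Independence under product measures -/

section Product

variable {ι : Type*} {X : ι → Type*} [∀ i, MeasurableSpace (X i)]

theorem measurable_iSup_comap_of_dependsOn [∀ i, Nonempty (X i)] {α : Type*} [MeasurableSpace α]
    {S : Set ι} {f : (∀ i, X i) → α} (hf : Measurable f) (hfS : DependsOn f S) :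
    Measurable[⨆ i ∈ S, MeasurableSpace.comap (fun ω : ∀ i, X i => ω i) inferInstance] f := by
  classical
  let freeze : (∀ i, X i) → ∀ i, X i := fun ω i => if i ∈ S then ω i else Classical.arbitrary _
  have hfreeze : f = f ∘ freeze := funext fun ω => hfS fun i hi => by simp [freeze, hi]
  rw [hfreeze]
  refine hf.comp (@measurable_pi_lambda _ _ _
    (⨆ i ∈ S, MeasurableSpace.comap (fun ω : ∀ i, X i => ω i) inferInstance) _ _ fun i => ?_)
  by_cases hi : i ∈ S
  · simp only [freeze, hi, if_true]
    exact (comap_measurable fun ω : ∀ i, X i => ω i).mono (le_iSup₂_of_le i hi le_rfl) le_rfl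
  · simp only [freeze, hi, if_false]
    exact measurable_const

variable (μ : ∀ i, Measure (X i)) [∀ i, IsProbabilityMeasure (μ i)] {S T : Set ι}

theorem indepFun_infinitePi_of_dependsOn {α γ : Type*} [MeasurableSpace α] [MeasurableSpace γ]
    (hST : Disjoint S T) {f : (∀ i, X i) → α} {g : (∀ i, X i) → γ} (hf : Measurable f)
    (hg : Measurable g) (hfS : DependsOn f S) (hgT : DependsOn g T) :
    IndepFun f g (Measure.infinitePi μ) := by
  have : ∀ i, Nonempty (X i) := fun i => nonempty_of_isProbabilityMeasure (μ i)
  have hcoord : iIndepFun (fun i (ω : ∀ i, X i) => ω i) (Measure.infinitePi μ) :=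
    iIndepFun_infinitePi (X := fun _ x => x) fun _ => measurable_id
  have hindep := indep_iSup_of_disjoint (fun i => (measurable_pi_apply i).comap_le)
    ((iIndepFun_iff_iIndep _ _ _).1 hcoord) hST
  rw [IndepFun_iff_Indep]
  exact indep_of_indep_of_le_right (indep_of_indep_of_le_left hindep
    (measurable_iSup_comap_of_dependsOn hf hfS).comap_le)
    (measurable_iSup_comap_of_dependsOn hg hgT).comap_le

theorem lintegral_infinitePi_mul_of_dependsOn (hST : Disjoint S T) {f g : (∀ i, X i) → ENNReal}
    (hf : Measurable f) (hg : Measurable g) (hfS : DependsOn f S) (hgT : DependsOn g T) :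
    ∫⁻ ω, f ω * g ω ∂Measure.infinitePi μ
      = (∫⁻ ω, f ω ∂Measure.infinitePi μ) * ∫⁻ ω, g ω ∂Measure.infinitePi μ :=
  lintegral_mul_eq_lintegral_mul_lintegral_of_indepFun hf hg
    (indepFun_infinitePi_of_dependsOn μ hST hf hg hfS hgT)

end Product

/-! ### Marked trees -/

section Marks

/-- Real marks on the `b`-ary tree, the word `l` being the `j`-th child of `m` when `l = j :: m`.
The mark at a vertex is that of the edge above it, so that `[]` marks an additional edge above the
root: this is the environment seen from an edge of the `(b + 1)`-regular tree. -/
abbrev Marks (b : ℕ) : Type := List (Fin b) → ℝ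

variable {b : ℕ}

/-- The marks of the subtree of the `i`-th child of the root, including the edge above it. -/
def shift (i : Fin b) (ξ : Marks b) : Marks b := fun l => ξ (l ++ [i])

/-- The law of i.i.d. marks with law `μ` on the `b`-ary tree. -/
noncomputable def marksLaw (b : ℕ) (μ : Measure ℝ) [IsProbabilityMeasure μ] : Measure (Marks b) :=
  Measure.infinitePi fun _ : List (Fin b) => μ

variable (μ : Measure ℝ) [IsProbabilityMeasure μ]

instance : IsProbabilityMeasure (marksLaw b μ) := by
  unfold marksLaw; infer_instance

@[fun_prop]
theorem measurable_shift (i : Fin b) : Measurable (shift i : Marks b → Marks b) :=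
  measurable_pi_lambda _ fun _ => measurable_pi_apply _

theorem injective_append_singleton :
    Function.Injective fun p : Fin b × List (Fin b) => p.2 ++ [p.1] := by
  rintro ⟨i, l⟩ ⟨j, m⟩ h
  obtain ⟨rfl, h'⟩ := List.append_inj' h rfl
  simpa using h'

theorem map_marksLaw_shift (i : Fin b) : (marksLaw b μ).map (shift i) = marksLaw b μ :=
  Measure.map_infinitePi_infinitePi_of_inj (P := fun _ : List (Fin b) => μ)
    (f := fun l => l ++ [i]) (List.append_left_injective [i])

theorem map_marksLaw_shifts :
    (marksLaw b μ).map (fun ξ i => shift i ξ) = Measure.pi fun _ : Fin b => marksLaw b μ := by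
  have hflat := Measure.map_infinitePi_infinitePi_of_inj
    (P := fun _ : List (Fin b) => μ) injective_append_singleton
  have hcurry := Measure.infinitePi_map_curry (fun (_ : Fin b) (_ : List (Fin b)) => μ)
  rw [← Measure.infinitePi_eq_pi]
  unfold marksLaw
  rw [← hcurry, ← hflat, Measure.map_map (by fun_prop) (by fun_prop)]
  rfl

theorem map_marksLaw_root_shifts :
    (marksLaw b μ).map (fun ξ => (ξ [], fun i => shift i ξ))
      = μ.prod (Measure.pi fun _ : Fin b => marksLaw b μ) := by
  have hroot : Measurable fun ξ : Marks b => ξ [] := measurable_pi_apply _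
  have hsub : Measurable fun (ξ : Marks b) (i : Fin b) => shift i ξ := by fun_prop
  have hindep : IndepFun (fun ξ : Marks b => ξ []) (fun ξ i => shift i ξ) (marksLaw b μ) :=
    indepFun_infinitePi_of_dependsOn _ (S := {[]}) (T := {[]}ᶜ) disjoint_compl_right hroot hsub
      (fun _ _ h => h [] rfl) fun _ _ h => funext₂ fun _ _ => h _ (by simp)
  have hmap := (indepFun_iff_map_prod_eq_prod_map_map hroot.aemeasurable hsub.aemeasurable).1 hindep
  rw [hmap, map_marksLaw_shifts]
  congr 1
  exact Measure.infinitePi_map_eval (fun _ : List (Fin b) => μ) []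

theorem lintegral_comp_shift (i : Fin b) {f : Marks b → ENNReal} (hf : Measurable f) :
    ∫⁻ ξ, f (shift i ξ) ∂marksLaw b μ = ∫⁻ ξ, f ξ ∂marksLaw b μ := by
  conv_rhs => rw [← map_marksLaw_shift μ i]
  rw [lintegral_map hf (measurable_shift i)]

theorem lintegral_comp_shift_mul_comp_shift {i j : Fin b} (hij : i ≠ j) {f g : Marks b → ENNReal}
    (hf : Measurable f) (hg : Measurable g) :
    ∫⁻ ξ, f (shift i ξ) * g (shift j ξ) ∂marksLaw b μ
      = (∫⁻ ξ, f ξ ∂marksLaw b μ) * ∫⁻ ξ, g ξ ∂marksLaw b μ := by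
  rw [← lintegral_comp_shift μ i hf, ← lintegral_comp_shift μ j hg]
  refine lintegral_infinitePi_mul_of_dependsOn _ (S := Set.range fun l => l ++ [i])
    (T := Set.range fun l => l ++ [j]) ?_ (hf.comp (measurable_shift i))
    (hg.comp (measurable_shift j)) (fun _ _ h => congrArg f (funext fun l => h _ ⟨l, rfl⟩))
    fun _ _ h => congrArg g (funext fun l => h _ ⟨l, rfl⟩)
  rw [Set.disjoint_left]
  rintro _ ⟨l, rfl⟩ ⟨m, h⟩
  exact hij (congrArg Prod.fst (injective_append_singleton (a₁ := (j, m)) (a₂ := (i, l)) h)).symm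

theorem ae_marksLaw_forall {μ : Measure ℝ} [IsProbabilityMeasure μ] {p : ℝ → Prop}
    (hp : ∀ᵐ x ∂μ, p x) : ∀ᵐ ξ ∂marksLaw b μ, ∀ l, p (ξ l) :=
  ae_all_iff.2 fun l => (measurePreserving_eval_infinitePi
    (fun _ : List (Fin b) => μ) l).quasiMeasurePreserving.ae hp

end Marks

/-! ### Acceptance probabilities -/

section Jump

theorem AcceptanceFunction.pos (h : AcceptanceFunction) {x : ℝ} (hx : 0 < x) : 0 < h.toFun x := by
  obtain ⟨z, hz, hxz⟩ := ((h.tendsto_one.eventually_const_lt one_half_lt_one).and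
    (Filter.eventually_ge_atTop (1 / x))).exists
  have hz0 : 0 < z := (one_div_pos.2 hx).trans_le hxz
  calc 0 < 1 / z * h.toFun z := mul_pos (one_div_pos.2 hz0) (one_half_pos.trans hz)
    _ = h.toFun (1 / z) := by rw [h.map_inv _ (one_div_pos.2 hz0).le, one_div_one_div]
    _ ≤ h.toFun x :=
      h.monotoneOn (one_div_pos.2 hz0).le hx.le ((one_div_le hx hz0).1 hxz)

variable {d : ℕ} (h : AcceptanceFunction) (β₀ β : ℝ)

theorem jumpProb_pos (hd : 0 < d) (x : ℝ) : 0 < jumpProb h β₀ β d x :=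
  mul_pos (by positivity) (h.pos (Real.exp_pos _))

theorem jumpProb_le_one (x : ℝ) : jumpProb h β₀ β d x ≤ 1 :=
  (jumpProb_le h β₀ β x).trans (by simpa using Nat.cast_inv_le_one d)

theorem jumpProb_eq_exp_mul_neg (x : ℝ) :
    jumpProb h β₀ β d x = Real.exp ((β₀ + β) * x) * jumpProb h β₀ β d (-x) := by
  unfold jumpProb
  rw [h.map_inv _ (Real.exp_pos _).le, one_div (Real.exp _), ← Real.exp_neg, mul_neg]
  ring

theorem exists_pos_le_jumpProb (hd : 0 < d) (M A : ℝ) :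
    ∃ c : ℝ, 0 < c ∧ c ≤ 1 ∧ ∀ β x : ℝ, |β₀ + β| ≤ A → |x| ≤ M → c ≤ jumpProb h β₀ β d x := by
  refine ⟨jumpProb h 0 1 d (-(A * M)), jumpProb_pos h 0 1 hd _, jumpProb_le_one h 0 1 _,
    fun β x hβ hx => ?_⟩
  refine mul_le_mul_of_nonneg_left (h.monotoneOn (Real.exp_pos _).le (Real.exp_pos _).le
    (Real.exp_le_exp.2 ?_)) (by positivity)
  have : |(β₀ + β) * x| ≤ A * M := by
    rw [abs_mul]
    exact mul_le_mul hβ hx (abs_nonneg _) ((abs_nonneg _).trans hβ)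
  linarith [neg_le_of_abs_le this]

end Jump

/-! ### Escape weights of marked trees -/

section Escape

variable {b d : ℕ} (h : AcceptanceFunction) (β₀ β : ℝ)

/-- The effective weight of an edge with mark `x` in series with a weight `y` below it. -/
noncomputable def series (d : ℕ) (x y : ℝ) : ℝ :=
  jumpProb h β₀ β d x * (y / (jumpProb h β₀ β d (-x) + y))

/-- The weight with which the walk above the tree escapes through its upper edge and its first
`n` levels. -/
noncomputable def escapeUpTo (d : ℕ) : ℕ → Marks b → ℝ
  | 0, ξ => jumpProb h β₀ β d (ξ [])
  | n + 1, ξ => series h β₀ β d (ξ []) (∑ i, escapeUpTo d n (shift i ξ))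

/-- The weight with which the walk above the tree escapes to infinity through its upper edge. -/
noncomputable def escape (d : ℕ) (ξ : Marks b) : ℝ := ⨅ n, escapeUpTo h β₀ β d n ξ

/-- The probability that the walk started at the root of the tree never crosses the upper edge. -/
noncomputable def escapeProb (d : ℕ) (ξ : Marks b) : ℝ :=
  (∑ i, escape h β₀ β d (shift i ξ)) /
    (jumpProb h β₀ β d (-ξ []) + ∑ i, escape h β₀ β d (shift i ξ))

variable {h β₀ β}

theorem series_nonneg {x y : ℝ} (hy : 0 ≤ y) : 0 ≤ series h β₀ β d x y :=
  mul_nonneg (jumpProb_nonneg h β₀ β x)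
    (div_nonneg hy (add_nonneg (jumpProb_nonneg h β₀ β _) hy))

theorem series_mono (hd : 0 < d) {x y z : ℝ} (hy : 0 ≤ y) (hyz : y ≤ z) :
    series h β₀ β d x y ≤ series h β₀ β d x z := by
  have hp := jumpProb_pos h β₀ β hd (-x)
  refine mul_le_mul_of_nonneg_left ?_ (jumpProb_nonneg h β₀ β x)
  rw [div_le_div_iff₀ (by linarith) (by linarith)]
  nlinarith

theorem series_le_jumpProb {x y : ℝ} (hy : 0 ≤ y) :
    series h β₀ β d x y ≤ jumpProb h β₀ β d x :=
  mul_le_of_le_one_right (jumpProb_nonneg h β₀ β x)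
    (div_le_one_of_le₀ (by linarith [jumpProb_nonneg h β₀ β (d := d) (-x)])
      (add_nonneg (jumpProb_nonneg h β₀ β _) hy))

theorem escapeUpTo_nonneg (n : ℕ) (ξ : Marks b) : 0 ≤ escapeUpTo h β₀ β d n ξ := by
  induction n generalizing ξ with
  | zero => exact jumpProb_nonneg h β₀ β _
  | succ n ih => exact series_nonneg (Finset.sum_nonneg fun i _ => ih _)

theorem escapeUpTo_succ_le (hd : 0 < d) (n : ℕ) (ξ : Marks b) :
    escapeUpTo h β₀ β d (n + 1) ξ ≤ escapeUpTo h β₀ β d n ξ := by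
  induction n generalizing ξ with
  | zero => exact series_le_jumpProb (Finset.sum_nonneg fun i _ => escapeUpTo_nonneg 0 _)
  | succ n ih =>
    exact series_mono hd (Finset.sum_nonneg fun i _ => escapeUpTo_nonneg _ _)
      (Finset.sum_le_sum fun i _ => ih _)

theorem escapeUpTo_antitone (hd : 0 < d) (ξ : Marks b) :
    Antitone fun n => escapeUpTo h β₀ β d n ξ :=
  antitone_nat_of_succ_le fun n => escapeUpTo_succ_le hd n ξ

theorem bddBelow_escapeUpTo (ξ : Marks b) :
    BddBelow (Set.range fun n => escapeUpTo h β₀ β d n ξ) :=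
  ⟨0, by rintro _ ⟨n, rfl⟩; exact escapeUpTo_nonneg n ξ⟩

theorem tendsto_escapeUpTo (hd : 0 < d) (ξ : Marks b) :
    Filter.Tendsto (fun n => escapeUpTo h β₀ β d n ξ) Filter.atTop
      (nhds (escape h β₀ β d ξ)) :=
  tendsto_atTop_ciInf (escapeUpTo_antitone hd ξ) (bddBelow_escapeUpTo ξ)

theorem escape_nonneg (ξ : Marks b) : 0 ≤ escape h β₀ β d ξ :=
  le_ciInf fun n => escapeUpTo_nonneg n ξ

theorem sum_escape_nonneg (ξ : Marks b) : 0 ≤ ∑ i, escape h β₀ β d (shift i ξ) :=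
  Finset.sum_nonneg fun _ _ => escape_nonneg _

theorem escape_shift_le_sum (ξ : Marks b) (i : Fin b) :
    escape h β₀ β d (shift i ξ) ≤ ∑ i, escape h β₀ β d (shift i ξ) :=
  Finset.single_le_sum (f := fun i => escape h β₀ β d (shift i ξ))
    (fun _ _ => escape_nonneg _) (Finset.mem_univ i)

theorem escape_le_one (ξ : Marks b) : escape h β₀ β d ξ ≤ 1 :=
  (ciInf_le (bddBelow_escapeUpTo ξ) 0).trans (jumpProb_le_one h β₀ β _)

theorem jumpProb_neg_add_sum_escape_pos (hd : 0 < d) (ξ : Marks b) :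
    0 < jumpProb h β₀ β d (-ξ []) + ∑ i, escape h β₀ β d (shift i ξ) :=
  add_pos_of_pos_of_nonneg (jumpProb_pos h β₀ β hd _) (sum_escape_nonneg ξ)

theorem escape_eq_series (hd : 0 < d) (ξ : Marks b) :
    escape h β₀ β d ξ = series h β₀ β d (ξ []) (∑ i, escape h β₀ β d (shift i ξ)) := by
  have hsum : Filter.Tendsto (fun n => ∑ i, escapeUpTo h β₀ β d n (shift i ξ)) Filter.atTop
      (nhds (∑ i, escape h β₀ β d (shift i ξ))) :=
    tendsto_finsetSum _ fun i _ => tendsto_escapeUpTo hd _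
  exact tendsto_nhds_unique ((tendsto_escapeUpTo hd ξ).comp (Filter.tendsto_add_atTop_nat 1))
    ((hsum.div (hsum.const_add _) (jumpProb_neg_add_sum_escape_pos hd ξ).ne').const_mul _)

theorem escape_eq_mul_escapeProb (hd : 0 < d) (ξ : Marks b) :
    escape h β₀ β d ξ = jumpProb h β₀ β d (ξ []) * escapeProb h β₀ β d ξ :=
  escape_eq_series hd ξ

theorem escapeProb_nonneg (ξ : Marks b) : 0 ≤ escapeProb h β₀ β d ξ :=
  div_nonneg (sum_escape_nonneg ξ)
    (add_nonneg (jumpProb_nonneg h β₀ β _) (sum_escape_nonneg ξ))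

theorem one_sub_escapeProb (hd : 0 < d) (ξ : Marks b) :
    1 - escapeProb h β₀ β d ξ = jumpProb h β₀ β d (-ξ []) /
      (jumpProb h β₀ β d (-ξ []) + ∑ i, escape h β₀ β d (shift i ξ)) := by
  rw [escapeProb, one_sub_div (jumpProb_neg_add_sum_escape_pos hd ξ).ne', add_sub_cancel_right]

theorem one_sub_escapeProb_nonneg (hd : 0 < d) (ξ : Marks b) :
    0 ≤ 1 - escapeProb h β₀ β d ξ := by
  rw [one_sub_escapeProb hd]
  exact div_nonneg (jumpProb_nonneg h β₀ β _) (jumpProb_neg_add_sum_escape_pos hd ξ).le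

theorem one_sub_escapeProb_le (hd : 0 < d) (ξ : Marks b) (i : Fin b) :
    1 - escapeProb h β₀ β d ξ ≤ 1 / (1 + escape h β₀ β d (shift i ξ)) := by
  have hchild : 0 ≤ escape h β₀ β d (shift i ξ) := escape_nonneg _
  have hsum : escape h β₀ β d (shift i ξ) ≤ ∑ i, escape h β₀ β d (shift i ξ) :=
    escape_shift_le_sum ξ i
  rw [one_sub_escapeProb hd, div_le_div_iff₀ (jumpProb_neg_add_sum_escape_pos hd ξ)
    (by linarith)]
  nlinarith [jumpProb_le_one h β₀ β (d := d) (-ξ [])]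

theorem measurable_escapeUpTo (n : ℕ) :
    Measurable (escapeUpTo h β₀ β d n : Marks b → ℝ) := by
  have hroot : Measurable fun ξ : Marks b => ξ [] := measurable_pi_apply _
  have hjump : Measurable (jumpProb h β₀ β d) := measurable_jumpProb h β₀ β
  induction n with
  | zero => exact hjump.comp hroot
  | succ n ih =>
    have hsum : Measurable fun ξ : Marks b => ∑ i, escapeUpTo h β₀ β d n (shift i ξ) :=
      Finset.measurable_sum _ fun i _ => ih.comp (measurable_shift i)
    exact (hjump.comp hroot).mul (hsum.div ((hjump.comp hroot.neg).add hsum))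

theorem measurable_escape : Measurable (escape h β₀ β d : Marks b → ℝ) :=
  Measurable.iInf fun n => measurable_escapeUpTo n

theorem mul_escape_shift_le (hd : 0 < d) {c : ℝ} (hc : 0 < c) {ξ : Marks b}
    (hξ : c ≤ jumpProb h β₀ β d (ξ [])) (i : Fin b) :
    c / 2 * escape h β₀ β d (shift i ξ) ≤ escape h β₀ β d ξ := by
  rw [escape_eq_series hd ξ]
  refine le_trans ?_ (series_mono hd (escape_nonneg _) (escape_shift_le_sum ξ i))
  have hy0 : 0 ≤ escape h β₀ β d (shift i ξ) := escape_nonneg _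
  have hy1 : escape h β₀ β d (shift i ξ) ≤ 1 := escape_le_one _
  set y := escape h β₀ β d (shift i ξ)
  have hhalf : y / 2 ≤ y / (jumpProb h β₀ β d (-ξ []) + y) :=
    div_le_div_of_nonneg_left hy0 (by linarith [jumpProb_pos h β₀ β hd (-ξ [])])
      (by linarith [jumpProb_le_one h β₀ β (d := d) (-ξ [])])
  calc c / 2 * y = c * (y / 2) := by ring
    _ ≤ series h β₀ β d (ξ []) y := mul_le_mul hξ hhalf (by positivity) (hc.le.trans hξ)

end Escape

/-! ### A subharmonic function of the branching random walk in a strip -/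

section Strip

theorem ReversibleAt.integral_exp_half_mul_comp_neg {μ : Measure ℝ} {β₀ : ℝ}
    (hrev : ReversibleAt μ β₀) (hbdd : EssBounded μ) {g : ℝ → ℝ} (hg : Measurable g) {C : ℝ}
    (hC : ∀ x, |g x| ≤ C) :
    ∫ x, Real.exp (β₀ / 2 * x) * g (-x) ∂μ = ∫ x, Real.exp (β₀ / 2 * x) * g x ∂μ := by
  obtain ⟨M, hM⟩ := hbdd
  let f : ℝ → ℝ := fun x => if |x| ≤ M then Real.exp (-(β₀ / 2 * x)) * g x else 0
  have hf : Measurable f :=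
    Measurable.ite (measurableSet_le (by fun_prop) (by fun_prop)) (by fun_prop) (by fun_prop)
  have hfC : ∀ x, |f x| ≤ Real.exp (|β₀ / 2| * |M|) * C := by
    intro x
    have hC0 : 0 ≤ C := (abs_nonneg _).trans (hC 0)
    simp only [f]
    split_ifs with hx
    · rw [abs_mul, Real.abs_exp]
      refine mul_le_mul (Real.exp_le_exp.2 ?_) (hC x) (abs_nonneg _) (Real.exp_pos _).le
      calc -(β₀ / 2 * x) ≤ |β₀ / 2 * x| := neg_le_abs _
        _ = |β₀ / 2| * |x| := abs_mul _ _
        _ ≤ |β₀ / 2| * |M| := mul_le_mul_of_nonneg_left (hx.trans (le_abs_self M)) (abs_nonneg _)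
    · rw [abs_zero]
      positivity
  calc ∫ x, Real.exp (β₀ / 2 * x) * g (-x) ∂μ = ∫ x, f (-x) ∂μ := by
        refine integral_congr_ae (hM.mono fun x hx => ?_)
        simp only [f, abs_neg, if_pos hx, mul_neg, neg_neg]
    _ = ∫ x, Real.exp (β₀ * x) * f x ∂μ := (hrev f hf ⟨_, hfC⟩).symm
    _ = ∫ x, Real.exp (β₀ / 2 * x) * g x ∂μ := by
        refine integral_congr_ae (hM.mono fun x hx => ?_)
        simp only [f, if_pos hx]
        rw [← mul_assoc, ← Real.exp_add]
        ring_nf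

theorem ReversibleAt.integral_exp_half_mul_sin {μ : Measure ℝ} {β₀ : ℝ}
    (hrev : ReversibleAt μ β₀) (hbdd : EssBounded μ) (θ : ℝ) :
    ∫ x, Real.exp (β₀ / 2 * x) * Real.sin (θ * x) ∂μ = 0 := by
  have hsymm := hrev.integral_exp_half_mul_comp_neg hbdd (g := fun x => Real.sin (θ * x))
    (by fun_prop) fun x => Real.abs_sin_le_one _
  simp only [mul_neg, Real.sin_neg, integral_neg] at hsymm
  linarith

theorem EssBounded.integrable_exp_mul {μ : Measure ℝ} [IsFiniteMeasure μ] (hbdd : EssBounded μ)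
    (t : ℝ) : Integrable (fun x => Real.exp (t * x)) μ :=
  let ⟨_, hM⟩ := hbdd
  integrable_exp_mul_of_mem_Icc aemeasurable_id (hM.mono fun _ hx => abs_le.1 hx)

theorem ReversibleAt.integral_exp_half_mul_cos_add {μ : Measure ℝ} [IsFiniteMeasure μ] {β₀ : ℝ}
    (hrev : ReversibleAt μ β₀) (hbdd : EssBounded μ) (θ s : ℝ) :
    ∫ x, Real.exp (β₀ / 2 * x) * Real.cos (θ * (s + x)) ∂μ
      = Real.cos (θ * s) * ∫ x, Real.exp (β₀ / 2 * x) * Real.cos (θ * x) ∂μ := by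
  have hcos : Integrable (fun x => Real.exp (β₀ / 2 * x) * Real.cos (θ * x)) μ :=
    (hbdd.integrable_exp_mul _).mul_bdd (c := 1) (by fun_prop)
      (Filter.Eventually.of_forall fun x => Real.abs_cos_le_one _)
  have hsin : Integrable (fun x => Real.exp (β₀ / 2 * x) * Real.sin (θ * x)) μ :=
    (hbdd.integrable_exp_mul _).mul_bdd (c := 1) (by fun_prop)
      (Filter.Eventually.of_forall fun x => Real.abs_sin_le_one _)
  calc ∫ x, Real.exp (β₀ / 2 * x) * Real.cos (θ * (s + x)) ∂μ
      = ∫ x, Real.cos (θ * s) * (Real.exp (β₀ / 2 * x) * Real.cos (θ * x))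
          - Real.sin (θ * s) * (Real.exp (β₀ / 2 * x) * Real.sin (θ * x)) ∂μ := by
        congr with x
        rw [mul_add, Real.cos_add]
        ring
    _ = _ := by
        rw [integral_sub (hcos.const_mul _) (hsin.const_mul _), integral_const_mul,
          integral_const_mul, hrev.integral_exp_half_mul_sin hbdd, mul_zero, sub_zero]

theorem cos_mul_integral_exp_mul_le {μ : Measure ℝ} [IsFiniteMeasure μ] {M : ℝ}
    (hM : ∀ᵐ x ∂μ, |x| ≤ M) (α : ℝ) {θ : ℝ} (hθ : 0 ≤ θ) (hθM : θ * M ≤ Real.pi) :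
    Real.cos (θ * M) * ∫ x, Real.exp (α * x) ∂μ
      ≤ ∫ x, Real.exp (α * x) * Real.cos (θ * x) ∂μ := by
  have hexp : Integrable (fun x => Real.exp (α * x)) μ := EssBounded.integrable_exp_mul ⟨M, hM⟩ α
  rw [← integral_const_mul]
  refine integral_mono_ae (hexp.const_mul _) (hexp.mul_bdd (c := 1) (by fun_prop)
    (Filter.Eventually.of_forall fun x => Real.abs_cos_le_one _)) (hM.mono fun x hx => ?_)
  simp only
  rw [mul_comm, ← Real.cos_abs (θ * x), abs_mul, abs_of_nonneg hθ]
  exact mul_le_mul_of_nonneg_left (Real.cos_le_cos_of_nonneg_of_le_pi (by positivity) hθM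
    (mul_le_mul_of_nonneg_left hx hθ)) (Real.exp_pos _).le

/-- The exponentially tilted ground state `exp (α s) cos (π s / (2 A))` of the strip `|s| ≤ A`,
extended by zero. -/
noncomputable def stripFun (α A s : ℝ) : ℝ :=
  if |s| ≤ A then Real.exp (α * s) * Real.cos (Real.pi / 2 / A * s) else 0

variable {α A : ℝ}

theorem measurable_stripFun : Measurable (stripFun α A) :=
  Measurable.ite (measurableSet_le (by fun_prop) (by fun_prop)) (by fun_prop) (by fun_prop)

theorem stripFun_of_abs_le {s : ℝ} (hs : |s| ≤ A) :
    stripFun α A s = Real.exp (α * s) * Real.cos (Real.pi / 2 / A * s) :=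
  if_pos hs

theorem stripFun_nonneg (hA : 0 < A) (s : ℝ) : 0 ≤ stripFun α A s := by
  unfold stripFun
  split_ifs with hs
  · have hangle : |Real.pi / 2 / A * s| ≤ Real.pi / 2 := by
      rw [div_mul_eq_mul_div, abs_div, abs_mul, abs_of_pos hA, abs_of_pos Real.pi_div_two_pos]
      exact div_le_of_le_mul₀ hA.le Real.pi_div_two_pos.le
        (mul_le_mul_of_nonneg_left hs Real.pi_div_two_pos.le)
    exact mul_nonneg (Real.exp_pos _).le
      (Real.cos_nonneg_of_neg_pi_div_two_le_of_le (abs_le.1 hangle).1 (abs_le.1 hangle).2)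
  · exact le_rfl

theorem stripFun_le (s : ℝ) : stripFun α A s ≤ Real.exp (|α| * A) := by
  unfold stripFun
  split_ifs with hs
  · refine (mul_le_of_le_one_right (Real.exp_pos _).le (Real.cos_le_one _)).trans
      (Real.exp_le_exp.2 ?_)
    calc α * s ≤ |α * s| := le_abs_self _
      _ = |α| * |s| := abs_mul _ _
      _ ≤ |α| * A := mul_le_mul_of_nonneg_left hs (abs_nonneg _)
  · exact (Real.exp_pos _).le

/-- Cutting off the cosine only increases it up to its next zero, beyond the reach of a jump. -/
theorem exp_mul_cos_le_stripFun (hA : 0 < A) {s : ℝ} (hs : |s| ≤ 2 * A) :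
    Real.exp (α * s) * Real.cos (Real.pi / 2 / A * s) ≤ stripFun α A s := by
  unfold stripFun
  split_ifs with hsA
  · exact le_rfl
  · have hAs : A ≤ |s| := (not_le.1 hsA).le
    have hangle : |Real.pi / 2 / A * s| = Real.pi / 2 * (|s| / A) := by
      rw [abs_mul, abs_of_pos (by positivity)]
      ring
    refine mul_nonpos_of_nonneg_of_nonpos (Real.exp_pos _).le ?_
    rw [← Real.cos_abs, hangle]
    refine Real.cos_nonpos_of_pi_div_two_le_of_le ?_ ?_
    · exact le_mul_of_one_le_right Real.pi_div_two_pos.le ((one_le_div hA).2 hAs)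
    · nlinarith [(div_le_iff₀ hA).2 hs, Real.pi_pos]

theorem integrable_stripFun_add {μ : Measure ℝ} [IsFiniteMeasure μ] (hA : 0 < A) (s : ℝ) :
    Integrable (fun x => stripFun α A (s + x)) μ :=
  .of_bound (measurable_stripFun.comp (measurable_const_add s)).aestronglyMeasurable _
    (Filter.Eventually.of_forall fun _ =>
      (Real.norm_of_nonneg (stripFun_nonneg hA _)).trans_le (stripFun_le _))

theorem ReversibleAt.mul_stripFun_le_integral {μ : Measure ℝ} [IsFiniteMeasure μ] {β₀ : ℝ}
    (hrev : ReversibleAt μ β₀) {M : ℝ} (hM : ∀ᵐ x ∂μ, |x| ≤ M) (hA : 0 < A) (hMA : M ≤ A) {s : ℝ}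
    (hs : |s| ≤ A) :
    Real.cos (Real.pi / 2 / A * M) * (∫ x, Real.exp (β₀ / 2 * x) ∂μ) * stripFun (β₀ / 2) A s
      ≤ ∫ x, stripFun (β₀ / 2) A (s + x) ∂μ := by
  set θ := Real.pi / 2 / A
  have hθ : 0 ≤ θ := by positivity
  have hθA : θ * A = Real.pi / 2 := div_mul_cancel₀ _ hA.ne'
  have hθM : θ * M ≤ Real.pi := by
    linarith [mul_le_mul_of_nonneg_left hMA hθ, Real.pi_pos]
  have hbdd : EssBounded μ := ⟨M, hM⟩
  calc Real.cos (θ * M) * (∫ x, Real.exp (β₀ / 2 * x) ∂μ) * stripFun (β₀ / 2) A s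
      ≤ (∫ x, Real.exp (β₀ / 2 * x) * Real.cos (θ * x) ∂μ) * stripFun (β₀ / 2) A s :=
        mul_le_mul_of_nonneg_right (cos_mul_integral_exp_mul_le hM _ hθ hθM)
          (stripFun_nonneg hA s)
    _ = Real.exp (β₀ / 2 * s) * ∫ x, Real.exp (β₀ / 2 * x) * Real.cos (θ * (s + x)) ∂μ := by
        rw [hrev.integral_exp_half_mul_cos_add hbdd, stripFun_of_abs_le hs]
        ring
    _ = ∫ x, Real.exp (β₀ / 2 * (s + x)) * Real.cos (θ * (s + x)) ∂μ := by
        simp only [mul_add (β₀ / 2), Real.exp_add, mul_assoc, integral_const_mul]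
    _ ≤ ∫ x, stripFun (β₀ / 2) A (s + x) ∂μ := by
        refine integral_mono_ae ?_ (integrable_stripFun_add hA s) (hM.mono fun x hx =>
          exp_mul_cos_le_stripFun hA ((abs_add_le s x).trans (by linarith)))
        simp only [mul_add (β₀ / 2), Real.exp_add]
        exact ((hbdd.integrable_exp_mul _).const_mul _).mul_bdd (c := 1) (by fun_prop)
          (Filter.Eventually.of_forall fun x => Real.abs_cos_le_one _)

/-- A function supported in a strip which is strictly subharmonic there for the mean kernel of
the branching random walk with `b` offspring and displacement law `μ`. -/
structure StripFunction (b : ℕ) (μ : Measure ℝ) where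
  /-- the half-width of the strip -/
  width : ℝ
  /-- the expansion factor -/
  rate : ℝ
  toFun : ℝ → ℝ
  bound : ℝ
  width_pos : 0 < width
  one_lt_rate : 1 < rate
  measurable : Measurable toFun
  nonneg : ∀ s, 0 ≤ toFun s
  eq_zero : ∀ s, width < |s| → toFun s = 0
  le_bound : ∀ s, toFun s ≤ bound
  zero_pos : 0 < toFun 0
  subharmonic : ∀ s, |s| ≤ width → rate * toFun s ≤ b * ∫ x, toFun (s + x) ∂μ

theorem one_lt_mul_integral_exp_of_logLaplace_pos {d : ℕ} (hd : 2 ≤ d) {μ : Measure ℝ}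
    [IsProbabilityMeasure μ] (hbdd : EssBounded μ) (hΛ : 0 < logLaplace d μ α) :
    1 < ((d - 1 : ℕ) : ℝ) * ∫ x, Real.exp (α * x) ∂μ := by
  have hZ : 0 < ∫ x, Real.exp (α * x) ∂μ := integral_exp_pos (hbdd.integrable_exp_mul α)
  have hb : (0 : ℝ) < (d - 1 : ℕ) := by exact_mod_cast Nat.sub_pos_of_lt hd
  rw [logLaplace, ← Nat.cast_pred (by lia), ← Real.log_mul hZ.ne' hb.ne', mul_comm] at hΛ
  exact (Real.log_pos_iff (by positivity)).1 hΛ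

theorem exists_stripFunction {d : ℕ} (hd : 2 ≤ d) {μ : Measure ℝ} [IsProbabilityMeasure μ]
    (hbdd : EssBounded μ) {β₀ : ℝ} (hrev : ReversibleAt μ β₀)
    (hΛ : 0 < logLaplace d μ (β₀ / 2)) : Nonempty (StripFunction (d - 1) μ) := by
  set b : ℝ := ((d - 1 : ℕ) : ℝ)
  set Z := ∫ x, Real.exp (β₀ / 2 * x) ∂μ
  have hZ : 1 < b * Z := one_lt_mul_integral_exp_of_logLaplace_pos hd hbdd hΛ
  obtain ⟨M, hM⟩ := hbdd
  have hlim : Filter.Tendsto (fun A : ℝ => b * (Real.cos (Real.pi / 2 / A * M) * Z))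
      Filter.atTop (nhds (b * Z)) := by
    have hangle : Filter.Tendsto (fun A : ℝ => Real.pi / 2 / A * M) Filter.atTop (nhds 0) := by
      simpa using (Filter.Tendsto.div_atTop tendsto_const_nhds Filter.tendsto_id).mul_const M
    simpa using (((Real.continuous_cos.tendsto 0).comp hangle).mul_const Z).const_mul b
  obtain ⟨A, hrate, hMA, hA⟩ := ((hlim.eventually (lt_mem_nhds hZ)).and
    ((Filter.eventually_ge_atTop M).and (Filter.eventually_gt_atTop 0))).exists
  exact ⟨{
    width := A
    rate := b * (Real.cos (Real.pi / 2 / A * M) * Z)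
    toFun := stripFun (β₀ / 2) A
    bound := Real.exp (|β₀ / 2| * A)
    width_pos := hA
    one_lt_rate := hrate
    measurable := measurable_stripFun
    nonneg := stripFun_nonneg hA
    eq_zero := fun s hs => if_neg (not_le.2 hs)
    le_bound := stripFun_le
    zero_pos := by simp [stripFun, hA.le]
    subharmonic := fun s hs => by
      rw [mul_assoc]
      exact mul_le_mul_of_nonneg_left (hrev.mul_stripFun_le_integral hM hA hMA hs)
        (Nat.cast_nonneg _) }⟩

end Strip

/-! ### Uniform lower bound on the escape weights -/

section Strip

theorem one_sub_prod_one_sub_mem_Icc {ι : Type*} (s : Finset ι) {a : ι → ℝ}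
    (ha : ∀ i ∈ s, a i ∈ Set.Icc 0 1) : 1 - ∏ i ∈ s, (1 - a i) ∈ Set.Icc (0 : ℝ) 1 :=
  ⟨sub_nonneg.2 (Finset.prod_le_one (fun i hi => sub_nonneg.2 (ha i hi).2)
    fun i hi => sub_le_self _ (ha i hi).1),
    sub_le_self _ (Finset.prod_nonneg fun i hi => sub_nonneg.2 (ha i hi).2)⟩

theorem one_sub_prod_one_sub_le_sum {ι : Type*} (s : Finset ι) {a : ι → ℝ}
    (ha : ∀ i ∈ s, a i ∈ Set.Icc 0 1) : 1 - ∏ i ∈ s, (1 - a i) ≤ ∑ i ∈ s, a i := by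
  classical
  induction s using Finset.induction_on with
  | empty => simp
  | insert i s hi ih =>
    have has : ∀ j ∈ s, a j ∈ Set.Icc 0 1 := fun j hj => ha j (Finset.mem_insert_of_mem hj)
    have hai := ha i (Finset.mem_insert_self _ _)
    rw [Finset.sum_insert hi, Finset.prod_insert hi]
    nlinarith [ih has, (one_sub_prod_one_sub_mem_Icc s has).1, hai.1]

/-- Bernoulli's inequality for `(1 + u) ^ n`, since `(1 - u) ^ n * (1 + u) ^ n ≤ 1`. -/
theorem div_one_add_le_one_sub_one_sub_pow (n : ℕ) {u y C : ℝ} (hu : 0 ≤ u) (huC : u ≤ C)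
    (huy : u ≤ y) (hy : y ≤ 1) : n * u / (1 + n * C) ≤ 1 - (1 - y) ^ n := by
  have hinv : (1 - u) ^ n ≤ 1 / (1 + n * u) := by
    rw [le_div_iff₀ (by positivity)]
    calc (1 - u) ^ n * (1 + n * u) ≤ (1 - u) ^ n * (1 + u) ^ n :=
          mul_le_mul_of_nonneg_left (one_add_mul_le_pow (by linarith) n)
            (pow_nonneg (by linarith) n)
      _ = (1 - u ^ 2) ^ n := by rw [← mul_pow]; ring_nf
      _ ≤ 1 := pow_le_one₀ (by nlinarith) (by nlinarith)
  calc n * u / (1 + n * C) ≤ n * u / (1 + n * u) := by gcongr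
    _ = 1 - 1 / (1 + n * u) := by field_simp; ring
    _ ≤ 1 - (1 - u) ^ n := sub_le_sub_left hinv _
    _ ≤ 1 - (1 - y) ^ n :=
      sub_le_sub_left (pow_le_pow_left₀ (by linarith) (by linarith) n) _

variable {b d : ℕ} (h : AcceptanceFunction) (β₀ β A κ : ℝ)

/-- The truncated escape weight of a tree hanging from a vertex of potential `s`, set to zero
when its root is outside the strip. -/
noncomputable def stripEscape (d n : ℕ) (s : ℝ) (ξ : Marks b) : ℝ :=
  if |s + ξ []| ≤ A then min 1 (Real.exp ((β₀ + β) * s) * escapeUpTo h β₀ β d n ξ / κ) else 0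

variable {h β₀ β A κ}

theorem stripEscape_mem_Icc (hκ : 0 < κ) (n : ℕ) (s : ℝ) (ξ : Marks b) :
    stripEscape h β₀ β A κ d n s ξ ∈ Set.Icc (0 : ℝ) 1 := by
  have hweight := escapeUpTo_nonneg (h := h) (β₀ := β₀) (β := β) (d := d) n ξ
  unfold stripEscape
  split_ifs
  · exact ⟨le_min zero_le_one (by positivity), min_le_left _ _⟩
  · exact ⟨le_rfl, zero_le_one⟩

theorem mul_stripEscape_le (hκ : 0 < κ) (n : ℕ) (s : ℝ) (ξ : Marks b) :
    κ * stripEscape h β₀ β A κ d n s ξ ≤ Real.exp ((β₀ + β) * s) * escapeUpTo h β₀ β d n ξ := by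
  have hweight := escapeUpTo_nonneg (h := h) (β₀ := β₀) (β := β) (d := d) n ξ
  rw [mul_comm, ← le_div_iff₀ hκ]
  unfold stripEscape
  split_ifs
  · exact min_le_right _ _
  · positivity

theorem measurable_stripEscape (n : ℕ) :
    Measurable fun p : ℝ × Marks b => stripEscape h β₀ β A κ d n p.1 p.2 := by
  have : Measurable fun p : ℝ × Marks b => p.2 [] :=
    (measurable_pi_apply _).comp measurable_snd
  have : Measurable fun p : ℝ × Marks b => escapeUpTo h β₀ β d n p.2 :=
    (measurable_escapeUpTo n).comp measurable_snd
  unfold stripEscape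
  exact Measurable.ite (measurableSet_le (by fun_prop) (by fun_prop)) (by fun_prop) (by fun_prop)

theorem measurable_stripEscape_right (n : ℕ) (s : ℝ) :
    Measurable (stripEscape h β₀ β A κ d n s : Marks b → ℝ) :=
  (measurable_stripEscape n).comp measurable_prodMk_left

theorem integrable_stripEscape (hκ : 0 < κ) (n : ℕ) (s : ℝ) (P : Measure (Marks b))
    [IsFiniteMeasure P] : Integrable (stripEscape h β₀ β A κ d n s) P :=
  .of_mem_Icc 0 1 (measurable_stripEscape_right n s).aemeasurable
    (Filter.Eventually.of_forall fun ξ => stripEscape_mem_Icc hκ n s ξ)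

theorem integral_mem_Icc {α : Type*} [MeasurableSpace α] {P : Measure α} [IsProbabilityMeasure P]
    {f : α → ℝ} (hf : AEStronglyMeasurable f P) {C : ℝ} (hfC : ∀ x, f x ∈ Set.Icc 0 C) :
    ∫ x, f x ∂P ∈ Set.Icc 0 C := by
  refine ⟨integral_nonneg fun x => (hfC x).1, ?_⟩
  have hint : Integrable f P := .of_mem_Icc 0 C hf.aemeasurable (Filter.Eventually.of_forall hfC)
  simpa using integral_mono hint (integrable_const C) fun x => (hfC x).2

theorem integral_stripEscape_mem_Icc (hκ : 0 < κ) (n : ℕ) (s : ℝ) (P : Measure (Marks b))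
    [IsProbabilityMeasure P] : ∫ ξ, stripEscape h β₀ β A κ d n s ξ ∂P ∈ Set.Icc (0 : ℝ) 1 :=
  integral_mem_Icc (measurable_stripEscape_right n s).aestronglyMeasurable
    fun ξ => stripEscape_mem_Icc hκ n s ξ

theorem le_stripEscape_succ (hd : 0 < d) {c r : ℝ} (hκ : 0 < κ) (hr : 0 ≤ r) (hr1 : r ≤ 1)
    (hκc : ∀ s, |s| ≤ A → κ ≤ c * (1 - r) * Real.exp ((β₀ + β) * s)) (n : ℕ) {s : ℝ}
    {ξ : Marks b} (hs : |s + ξ []| ≤ A) (hc : c ≤ jumpProb h β₀ β d (-ξ [])) :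
    r * (1 - ∏ i, (1 - stripEscape h β₀ β A κ d n (s + ξ []) (shift i ξ)))
      ≤ stripEscape h β₀ β A κ d (n + 1) s ξ := by
  set p := jumpProb h β₀ β d (-ξ [])
  set B := ∑ i, escapeUpTo h β₀ β d n (shift i ξ) with hB_def
  set E := Real.exp ((β₀ + β) * (s + ξ [])) with hE_def
  set q := 1 - ∏ i, (1 - stripEscape h β₀ β A κ d n (s + ξ []) (shift i ξ))
  have hp : 0 < p := jumpProb_pos h β₀ β hd _
  have hB : 0 ≤ B := Finset.sum_nonneg fun i _ => escapeUpTo_nonneg _ _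
  have hq : q ∈ Set.Icc 0 1 :=
    one_sub_prod_one_sub_mem_Icc _ fun i _ => stripEscape_mem_Icc hκ n _ _
  have hκq : κ * q ≤ E * B := by
    calc κ * q ≤ κ * ∑ i, stripEscape h β₀ β A κ d n (s + ξ []) (shift i ξ) :=
          mul_le_mul_of_nonneg_left (one_sub_prod_one_sub_le_sum _ fun i _ =>
            stripEscape_mem_Icc hκ n _ _) hκ.le
      _ ≤ E * B := by
          rw [hB_def, Finset.mul_sum, Finset.mul_sum]
          exact Finset.sum_le_sum fun i _ => mul_stripEscape_le hκ n _ _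
  have hκp : κ ≤ p * (1 - r) * E :=
    (hκc _ hs).trans (mul_le_mul_of_nonneg_right
      (mul_le_mul_of_nonneg_right hc (sub_nonneg.2 hr1)) (Real.exp_pos _).le)
  have hnext : Real.exp ((β₀ + β) * s) * escapeUpTo h β₀ β d (n + 1) ξ
      = E * B * (p / (p + B)) := by
    rw [escapeUpTo, series, jumpProb_eq_exp_mul_neg, hE_def, mul_add, Real.exp_add]
    ring
  have hrq : r * q ≤ 1 := mul_le_one₀ hr1 hq.1 hq.2
  have hmain : r * q * κ * (p + B) ≤ E * B * p := by
    calc r * q * κ * (p + B) = r * p * (κ * q) + r * q * (κ * B) := by ring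
      _ ≤ r * p * (E * B) + 1 * (p * (1 - r) * E * B) := by gcongr
      _ = E * B * p := by ring
  rw [stripEscape, if_pos hs, hnext]
  refine le_min hrq ?_
  rwa [le_div_iff₀ hκ, mul_div_assoc', le_div_iff₀ (by positivity)]

theorem stripEscape_zero_eq_one {c : ℝ} (hκ : 0 < κ)
    (hκc : ∀ s, |s| ≤ A → κ ≤ c * Real.exp ((β₀ + β) * s)) {s : ℝ} {ξ : Marks b}
    (hs : |s + ξ []| ≤ A) (hc : c ≤ jumpProb h β₀ β d (-ξ [])) :
    stripEscape h β₀ β A κ d 0 s ξ = 1 := by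
  rw [stripEscape, if_pos hs]
  refine min_eq_left ?_
  rw [one_le_div hκ, escapeUpTo, jumpProb_eq_exp_mul_neg, ← mul_assoc, ← Real.exp_add, ← mul_add,
    mul_comm]
  exact (hκc _ hs).trans (mul_le_mul_of_nonneg_right hc (Real.exp_pos _).le)

theorem integral_pi_one_sub_prod_one_sub {ι α : Type*} [Fintype ι] [MeasurableSpace α]
    {P : Measure α} [IsProbabilityMeasure P] {a : α → ℝ} (ha : Measurable a)
    (ha01 : ∀ x, a x ∈ Set.Icc 0 1) :
    ∫ ζ : ι → α, (1 - ∏ i, (1 - a (ζ i))) ∂Measure.pi (fun _ => P)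
      = 1 - (1 - ∫ x, a x ∂P) ^ Fintype.card ι := by
  have hprod : Integrable (fun ζ : ι → α => ∏ i, (1 - a (ζ i))) (Measure.pi fun _ => P) := by
    refine .of_mem_Icc 0 1 (Finset.measurable_prod _ fun i _ => measurable_const.sub
      (ha.comp (measurable_pi_apply i))).aemeasurable (Filter.Eventually.of_forall fun ζ => ?_)
    exact ⟨Finset.prod_nonneg fun i _ => sub_nonneg.2 (ha01 _).2,
      Finset.prod_le_one (fun i _ => sub_nonneg.2 (ha01 _).2) fun i _ => sub_le_self _ (ha01 _).1⟩
  have hint : Integrable a P := .of_mem_Icc 0 1 ha.aemeasurable (Filter.Eventually.of_forall ha01)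
  rw [integral_sub (integrable_const 1) hprod,
    integral_fintype_prod_eq_pow (ι := ι) fun x => 1 - a x,
    integral_sub (integrable_const 1) hint]
  simp

theorem integral_comp_root {μ : Measure ℝ} [IsProbabilityMeasure μ] {f : ℝ → ℝ}
    (hf : Measurable f) : ∫ ξ, f (ξ []) ∂marksLaw b μ = ∫ x, f x ∂μ := by
  have hroot : (marksLaw b μ).map (fun ξ => ξ []) = μ :=
    Measure.infinitePi_map_eval (fun _ : List (Fin b) => μ) []
  conv_rhs => rw [← hroot]
  exact (integral_map (measurable_pi_apply _).aemeasurable hf.aestronglyMeasurable).symm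

theorem integral_comp_root_shifts {μ : Measure ℝ} [IsProbabilityMeasure μ]
    {G : ℝ × (Fin b → Marks b) → ℝ}
    (hG : Integrable G (μ.prod (Measure.pi fun _ : Fin b => marksLaw b μ))) :
    ∫ ξ, G (ξ [], fun i => shift i ξ) ∂marksLaw b μ
      = ∫ x, ∫ ζ, G (x, ζ) ∂Measure.pi (fun _ : Fin b => marksLaw b μ) ∂μ := by
  have hmap : Measurable fun ξ : Marks b => (ξ [], fun i => shift i ξ) :=
    (measurable_pi_apply _).prodMk (by fun_prop)
  rw [← integral_prod _ hG, ← map_marksLaw_root_shifts, integral_map hmap.aemeasurable]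
  rw [map_marksLaw_root_shifts]
  exact hG.aestronglyMeasurable

theorem le_integral_stripEscape_succ (hd : 0 < d) {μ : Measure ℝ} [IsProbabilityMeasure μ]
    {c r M : ℝ} (hM : ∀ᵐ x ∂μ, |x| ≤ M) (hκ : 0 < κ) (hr : 0 ≤ r) (hr1 : r ≤ 1)
    (hκc : ∀ s, |s| ≤ A → κ ≤ c * (1 - r) * Real.exp ((β₀ + β) * s))
    (hc : ∀ x, |x| ≤ M → c ≤ jumpProb h β₀ β d x) (n : ℕ) (s : ℝ) :
    ∫ x, (if |s + x| ≤ A then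
        r * (1 - (1 - ∫ ξ, stripEscape h β₀ β A κ d n (s + x) ξ ∂marksLaw b μ) ^ b) else 0) ∂μ
      ≤ ∫ ξ, stripEscape h β₀ β A κ d (n + 1) s ξ ∂marksLaw b μ := by
  let G : ℝ × (Fin b → Marks b) → ℝ := fun p => if |s + p.1| ≤ A then
    r * (1 - ∏ i, (1 - stripEscape h β₀ β A κ d n (s + p.1) (p.2 i))) else 0
  have hG : Measurable G := by
    refine Measurable.ite (measurableSet_le (by fun_prop) (by fun_prop)) ?_ measurable_const
    refine (measurable_const.sub (Finset.measurable_prod _ fun i _ =>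
      measurable_const.sub ?_)).const_mul r
    exact (measurable_stripEscape n).comp (by fun_prop :
      Measurable fun p : ℝ × (Fin b → Marks b) => (s + p.1, p.2 i))
  have hGr : ∀ p, G p ∈ Set.Icc 0 1 := by
    intro p
    have hq := one_sub_prod_one_sub_mem_Icc Finset.univ
      (a := fun i => stripEscape h β₀ β A κ d n (s + p.1) (p.2 i))
      fun i _ => stripEscape_mem_Icc hκ n _ _
    simp only [G]
    split_ifs
    · exact ⟨mul_nonneg hr hq.1, mul_le_one₀ hr1 hq.1 hq.2⟩
    · exact ⟨le_rfl, zero_le_one⟩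
  calc ∫ x, (if |s + x| ≤ A then
        r * (1 - (1 - ∫ ξ, stripEscape h β₀ β A κ d n (s + x) ξ ∂marksLaw b μ) ^ b) else 0) ∂μ
      = ∫ x, ∫ ζ, G (x, ζ) ∂Measure.pi (fun _ : Fin b => marksLaw b μ) ∂μ := by
        congr with x
        simp only [G]
        split_ifs
        · rw [integral_const_mul, integral_pi_one_sub_prod_one_sub
            (measurable_stripEscape_right n _) (stripEscape_mem_Icc hκ n _), Fintype.card_fin]
        · simp
    _ = ∫ ξ, G (ξ [], fun i => shift i ξ) ∂marksLaw b μ :=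
        (integral_comp_root_shifts (.of_mem_Icc 0 1 hG.aemeasurable
          (Filter.Eventually.of_forall hGr))).symm
    _ ≤ ∫ ξ, stripEscape h β₀ β A κ d (n + 1) s ξ ∂marksLaw b μ := by
        refine integral_mono_of_nonneg (Filter.Eventually.of_forall fun ξ => (hGr _).1)
          (integrable_stripEscape hκ _ _ _) ((ae_marksLaw_forall hM).mono fun ξ hξ => ?_)
        simp only [G]
        split_ifs with hs
        · exact le_stripEscape_succ hd hκ hr hr1 hκc n hs (hc _ ((abs_neg _).trans_le (hξ [])))
        · exact (stripEscape_mem_Icc hκ _ _ _).1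

namespace StripFunction

variable {μ : Measure ℝ} (f : StripFunction b μ)

theorem mem_Icc (s : ℝ) : f.toFun s ∈ Set.Icc 0 f.bound := ⟨f.nonneg s, f.le_bound s⟩

theorem bound_pos : 0 < f.bound := f.zero_pos.trans_le (f.le_bound 0)

theorem measurable_comp_add (s : ℝ) : Measurable fun x => f.toFun (s + x) :=
  f.measurable.comp (measurable_const_add s)

variable [IsProbabilityMeasure μ]

theorem integral_mem_Icc (s : ℝ) : ∫ x, f.toFun (s + x) ∂μ ∈ Set.Icc 0 f.bound :=
  MetropolisTree.integral_mem_Icc (f.measurable_comp_add s).aestronglyMeasurable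
    fun _ => f.mem_Icc _

theorem mul_le_mul_one_sub_pow {r δ : ℝ} (hr : 0 ≤ r) (hδ : 0 ≤ δ)
    (hδr : 1 + b * (δ * f.bound) ≤ r * f.rate) {s y : ℝ} (hs : |s| ≤ f.width)
    (hy : δ * ∫ x, f.toFun (s + x) ∂μ ≤ y) (hy1 : y ≤ 1) :
    δ * f.toFun s ≤ r * (1 - (1 - y) ^ b) := by
  obtain ⟨hint0, hint_le⟩ := f.integral_mem_Icc s
  have hC : 0 < 1 + b * (δ * f.bound) := by have := f.bound_pos; positivity
  refine le_trans ?_ (mul_le_mul_of_nonneg_left (div_one_add_le_one_sub_one_sub_pow b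
    (mul_nonneg hδ hint0) (mul_le_mul_of_nonneg_left hint_le hδ) hy hy1) hr)
  rw [mul_div_assoc', le_div_iff₀ hC]
  calc δ * f.toFun s * (1 + b * (δ * f.bound))
      ≤ δ * f.toFun s * (r * f.rate) :=
        mul_le_mul_of_nonneg_left hδr (mul_nonneg hδ (f.nonneg s))
    _ = r * δ * (f.rate * f.toFun s) := by ring
    _ ≤ r * δ * (b * ∫ x, f.toFun (s + x) ∂μ) :=
        mul_le_mul_of_nonneg_left (f.subharmonic s hs) (mul_nonneg hr hδ)
    _ = r * (b * (δ * ∫ x, f.toFun (s + x) ∂μ)) := by ring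

theorem le_integral_stripEscape_zero {c M δ : ℝ} (hM : ∀ᵐ x ∂μ, |x| ≤ M) (hκ : 0 < κ)
    (hκc : ∀ s, |s| ≤ f.width → κ ≤ c * Real.exp ((β₀ + β) * s))
    (hc : ∀ x, |x| ≤ M → c ≤ jumpProb h β₀ β d x) (hδ : 0 ≤ δ) (hδ1 : δ * f.bound ≤ 1) (s : ℝ) :
    δ * ∫ x, f.toFun (s + x) ∂μ
      ≤ ∫ ξ, stripEscape h β₀ β f.width κ d 0 s ξ ∂marksLaw b μ := by
  rw [← integral_comp_root (b := b) (f.measurable_comp_add s), ← integral_const_mul]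
  refine integral_mono_of_nonneg (Filter.Eventually.of_forall fun ξ => mul_nonneg hδ (f.nonneg _))
    (integrable_stripEscape hκ _ _ _) ((ae_marksLaw_forall hM).mono fun ξ hξ => ?_)
  by_cases hs : |s + ξ []| ≤ f.width
  · simp only
    rw [stripEscape_zero_eq_one hκ hκc hs (hc _ ((abs_neg _).trans_le (hξ [])))]
    exact (mul_le_mul_of_nonneg_left (f.le_bound _) hδ).trans hδ1
  · simp only [f.eq_zero _ (not_le.1 hs), mul_zero]
    exact (stripEscape_mem_Icc hκ _ _ _).1

theorem le_integral_stripEscape (hd : 0 < d) {c r M δ : ℝ} (hM : ∀ᵐ x ∂μ, |x| ≤ M) (hκ : 0 < κ)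
    (hr : 0 ≤ r) (hr1 : r ≤ 1)
    (hκc : ∀ s, |s| ≤ f.width → κ ≤ c * (1 - r) * Real.exp ((β₀ + β) * s)) (hc0 : 0 ≤ c)
    (hc : ∀ x, |x| ≤ M → c ≤ jumpProb h β₀ β d x) (hδ : 0 ≤ δ) (hδ1 : δ * f.bound ≤ 1)
    (hδr : 1 + b * (δ * f.bound) ≤ r * f.rate) (n : ℕ) (s : ℝ) :
    δ * ∫ x, f.toFun (s + x) ∂μ
      ≤ ∫ ξ, stripEscape h β₀ β f.width κ d n s ξ ∂marksLaw b μ := by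
  induction n generalizing s with
  | zero =>
    refine f.le_integral_stripEscape_zero hM hκ (fun s hs => (hκc s hs).trans ?_) hc hδ hδ1 s
    exact mul_le_mul_of_nonneg_right (mul_le_of_le_one_right hc0 (by linarith))
      (Real.exp_pos _).le
  | succ n ih =>
    refine le_trans ?_ (le_integral_stripEscape_succ hd hM hκ hr hr1 hκc hc n s)
    let y : ℝ → ℝ := fun s => ∫ ξ, stripEscape h β₀ β f.width κ d n s ξ ∂marksLaw b μ
    have hy : ∀ s, y s ∈ Set.Icc (0 : ℝ) 1 := fun s => integral_stripEscape_mem_Icc hκ n s _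
    have hy_meas : Measurable y :=
      ((measurable_stripEscape n).stronglyMeasurable.integral_prod_right).measurable
    rw [← integral_const_mul]
    refine integral_mono_of_nonneg (Filter.Eventually.of_forall fun x =>
      mul_nonneg hδ (f.nonneg _)) ?_ (Filter.Eventually.of_forall fun x => ?_)
    · refine .of_mem_Icc 0 1 (Measurable.aemeasurable ?_) (Filter.Eventually.of_forall fun x => ?_)
      · exact Measurable.ite (measurableSet_le (by fun_prop) (by fun_prop))
          ((measurable_const.sub ((measurable_const.sub
            (hy_meas.comp (measurable_const_add s))).pow_const b)).const_mul r) measurable_const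
      · have hpow : (1 - y (s + x)) ^ b ∈ Set.Icc (0 : ℝ) 1 :=
          ⟨pow_nonneg (sub_nonneg.2 (hy _).2) b,
            pow_le_one₀ (sub_nonneg.2 (hy _).2) (sub_le_self _ (hy _).1)⟩
        split_ifs
        · exact ⟨mul_nonneg hr (sub_nonneg.2 hpow.2),
            mul_le_one₀ hr1 (sub_nonneg.2 hpow.2) (sub_le_self _ hpow.1)⟩
        · exact ⟨le_rfl, zero_le_one⟩
    · simp only
      split_ifs with hs
      · exact f.mul_le_mul_one_sub_pow hr hδ hδr hs (ih _) (hy _).2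
      · rw [f.eq_zero _ (not_le.1 hs), mul_zero]

theorem exists_le_integral_stripEscape (hd : 0 < d) {M : ℝ} (hM : ∀ᵐ x ∂μ, |x| ≤ M)
    (h : AcceptanceFunction) (β₀ K : ℝ) :
    ∃ κ δ : ℝ, 0 < κ ∧ 0 < δ ∧ δ * f.bound ≤ 1 ∧ ∀ β, |β₀ + β| ≤ K → ∀ n s,
      δ * ∫ x, f.toFun (s + x) ∂μ
        ≤ ∫ ξ, stripEscape h β₀ β f.width κ d n s ξ ∂marksLaw b μ := by
  obtain ⟨c, hc0, -, hc⟩ := exists_pos_le_jumpProb h β₀ hd M K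
  obtain ⟨r, hr, hr1⟩ : ∃ r, f.rate⁻¹ < r ∧ r < 1 := exists_between (inv_lt_one_of_one_lt₀
    f.one_lt_rate)
  have hrate : 0 < f.rate := one_pos.trans f.one_lt_rate
  have hr0 : 0 < r := (inv_pos.2 hrate).trans hr
  have hgap : 0 < r * f.rate - 1 := sub_pos.2 ((inv_lt_iff_one_lt_mul₀ hrate).1 hr)
  have hbound := f.bound_pos
  set η := min 1 ((r * f.rate - 1) / (b + 1))
  have hη : 0 < η := lt_min one_pos (by positivity)
  have hbη : 1 + b * η ≤ r * f.rate := by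
    have : η * (b + 1) ≤ r * f.rate - 1 := (le_div_iff₀ (by positivity)).1 (min_le_right _ _)
    linarith
  refine ⟨c * (1 - r) * Real.exp (-(K * f.width)), η / f.bound,
    mul_pos (mul_pos hc0 (sub_pos.2 hr1)) (Real.exp_pos _), by positivity, ?_,
    fun β hβ n s => f.le_integral_stripEscape hd hM ?_ hr0.le hr1.le ?_ hc0.le
      (fun x hx => hc β x hβ hx) (by positivity) ?_ ?_ n s⟩
  · rw [div_mul_cancel₀ _ hbound.ne']
    exact min_le_left _ _
  · exact mul_pos (mul_pos hc0 (sub_pos.2 hr1)) (Real.exp_pos _)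
  · refine fun s hs => mul_le_mul_of_nonneg_left (Real.exp_le_exp.2 (neg_le_of_abs_le ?_))
      (mul_nonneg hc0.le (sub_nonneg.2 hr1.le))
    rw [abs_mul]
    exact mul_le_mul hβ hs (abs_nonneg _) ((abs_nonneg _).trans hβ)
  · rw [div_mul_cancel₀ _ hbound.ne']
    exact min_le_left _ _
  · rwa [div_mul_cancel₀ _ hbound.ne']

end StripFunction

theorem measure_lt_half_le {α : Type*} [MeasurableSpace α] {P : Measure α}
    [IsProbabilityMeasure P] {g : α → ℝ} (hg : Measurable g) (hg01 : ∀ x, g x ∈ Set.Icc 0 1)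
    {m : ℝ} (hm1 : m ≤ 1) (hm : m ≤ ∫ x, g x ∂P) :
    P {x | g x < m / 2} ≤ ENNReal.ofReal (1 - m / 2) := by
  have hint : Integrable g P := .of_mem_Icc 0 1 hg.aemeasurable (Filter.Eventually.of_forall hg01)
  have hmarkov := mul_meas_ge_le_integral_of_nonneg (μ := P) (f := fun x => 1 - g x)
    (Filter.Eventually.of_forall fun x => sub_nonneg.2 (hg01 x).2)
    ((integrable_const 1).sub hint) (1 - m / 2)
  rw [integral_sub (integrable_const 1) hint, integral_const, probReal_univ, one_smul] at hmarkov
  have hsub : P.real {x | g x < m / 2} ≤ P.real {x | 1 - m / 2 ≤ 1 - g x} :=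
    measureReal_mono fun x (hx : g x < m / 2) => sub_le_sub_left hx.le 1
  rw [← ofReal_measureReal]
  refine ENNReal.ofReal_le_ofReal (hsub.trans ?_)
  nlinarith [sq_nonneg m]

theorem le_integral_min_escape (hd : 0 < d) (hκ : 0 < κ) {P : Measure (Marks b)}
    [IsProbabilityMeasure P] {m : ℝ} (hm : ∀ n, m ≤ ∫ ξ, stripEscape h β₀ β A κ d n 0 ξ ∂P) :
    m ≤ ∫ ξ, min 1 (escape h β₀ β d ξ / κ) ∂P := by
  have hmem : ∀ n (ξ : Marks b), min 1 (escapeUpTo h β₀ β d n ξ / κ) ∈ Set.Icc 0 1 := fun n ξ =>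
    ⟨le_min zero_le_one (div_nonneg (escapeUpTo_nonneg n ξ) hκ.le), min_le_left _ _⟩
  have hmeas : ∀ n, Measurable fun ξ : Marks b => min 1 (escapeUpTo h β₀ β d n ξ / κ) := fun n =>
    measurable_const.min ((measurable_escapeUpTo n).div_const κ)
  have hlim : Filter.Tendsto (fun n => ∫ ξ, min 1 (escapeUpTo h β₀ β d n ξ / κ) ∂P) Filter.atTop
      (nhds (∫ ξ, min 1 (escape h β₀ β d ξ / κ) ∂P)) :=
    tendsto_integral_of_dominated_convergence (fun _ => 1)
      (fun n => (hmeas n).aestronglyMeasurable) (integrable_const 1)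
      (fun n => Filter.Eventually.of_forall fun ξ =>
        (Real.norm_of_nonneg (hmem n ξ).1).trans_le (hmem n ξ).2)
      (Filter.Eventually.of_forall fun ξ =>
        tendsto_const_nhds.min ((tendsto_escapeUpTo hd ξ).div_const κ))
  refine ge_of_tendsto' hlim fun n => (hm n).trans (integral_mono_of_nonneg
    (Filter.Eventually.of_forall fun ξ => (stripEscape_mem_Icc hκ _ _ _).1)
    (.of_mem_Icc 0 1 (hmeas n).aemeasurable (Filter.Eventually.of_forall (hmem n)))
    (Filter.Eventually.of_forall fun ξ => ?_))
  simp only [stripEscape, mul_zero, Real.exp_zero, one_mul]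
  split_ifs
  · exact le_rfl
  · exact (hmem n ξ).1

theorem exists_measure_escape_lt_le (hd : 2 ≤ d) {μ : Measure ℝ} [IsProbabilityMeasure μ]
    (hbdd : EssBounded μ) {β₀ : ℝ} (hrev : ReversibleAt μ β₀)
    (hΛ : 0 < logLaplace d μ (β₀ / 2)) (h : AcceptanceFunction) (K : ℝ) :
    ∃ y q : ℝ, 0 < y ∧ 0 < q ∧ q < 1 ∧ ∀ β, |β| ≤ K →
      marksLaw (d - 1) μ {ξ | escape h β₀ β d ξ < y} ≤ ENNReal.ofReal q := by
  obtain ⟨f⟩ := exists_stripFunction hd hbdd hrev hΛ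
  obtain ⟨M, hM⟩ := hbdd
  have hd0 : 0 < d := by lia
  obtain ⟨κ, δ, hκ, hδ, hδ1, hmean⟩ :=
    f.exists_le_integral_stripEscape hd0 hM h β₀ (|β₀| + K)
  set m := δ * ∫ x, f.toFun (0 + x) ∂μ
  have hm : 0 < m := by
    have hsub := f.subharmonic 0 (by simpa using f.width_pos.le)
    have hrate : 0 < f.rate * f.toFun 0 := mul_pos (one_pos.trans f.one_lt_rate) f.zero_pos
    exact mul_pos hδ (pos_of_mul_pos_right (hrate.trans_le hsub) (Nat.cast_nonneg _))
  have hm1 : m ≤ 1 :=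
    (mul_le_mul_of_nonneg_left (f.integral_mem_Icc 0).2 hδ.le).trans hδ1
  refine ⟨κ * (m / 2), 1 - m / 2, by positivity, by linarith, by linarith, fun β hβ => ?_⟩
  have hβ' : |β₀ + β| ≤ |β₀| + K := (abs_add_le _ _).trans (by linarith)
  have hmem : ∀ ξ : Marks (d - 1), min 1 (escape h β₀ β d ξ / κ) ∈ Set.Icc (0 : ℝ) 1 := fun ξ =>
    ⟨le_min zero_le_one (div_nonneg (escape_nonneg ξ) hκ.le), min_le_left _ _⟩
  refine (measure_mono fun ξ (hξ : escape h β₀ β d ξ < κ * (m / 2)) => ?_).trans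
    (measure_lt_half_le (measurable_const.min (measurable_escape.div_const κ)) hmem hm1
      (le_integral_min_escape hd0 hκ fun n => hmean β hβ' n 0))
  exact (min_le_right _ _).trans_lt ((div_lt_iff₀' hκ).2 hξ)

end Strip

/-! ### Uniform estimates on the environment -/

section Moments

variable {b d : ℕ} {h : AcceptanceFunction} {β₀ β : ℝ} {μ : Measure ℝ} [IsProbabilityMeasure μ]

/- An escape weight is of the order of the largest escape weight of the subtrees below it, so it is
tiny only if those of all the (at least two) independent subtrees are tiny: the exponent of the
tail doubles with every generation. -/
theorem measure_escape_lt_pow_le (hd : 0 < d) (hb : 2 ≤ b) {M c y q : ℝ}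
    (hM : ∀ᵐ x ∂μ, |x| ≤ M) (hc0 : 0 < c)
    (hc : ∀ x, |x| ≤ M → c ≤ jumpProb h β₀ β d x) (hq0 : 0 ≤ q)
    (hq : marksLaw b μ {ξ | escape h β₀ β d ξ < y} ≤ ENNReal.ofReal q) (k : ℕ) :
    marksLaw b μ {ξ | escape h β₀ β d ξ < (c / 2) ^ k * y} ≤ ENNReal.ofReal (q ^ 2 ^ k) := by
  induction k with
  | zero => simpa using hq
  | succ k ih =>
    set S := {ξ : Marks b | escape h β₀ β d ξ < (c / 2) ^ k * y}
    have hS : MeasurableSet S := measurableSet_lt measurable_escape measurable_const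
    have hsub : marksLaw b μ {ξ | escape h β₀ β d ξ < (c / 2) ^ (k + 1) * y}
        ≤ marksLaw b μ ((fun ξ i => shift i ξ) ⁻¹' (Set.univ.pi fun _ : Fin b => S)) := by
      refine measure_mono_ae ?_
      filter_upwards [ae_marksLaw_forall (b := b) hM] with ξ hξ hlt i _
      have hshift : c / 2 * escape h β₀ β d (shift i ξ) < (c / 2) ^ (k + 1) * y :=
        (mul_escape_shift_le hd hc0 (hc _ (hξ [])) i).trans_lt hlt
      rw [pow_succ', mul_assoc] at hshift
      exact lt_of_mul_lt_mul_left hshift (by positivity)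
    refine hsub.trans ?_
    rw [← Measure.map_apply (by fun_prop) (MeasurableSet.univ_pi fun _ => hS),
      map_marksLaw_shifts, Measure.pi_pi, Finset.prod_const, Finset.card_univ, Fintype.card_fin]
    calc marksLaw b μ S ^ b ≤ marksLaw b μ S ^ 2 := pow_le_pow_right_of_le_one' prob_le_one hb
      _ ≤ ENNReal.ofReal (q ^ 2 ^ k) ^ 2 := by gcongr
      _ = _ := by rw [← ENNReal.ofReal_pow (by positivity), ← pow_mul, pow_succ]

end Moments

section Truncation

variable {α : Type*} [MeasurableSpace α] {P : Measure α} [IsProbabilityMeasure P]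

theorem lintegral_le_measure_add {f : α → ENNReal} {s : Set α} (hs : MeasurableSet s)
    {v : ENNReal} (hf : ∀ x, f x ≤ 1) (hfv : ∀ x ∉ s, f x ≤ v) : ∫⁻ x, f x ∂P ≤ P s + v := by
  calc ∫⁻ x, f x ∂P ≤ ∫⁻ x, (s.indicator 1 x + v) ∂P := by
        refine lintegral_mono fun x => ?_
        by_cases hx : x ∈ s
        · simpa [hx] using le_add_right (hf x)
        · simpa [hx] using hfv x hx
    _ = P s + v := by
        rw [lintegral_add_right _ measurable_const, lintegral_indicator_one hs]
        simp

variable {g : α → ℝ} (hg : Measurable g) (hg01 : ∀ x, g x ∈ Set.Icc 0 1)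

include hg hg01

theorem lintegral_one_sub_le {y q : ℝ} (hy : 0 ≤ y) (hq : 0 ≤ q)
    (htail : P {x | g x < y} ≤ ENNReal.ofReal q) :
    ∫⁻ x, ENNReal.ofReal (1 - g x) ∂P ≤ ENNReal.ofReal (1 - y * (1 - q)) := by
  have hint : Integrable g P := .of_mem_Icc 0 1 hg.aemeasurable (Filter.Eventually.of_forall hg01)
  have hint' : Integrable (fun x => 1 - g x) P := (integrable_const 1).sub hint
  rw [← ofReal_integral_eq_lintegral_ofReal hint'
    (Filter.Eventually.of_forall fun x => sub_nonneg.2 (hg01 x).2),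
    integral_sub (integrable_const 1) hint, integral_const, probReal_univ, one_smul]
  have hcompl : P.real {x | y ≤ g x} = 1 - P.real {x | g x < y} := by
    rw [← probReal_compl_eq_one_sub (measurableSet_lt hg measurable_const)]
    simp only [Set.compl_ofPred, not_lt]
  have hprob : P.real {x | g x < y} ≤ q := ENNReal.toReal_le_of_le_ofReal hq htail
  have hmarkov := mul_meas_ge_le_integral_of_nonneg
    (Filter.Eventually.of_forall fun x => (hg01 x).1) hint y
  refine ENNReal.ofReal_le_ofReal (sub_le_sub_left (le_trans ?_ hmarkov) 1)
  rw [hcompl]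
  gcongr

theorem lintegral_one_sub_pow_le {t u : ℝ}
    (htail : P {x | g x < t} ≤ ENNReal.ofReal (Real.exp (-u))) {r : ℕ} (hu : u ≤ r * t) :
    ∫⁻ x, ENNReal.ofReal ((1 - g x) ^ r) ∂P ≤ ENNReal.ofReal (2 * Real.exp (-u)) := by
  have hnonneg : ∀ x, 0 ≤ 1 - g x := fun x => sub_nonneg.2 (hg01 x).2
  refine (lintegral_le_measure_add (v := ENNReal.ofReal (Real.exp (-u)))
    (measurableSet_lt hg measurable_const) (fun x => ?_) fun x hx => ?_).trans
    ((add_le_add_left htail _).trans_eq ?_)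
  · exact ENNReal.ofReal_le_one.2 (pow_le_one₀ (hnonneg x) (sub_le_self _ (hg01 x).1))
  · refine ENNReal.ofReal_le_ofReal ?_
    have htx : t ≤ g x := not_lt.1 hx
    calc (1 - g x) ^ r ≤ Real.exp (-g x) ^ r :=
          pow_le_pow_left₀ (hnonneg x) (Real.one_sub_le_exp_neg _) r
      _ = Real.exp (-(r * g x)) := by rw [← Real.exp_nat_mul, mul_neg]
      _ ≤ Real.exp (-u) := Real.exp_le_exp.2 (neg_le_neg (hu.trans (by gcongr)))
  · rw [← ENNReal.ofReal_add (Real.exp_pos _).le (Real.exp_pos _).le, two_mul]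

theorem lintegral_one_div_one_add_pow_le {t u : ℝ} (ht : 0 ≤ t) (hu : 0 ≤ u)
    (htail : P {x | g x < t} ≤ ENNReal.ofReal u) (p : ℕ) :
    ∫⁻ x, ENNReal.ofReal ((1 / (1 + g x)) ^ p) ∂P
      ≤ ENNReal.ofReal (u + (1 / (1 + t)) ^ p) := by
  have hpos : ∀ x, 0 < 1 + g x := fun x => by linarith [(hg01 x).1]
  refine (lintegral_le_measure_add (v := ENNReal.ofReal ((1 / (1 + t)) ^ p))
    (measurableSet_lt hg measurable_const) (fun x => ?_) fun x hx => ?_).trans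
    ((add_le_add_left htail _).trans_eq ?_)
  · exact ENNReal.ofReal_le_one.2 (pow_le_one₀ (one_div_pos.2 (hpos x)).le
      ((div_le_one (hpos x)).2 (by linarith [(hg01 x).1])))
  · have htx : t ≤ g x := not_lt.1 hx
    refine ENNReal.ofReal_le_ofReal (pow_le_pow_left₀ (one_div_pos.2 (hpos x)).le ?_ p)
    exact one_div_le_one_div_of_le (by linarith) (by linarith)
  · rw [← ENNReal.ofReal_add hu (by positivity)]

end Truncation

section BacktrackSum

variable {b d : ℕ} {h : AcceptanceFunction} {β₀ β : ℝ} {μ : Measure ℝ} [IsProbabilityMeasure μ]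

/-- An upper bound for the sum of the `p`-th powers of the probabilities to backtrack over `s`
levels, where `σ` chooses a sibling of each vertex: before it moves up, the walk may escape through
the subtree of the sibling. -/
noncomputable def backtrackSum (h : AcceptanceFunction) (β₀ β : ℝ) (d p : ℕ) (σ : Fin b → Fin b) :
    ℕ → Marks b → ENNReal
  | 0, _ => 1
  | s + 1, ξ => ∑ i, ENNReal.ofReal ((1 / (1 + escape h β₀ β d (shift (σ i) ξ))) ^ p)
      * backtrackSum h β₀ β d p σ s (shift i ξ)

theorem measurable_one_div_one_add_escape_pow (p : ℕ) :
    Measurable fun ξ : Marks b => ENNReal.ofReal ((1 / (1 + escape h β₀ β d ξ)) ^ p) :=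
  (((measurable_escape.const_add 1).const_div 1).pow_const p).ennreal_ofReal

theorem measurable_backtrackSum (p : ℕ) (σ : Fin b → Fin b) (s : ℕ) :
    Measurable (backtrackSum h β₀ β d p σ s) := by
  induction s with
  | zero => exact measurable_const
  | succ s ih =>
    exact Finset.measurable_sum _ fun i _ => ((measurable_one_div_one_add_escape_pow p).comp
      (measurable_shift (σ i))).mul (ih.comp (measurable_shift i))

theorem lintegral_backtrackSum (p : ℕ) {σ : Fin b → Fin b} (hσ : ∀ i, σ i ≠ i) (s : ℕ) :
    ∫⁻ ξ, backtrackSum h β₀ β d p σ s ξ ∂marksLaw b μ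
      = (b * ∫⁻ ξ, ENNReal.ofReal ((1 / (1 + escape h β₀ β d ξ)) ^ p) ∂marksLaw b μ) ^ s := by
  induction s with
  | zero => simp [backtrackSum]
  | succ s ih =>
    simp only [backtrackSum]
    have hmeas : ∀ i ∈ (Finset.univ : Finset (Fin b)), Measurable fun ξ : Marks b =>
        ENNReal.ofReal ((1 / (1 + escape h β₀ β d (shift (σ i) ξ))) ^ p)
          * backtrackSum h β₀ β d p σ s (shift i ξ) := fun i _ =>
      ((measurable_one_div_one_add_escape_pow p).comp (measurable_shift (σ i))).mul
        ((measurable_backtrackSum p σ s).comp (measurable_shift i))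
    rw [lintegral_finsetSum _ hmeas, Finset.sum_congr rfl fun i _ =>
      lintegral_comp_shift_mul_comp_shift μ (hσ i) (measurable_one_div_one_add_escape_pow p)
        (measurable_backtrackSum p σ s), ih]
    simp only [Finset.sum_const, Finset.card_univ, Fintype.card_fin, nsmul_eq_mul, pow_succ']
    ring

end BacktrackSum

/-- The estimates on the environment on which the bounds for the walk rest, with constants that do
not depend on `β` as long as `|β| ≤ K`. -/
structure EnvEstimates (d : ℕ) (μ : Measure ℝ) [IsProbabilityMeasure μ] (β₀ : ℝ)
    (h : AcceptanceFunction) (K : ℝ) where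
  /-- a bound for the probability not to escape -/
  ρ : ℝ
  /-- the exponent of the tail of the inverse escape weight -/
  a : ℝ
  /-- the rate of the tail of the inverse escape weight -/
  c : ℝ
  /-- the order of the moment of the backtracking probabilities -/
  p : ℕ
  ρ_pos : 0 < ρ
  ρ_lt_one : ρ < 1
  a_pos : 0 < a
  a_le_one : a ≤ 1
  c_pos : 0 < c
  p_pos : 0 < p
  lintegral_one_sub : ∀ β, |β| ≤ K →
    ∫⁻ ξ, ENNReal.ofReal (1 - escape h β₀ β d ξ) ∂marksLaw (d - 1) μ ≤ ENNReal.ofReal ρ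
  lintegral_pow : ∀ β, |β| ≤ K → ∀ r : ℕ, 0 < r →
    ∫⁻ ξ, ENNReal.ofReal ((1 - escape h β₀ β d ξ) ^ r) ∂marksLaw (d - 1) μ
      ≤ ENNReal.ofReal (2 * Real.exp (-(c * (r : ℝ) ^ a)))
  lintegral_backtrack : ∀ β, |β| ≤ K →
    ((d - 1 : ℕ) : ENNReal) * ∫⁻ ξ, ENNReal.ofReal ((1 / (1 + escape h β₀ β d ξ)) ^ p)
      ∂marksLaw (d - 1) μ ≤ ENNReal.ofReal (1 / 4)

theorem exists_rpow_le_mul_pow_and_le_pow {θ : ℝ} (hθ : 0 < θ) :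
    ∃ a : ℝ, 0 < a ∧ a ≤ 1 ∧ ∀ r : ℝ, 1 ≤ r → ∃ k : ℕ, r ^ a ≤ r * θ ^ k ∧ r ^ a ≤ 2 * 2 ^ k := by
  obtain ⟨L, hL⟩ := exists_pow_lt_of_lt_one hθ one_half_lt_one
  refine ⟨((L + 1 : ℕ) : ℝ)⁻¹, by positivity, Nat.cast_inv_le_one _, fun r hr => ?_⟩
  set x := r ^ ((L + 1 : ℕ) : ℝ)⁻¹ with hx
  have hx1 : 1 ≤ x := Real.one_le_rpow hr (by positivity)
  have hrx : r = x * x ^ L := by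
    rw [← pow_succ', hx, Real.rpow_inv_natCast_pow (by positivity) L.succ_ne_zero]
  obtain ⟨k, hk, hk'⟩ := exists_nat_pow_near hx1 one_lt_two
  refine ⟨k, ?_, by simpa only [pow_succ'] using hk'.le⟩
  have hone : 1 ≤ x ^ L * θ ^ k := by
    calc (1 : ℝ) = ((2 : ℝ) ^ k) ^ L * ((1 / 2) ^ L) ^ k := by
          rw [← pow_mul, ← pow_mul, mul_comm L k, ← mul_pow]
          norm_num
      _ ≤ x ^ L * θ ^ k := by gcongr
  calc x ≤ x * (x ^ L * θ ^ k) := le_mul_of_one_le_right (by positivity) hone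
    _ = r * θ ^ k := by rw [hrx, mul_assoc]

theorem exists_pow_two_pow_add_pow_le {q θ y ε : ℝ} (hq0 : 0 ≤ q) (hq1 : q < 1) (hθ : 0 < θ)
    (hy : 0 < y) (hε : 0 < ε) :
    ∃ k p : ℕ, 0 < p ∧ q ^ 2 ^ k + (1 / (1 + θ ^ k * y)) ^ p ≤ ε := by
  obtain ⟨k, hk⟩ := exists_pow_lt_of_lt_one (half_pos hε) hq1
  have hk' : q ^ 2 ^ k ≤ ε / 2 :=
    (pow_le_pow_of_le_one hq0 hq1.le Nat.lt_two_pow_self.le).trans hk.le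
  have hθy : 0 < θ ^ k * y := by positivity
  have hlt : 1 / (1 + θ ^ k * y) < 1 := (div_lt_one (by positivity)).2 (by linarith)
  obtain ⟨p, hp⟩ := exists_pow_lt_of_lt_one (half_pos hε) hlt
  have hp' : (1 / (1 + θ ^ k * y)) ^ (p + 1) ≤ ε / 2 :=
    (pow_le_pow_of_le_one (by positivity) hlt.le p.le_succ).trans hp.le
  exact ⟨k, p + 1, p.succ_pos, by linarith⟩

theorem exists_measure_escape_lt_pow_le {d : ℕ} (hd : 3 ≤ d) {μ : Measure ℝ}
    [IsProbabilityMeasure μ] (hbdd : EssBounded μ) {β₀ : ℝ} (hrev : ReversibleAt μ β₀)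
    (hΛ : 0 < logLaplace d μ (β₀ / 2)) (h : AcceptanceFunction) (K : ℝ) :
    ∃ y θ q : ℝ, 0 < y ∧ 0 < θ ∧ 0 < q ∧ q < 1 ∧ ∀ β, |β| ≤ K → ∀ k : ℕ,
      marksLaw (d - 1) μ {ξ | escape h β₀ β d ξ < θ ^ k * y} ≤ ENNReal.ofReal (q ^ 2 ^ k) := by
  obtain ⟨y, q, hy, hq0, hq1, hq⟩ := exists_measure_escape_lt_le (by omega) hbdd hrev hΛ h K
  obtain ⟨M, hM⟩ := hbdd
  obtain ⟨m, hm0, -, hm⟩ := exists_pos_le_jumpProb h β₀ (d := d) (by omega) M (|β₀| + K)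
  refine ⟨y, m / 2, q, hy, half_pos hm0, hq0, hq1, fun β hβ => ?_⟩
  have hK : |β₀ + β| ≤ |β₀| + K := (abs_add_le _ _).trans (by gcongr)
  exact measure_escape_lt_pow_le (by omega) (by omega) hM hm0 (fun x => hm β x hK) hq0.le (hq β hβ)

theorem escape_mem_Icc {b d : ℕ} {h : AcceptanceFunction} {β₀ β : ℝ} (ξ : Marks b) :
    escape h β₀ β d ξ ∈ Set.Icc 0 1 :=
  ⟨escape_nonneg ξ, escape_le_one ξ⟩

theorem exists_envEstimates {d : ℕ} (hd : 3 ≤ d) {μ : Measure ℝ} [IsProbabilityMeasure μ]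
    (hbdd : EssBounded μ) {β₀ : ℝ} (hrev : ReversibleAt μ β₀)
    (hΛ : 0 < logLaplace d μ (β₀ / 2)) (h : AcceptanceFunction) (K : ℝ) :
    Nonempty (EnvEstimates d μ β₀ h K) := by
  obtain ⟨y, θ, q, hy, hθ, hq0, hq1, htail⟩ := exists_measure_escape_lt_pow_le hd hbdd hrev hΛ h K
  obtain ⟨a, ha0, ha1, ha⟩ := exists_rpow_le_mul_pow_and_le_pow hθ
  have hd1 : (0 : ℝ) < ((d - 1 : ℕ) : ℝ) := by exact_mod_cast (by omega : 0 < d - 1)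
  obtain ⟨k, p, hp, hkp⟩ := exists_pow_two_pow_add_pow_le hq0.le hq1 hθ hy
    (show (0 : ℝ) < 1 / 4 / ((d - 1 : ℕ) : ℝ) by positivity)
  have hlog : 0 < -Real.log q := neg_pos.2 (Real.log_neg hq0 hq1)
  refine ⟨⟨max (1 / 2) (1 - y * (1 - q)), a, min y (-Real.log q / 2), p,
    lt_max_of_lt_left one_half_pos, max_lt one_half_lt_one ?_, ha0, ha1,
    lt_min hy (half_pos hlog), hp, fun β hβ => ?_, fun β hβ r hr => ?_, fun β hβ => ?_⟩⟩
  · exact sub_lt_self _ (mul_pos hy (sub_pos.2 hq1))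
  · refine (lintegral_one_sub_le measurable_escape escape_mem_Icc hy.le hq0.le ?_).trans
      (ENNReal.ofReal_le_ofReal (le_max_right _ _))
    simpa using htail β hβ 0
  · obtain ⟨j, hj, hj'⟩ := ha r (by exact_mod_cast hr)
    have hra : (0 : ℝ) ≤ (r : ℝ) ^ a := by positivity
    refine lintegral_one_sub_pow_le measurable_escape escape_mem_Icc ((htail β hβ j).trans
      (ENNReal.ofReal_le_ofReal ?_)) ?_
    · rw [← Real.exp_log hq0, ← Real.exp_nat_mul, Real.exp_le_exp, Real.log_exp]
      push_cast
      nlinarith [min_le_right y (-Real.log q / 2)]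
    · calc min y (-Real.log q / 2) * (r : ℝ) ^ a ≤ y * (r * θ ^ j) := by
            gcongr
            exact min_le_left _ _
        _ = r * (θ ^ j * y) := by ring
  · calc ((d - 1 : ℕ) : ENNReal) * ∫⁻ ξ, ENNReal.ofReal ((1 / (1 + escape h β₀ β d ξ)) ^ p)
          ∂marksLaw (d - 1) μ
        ≤ ((d - 1 : ℕ) : ENNReal) * ENNReal.ofReal (1 / 4 / ((d - 1 : ℕ) : ℝ)) := by
          gcongr
          exact (lintegral_one_div_one_add_pow_le measurable_escape escape_mem_Icc (by positivity)
            (by positivity) (htail β hβ k) p).trans (ENNReal.ofReal_le_ofReal hkp)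
      _ = ENNReal.ofReal (1 / 4) := by
          rw [← ENNReal.ofReal_natCast, ← ENNReal.ofReal_mul hd1.le, mul_div_cancel₀ _ hd1.ne']

variable {d : ℕ}

/-! ### Descendants and subtrees -/

theorem level_eq_level_parent_add_one {w : Vertex d} (hw : w ≠ root) :
    level w = level (parent w) + 1 := by
  rcases w with _ | ⟨i, _ | ⟨j, l⟩⟩
  · exact absurd rfl hw
  · rfl
  · rfl

theorem vertex_induction {C : Vertex d → Prop} (root : C root)
    (edge : ∀ e : Edge d, C (parent (some e)) → C (some e)) (v : Vertex d) : C v := by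
  rcases v with _ | ⟨i, l⟩
  · exact root
  · induction l with
    | nil => exact edge _ root
    | cons j l ih => exact edge _ ih

/-- `StrictDesc v w` says that `w` lies below `v` in the tree and is different from `v`. -/
inductive StrictDesc (v : Vertex d) : Vertex d → Prop
  | child {w : Vertex d} : w ≠ root → parent w = v → StrictDesc v w
  | step {w : Vertex d} : w ≠ root → StrictDesc v (parent w) → StrictDesc v w

namespace StrictDesc

variable {v w : Vertex d}

theorem ne_root (hw : StrictDesc v w) : w ≠ root := by
  cases hw <;> assumption

theorem parent_eq_or (hw : StrictDesc v w) : parent w = v ∨ StrictDesc v (parent w) := by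
  cases hw with
  | child _ hv => exact Or.inl hv
  | step _ hv => exact Or.inr hv

theorem level_lt (hw : StrictDesc v w) : level v < level w := by
  induction hw with
  | child hroot hv => exact (hv ▸ level_eq_level_parent_add_one hroot).symm ▸ Nat.lt_succ_self _
  | step hroot _ ih => exact ih.trans (level_eq_level_parent_add_one hroot ▸ Nat.lt_succ_self _)

theorem trans {u : Vertex d} (hw : StrictDesc v w) (hu : StrictDesc w u) : StrictDesc v u := by
  induction hu with
  | child hroot hv => exact step hroot (hv ▸ hw)
  | step hroot _ ih => exact step hroot ih

theorem append (i : Fin d) (l : List (Fin (d - 1))) :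
    ∀ t : List (Fin (d - 1)), t ≠ [] → StrictDesc (some (i, l)) (some (i, t ++ l))
  | [], ht => absurd rfl ht
  | [_], _ => .child (by simp [root]) rfl
  | _ :: a :: t, _ => .step (by simp [root]) (append i l (a :: t) (by simp))

theorem exists_append {i : Fin d} {l : List (Fin (d - 1))} {w : Vertex d}
    (hw : StrictDesc (some (i, l)) w) :
    ∃ (t : List (Fin (d - 1))) (j : Fin (d - 1)), w = some (i, t ++ j :: l) := by
  induction hw with
  | @child w hroot hv =>
    rcases w with _ | ⟨i', _ | ⟨j, l'⟩⟩
    · exact absurd rfl hroot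
    · simp [parent] at hv
    · simp only [parent, Option.some.injEq, Prod.mk.injEq] at hv
      obtain ⟨rfl, rfl⟩ := hv
      exact ⟨[], j, rfl⟩
  | @step w hroot _ ih =>
    rcases w with _ | ⟨i', _ | ⟨j, l'⟩⟩
    · exact absurd rfl hroot
    · simp [parent] at ih
    · obtain ⟨t, j', ht⟩ := ih
      simp only [parent, Option.some.injEq, Prod.mk.injEq] at ht
      obtain ⟨rfl, rfl⟩ := ht
      exact ⟨j :: t, j', rfl⟩

end StrictDesc

theorem not_strictDesc_self (v : Vertex d) : ¬StrictDesc v v := fun hv => hv.level_lt.false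

theorem parent_notMem_children (e : Edge d) : parent (some e) ∉ children (some e) := by
  intro hmem
  obtain ⟨hroot, hparent⟩ := mem_children.1 hmem
  have hlevel := level_eq_level_parent_add_one hroot
  have hlevel' := level_eq_level_parent_add_one (w := some e) (by simp [root])
  rw [hparent] at hlevel
  omega

theorem sum_neighbors {M : Type*} [AddCommMonoid M] (i : Fin d) (l : List (Fin (d - 1)))
    (f : Vertex d → M) :
    ∑ w ∈ neighbors (some (i, l)), f w
      = f (parent (some (i, l))) + ∑ j, f (some (i, j :: l)) := by
  rw [neighbors, Finset.sum_insert (parent_notMem_children _), children,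
    Finset.sum_image fun j _ j' _ hj => by simpa using hj]

theorem mark_parent_left (ω : Env d) (e : Edge d) : mark ω (parent (some e)) (some e) = ω e := by
  obtain ⟨i, _ | ⟨j, l⟩⟩ := e <;> simp [parent, mark]

theorem mark_parent_right (ω : Env d) (e : Edge d) :
    mark ω (some e) (parent (some e)) = -ω e := by
  obtain ⟨i, _ | ⟨j, l⟩⟩ := e
  · simp [parent, mark]
  · have hne : parent (some (i, l)) ≠ some (i, j :: l) := fun heq =>
      parent_notMem_children (i, l) (heq ▸ mem_children.2 ⟨by simp [root], rfl⟩)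
    have hparent : parent (some (i, j :: l)) = some (i, l) := rfl
    rw [hparent]
    simp only [mark, if_neg hne, if_pos hparent]

/-- The marks of the subtree which hangs from the edge `e`, with the mark of `e` at its root. -/
def subMarks (e : Edge d) (ω : Env d) : Marks (d - 1) := fun l => ω (e.1, l ++ e.2)

@[fun_prop]
theorem measurable_subMarks (e : Edge d) : Measurable (subMarks e) :=
  measurable_pi_lambda _ fun _ => measurable_pi_apply _

theorem subMarks_nil (e : Edge d) (ω : Env d) : subMarks e ω [] = ω e := rfl

theorem subMarks_cons (i : Fin d) (j : Fin (d - 1)) (l : List (Fin (d - 1))) (ω : Env d) :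
    subMarks (i, j :: l) ω = shift j (subMarks (i, l) ω) := by
  funext t
  simp only [subMarks, shift, List.append_assoc, List.singleton_append]

theorem mark_child (ω : Env d) (i : Fin d) (l : List (Fin (d - 1))) (j : Fin (d - 1)) :
    mark ω (some (i, l)) (some (i, j :: l)) = shift j (subMarks (i, l) ω) [] := by
  rw [← subMarks_cons, subMarks_nil]
  exact mark_parent_left ω (i, j :: l)

theorem lintegral_subMarks (μ : Measure ℝ) [IsProbabilityMeasure μ] (e : Edge d)
    {f : Marks (d - 1) → ENNReal} (hf : Measurable f) :
    ∫⁻ ω, f (subMarks e ω) ∂envLaw d μ = ∫⁻ ξ, f ξ ∂marksLaw (d - 1) μ := by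
  have hmap : (envLaw d μ).map (subMarks e) = marksLaw (d - 1) μ :=
    Measure.map_infinitePi_infinitePi_of_inj (P := fun _ : Edge d => μ)
      (f := fun l => (e.1, l ++ e.2)) fun l m hlm => by simpa using hlm
  rw [← hmap, lintegral_map hf (measurable_subMarks e)]

/-! ### Probabilities to leave a lower set -/

/-- Sets of vertices which contain the children of their elements, but not the root. -/
structure IsLower (D : Set (Vertex d)) : Prop where
  root_notMem : root ∉ D
  mem_of_parent : ∀ w, w ≠ root → parent w ∈ D → w ∈ D

theorem isLower_strictDesc (v : Vertex d) : IsLower {w | StrictDesc v w} where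
  root_notMem hr := hr.ne_root rfl
  mem_of_parent _ := StrictDesc.step

theorem IsLower.append_mem {D : Set (Vertex d)} (hD : IsLower D) {i : Fin d}
    {l : List (Fin (d - 1))} (hl : some (i, l) ∈ D) (t : List (Fin (d - 1))) :
    some (i, t ++ l) ∈ D := by
  induction t with
  | nil => exact hl
  | cons a t ih => exact hD.mem_of_parent _ (by simp [root]) ih

section ExitBound

variable (h : AcceptanceFunction) (β₀ β : ℝ)

open Classical in
/-- The probability that the walk started at a vertex ever leaves the lower set `D`: the product of
the probabilities to cross, from below, the edges above the ancestors that lie in `D`. -/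
noncomputable def exitBound (D : Set (Vertex d)) (ω : Env d) : Vertex d → ℝ
  | none => 1
  | some e => (if some e ∈ D then 1 - escapeProb h β₀ β d (subMarks e ω) else 1)
      * exitBound D ω (parent (some e))
termination_by v => level v
decreasing_by
  rw [level_eq_level_parent_add_one (w := some e) (by simp [root])]
  exact Nat.lt_succ_self _

variable {h β₀ β} {D : Set (Vertex d)} {ω : Env d}

theorem exitBound_root : exitBound h β₀ β D ω root = 1 := by
  rw [root, exitBound]

theorem exitBound_of_mem {e : Edge d} (he : some e ∈ D) :
    exitBound h β₀ β D ω (some e)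
      = (1 - escapeProb h β₀ β d (subMarks e ω)) * exitBound h β₀ β D ω (parent (some e)) := by
  rw [exitBound, if_pos he]

theorem exitBound_of_notMem {e : Edge d} (he : some e ∉ D) :
    exitBound h β₀ β D ω (some e) = exitBound h β₀ β D ω (parent (some e)) := by
  rw [exitBound, if_neg he, one_mul]

theorem exitBound_nonneg (hd : 0 < d) (u : Vertex d) : 0 ≤ exitBound h β₀ β D ω u := by
  induction u using vertex_induction with
  | root => exact exitBound_root.symm ▸ zero_le_one
  | edge e ih =>
    by_cases he : some e ∈ D
    · exact exitBound_of_mem he ▸ mul_nonneg (one_sub_escapeProb_nonneg hd _) ih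
    · exact exitBound_of_notMem he ▸ ih

theorem exitBound_le_exitBound_parent (hd : 0 < d) (e : Edge d) :
    exitBound h β₀ β D ω (some e) ≤ exitBound h β₀ β D ω (parent (some e)) := by
  by_cases he : some e ∈ D
  · exact exitBound_of_mem he ▸
      mul_le_of_le_one_left (exitBound_nonneg hd _) (sub_le_self _ (escapeProb_nonneg _))
  · exact (exitBound_of_notMem he).le

theorem exitBound_le_one (hd : 0 < d) (u : Vertex d) : exitBound h β₀ β D ω u ≤ 1 := by
  induction u using vertex_induction with
  | root => exact exitBound_root.le
  | edge e ih => exact (exitBound_le_exitBound_parent hd e).trans ih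

theorem exitBound_eq_one (hD : IsLower D) {u : Vertex d} (hu : u ∉ D) :
    exitBound h β₀ β D ω u = 1 := by
  induction u using vertex_induction with
  | root => exact exitBound_root
  | edge e ih =>
    rw [exitBound_of_notMem hu]
    exact ih fun hp => hu (hD.mem_of_parent _ (by simp [root]) hp)

theorem sum_transProb_mul (ω : Env d) (f : Vertex d → ℝ) (u : Vertex d) :
    ∑ w ∈ insert u (neighbors u), transProb h β₀ β ω u w * f w
      = f u + ∑ w ∈ neighbors u, jumpProb h β₀ β d (mark ω u w) * (f w - f u) := by
  have hself : transProb h β₀ β ω u u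
      = 1 - ∑ w ∈ neighbors u, jumpProb h β₀ β d (mark ω u w) := by
    simp only [transProb, if_neg (notMem_neighbors_self u), if_true]
  have hneighbor : ∀ w ∈ neighbors u, transProb h β₀ β ω u w * f w
      = jumpProb h β₀ β d (mark ω u w) * f w := fun w hw => by
    simp only [transProb, if_pos hw]
  rw [Finset.sum_insert (notMem_neighbors_self u), hself, Finset.sum_congr rfl hneighbor]
  simp only [mul_sub, Finset.sum_sub_distrib, ← Finset.sum_mul]
  ring

theorem jumpProb_mul_exitBound_child_sub (hd : 0 < d) (hD : IsLower D) {i : Fin d}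
    {l : List (Fin (d - 1))} (hl : some (i, l) ∈ D) (j : Fin (d - 1)) :
    jumpProb h β₀ β d (mark ω (some (i, l)) (some (i, j :: l)))
        * (exitBound h β₀ β D ω (some (i, j :: l)) - exitBound h β₀ β D ω (some (i, l)))
      = -(escape h β₀ β d (shift j (subMarks (i, l) ω)) * exitBound h β₀ β D ω (some (i, l))) := by
  have hparent : parent (some (i, j :: l)) = some (i, l) := rfl
  have hmem : some (i, j :: l) ∈ D := hD.append_mem hl [j]
  rw [exitBound_of_mem hmem, hparent, mark_child, subMarks_cons,
    escape_eq_mul_escapeProb hd (shift j (subMarks (i, l) ω))]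
  ring

theorem exitBound_harmonic (hd : 0 < d) (hD : IsLower D) {u : Vertex d} (hu : u ∈ D) :
    ∑ w ∈ insert u (neighbors u), transProb h β₀ β ω u w * exitBound h β₀ β D ω w
      = exitBound h β₀ β D ω u := by
  obtain _ | ⟨i, l⟩ := u
  · exact absurd hu hD.root_notMem
  set ξ := subMarks (i, l) ω with hξ
  have hpB : jumpProb h β₀ β d (-ξ []) + ∑ j, escape h β₀ β d (shift j ξ) ≠ 0 :=
    (jumpProb_neg_add_sum_escape_pos hd ξ).ne'
  rw [sum_transProb_mul, sum_neighbors,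
    Finset.sum_congr rfl fun j _ => jumpProb_mul_exitBound_child_sub hd hD hu j, ← hξ,
    Finset.sum_neg_distrib, ← Finset.sum_mul, mark_parent_right, ← subMarks_nil (i, l) ω, ← hξ,
    exitBound_of_mem hu, ← hξ, one_sub_escapeProb hd]
  field_simp
  ring

theorem ofReal_exitBound_pow_le_mul (hd : 0 < d) (p : ℕ) (σ : Fin (d - 1) → Fin (d - 1))
    (hD : IsLower D) (i : Fin d) (t l : List (Fin (d - 1))) (hl : some (i, l) ∈ D) :
    ENNReal.ofReal (exitBound h β₀ β D ω (some (i, t ++ l)) ^ p)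
      ≤ backtrackSum h β₀ β d p σ t.length (subMarks (i, l) ω)
        * ENNReal.ofReal (exitBound h β₀ β D ω (parent (some (i, l))) ^ p) := by
  induction t using List.reverseRecOn generalizing l with
  | nil =>
    rw [List.nil_append, List.length_nil, backtrackSum, one_mul]
    exact ENNReal.ofReal_le_ofReal (pow_le_pow_left₀ (exitBound_nonneg hd _)
      (exitBound_le_exitBound_parent hd _) p)
  | append_singleton t j ih =>
    set ξ := subMarks (i, l) ω
    have hparent : parent (some (i, j :: l)) = some (i, l) := rfl
    have hfactor : ENNReal.ofReal ((1 - escapeProb h β₀ β d ξ) ^ p)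
        ≤ ENNReal.ofReal ((1 / (1 + escape h β₀ β d (shift (σ j) ξ))) ^ p) :=
      ENNReal.ofReal_le_ofReal (pow_le_pow_left₀ (one_sub_escapeProb_nonneg hd _)
        (one_sub_escapeProb_le hd _ (σ j)) p)
    rw [List.append_assoc, List.singleton_append, List.length_append, List.length_singleton,
      backtrackSum]
    refine (ih (j :: l) (hD.append_mem hl [j])).trans ?_
    rw [subMarks_cons, hparent, exitBound_of_mem hl, mul_pow,
      ENNReal.ofReal_mul (pow_nonneg (one_sub_escapeProb_nonneg hd _) _), ← mul_assoc, mul_comm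
      (backtrackSum _ _ _ _ _ _ _ _)]
    gcongr
    exact (mul_le_mul_left hfactor _).trans (Finset.single_le_sum (f := fun j =>
      ENNReal.ofReal ((1 / (1 + escape h β₀ β d (shift (σ j) ξ))) ^ p)
        * backtrackSum h β₀ β d p σ t.length (shift j ξ)) (fun _ _ => zero_le)
      (Finset.mem_univ j))

theorem ofReal_exitBound_pow_le_backtrackSum (hd : 0 < d) (p : ℕ)
    (σ : Fin (d - 1) → Fin (d - 1)) (hD : IsLower D) (i : Fin d) (t l : List (Fin (d - 1)))
    (hl : some (i, l) ∈ D) (hparent : parent (some (i, l)) ∉ D) :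
    ENNReal.ofReal (exitBound h β₀ β D ω (some (i, t ++ l)) ^ p)
      ≤ backtrackSum h β₀ β d p σ t.length (subMarks (i, l) ω) := by
  simpa [exitBound_eq_one hD hparent] using
    ofReal_exitBound_pow_le_mul (h := h) (β₀ := β₀) (β := β) (ω := ω) hd p σ hD i t l hl

end ExitBound

/-! ### The Markov property -/

/-- The trajectory after time `k`. -/
def shiftPath (k : ℕ) (V : ℕ → Vertex d) : ℕ → Vertex d := fun n => V (n + k)

@[fun_prop]
theorem measurable_shiftPath (k : ℕ) : Measurable (shiftPath k : (ℕ → Vertex d) → _) :=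
  measurable_pi_lambda _ fun _ => measurable_pi_apply _

/-- `Adapted k F` says that the event `F` depends only on the positions up to time `k`. -/
def Adapted (k : ℕ) (F : Set (ℕ → Vertex d)) : Prop :=
  ∀ x y : ℕ → Vertex d, (∀ i ≤ k, x i = y i) → x ∈ F → y ∈ F

/-- The trajectory that follows the finite path `u` and stays at the root afterwards. As `u`
varies, the cylinders of these trajectories form a countable partition of the path space. -/
def extendPath (k : ℕ) (u : Fin (k + 1) → Vertex d) : ℕ → Vertex d := fun i =>
  if hi : i < k + 1 then u ⟨i, hi⟩ else root

theorem mem_pathCylinder_extendPath {k : ℕ} {u : Fin (k + 1) → Vertex d} {V : ℕ → Vertex d} :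
    V ∈ pathCylinder k (extendPath k u) ↔ (fun i : Fin (k + 1) => V i) = u := by
  constructor
  · intro hV
    funext i
    rw [hV i (Nat.lt_succ_iff.1 i.2), extendPath, dif_pos i.2]
  · rintro rfl i hi
    rw [extendPath, dif_pos (Nat.lt_succ_of_le hi)]

theorem measure_eq_tsum_pathCylinder (m : Measure (ℕ → Vertex d)) (k : ℕ)
    {A : Set (ℕ → Vertex d)} (hA : MeasurableSet A) :
    m A = ∑' u : Fin (k + 1) → Vertex d, m (pathCylinder k (extendPath k u) ∩ A) := by
  rw [← measure_iUnion]
  · congr 1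
    ext V
    simp [mem_pathCylinder_extendPath]
  · intro u u' huu'
    refine Set.disjoint_left.2 fun V hV hV' => huu' ?_
    exact (mem_pathCylinder_extendPath.1 hV.1).symm.trans (mem_pathCylinder_extendPath.1 hV'.1)
  · exact fun u => (measurableSet_pathCylinder _ _).inter hA

namespace Adapted

variable {k : ℕ} {F : Set (ℕ → Vertex d)} {x : ℕ → Vertex d}

theorem pathCylinder_subset (hF : Adapted k F) (hx : x ∈ F) : pathCylinder k x ⊆ F :=
  fun _ hy => hF x _ (fun i hi => (hy i hi).symm) hx

theorem pathCylinder_inter_eq_empty (hF : Adapted k F) (hx : x ∉ F) :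
    pathCylinder k x ∩ F = ∅ :=
  Set.eq_empty_of_forall_notMem fun y hy => hx (hF y x hy.1 hy.2)

theorem measurableSet (hF : Adapted k F) : MeasurableSet F := by
  have hunion : F = ⋃ u : {u : Fin (k + 1) → Vertex d // extendPath k u ∈ F},
      pathCylinder k (extendPath k u.1) := by
    ext V
    simp only [Set.mem_iUnion]
    constructor
    · intro hV
      have hmem : V ∈ pathCylinder k (extendPath k fun i => V i) :=
        mem_pathCylinder_extendPath.2 rfl
      exact ⟨⟨_, hF V _ hmem hV⟩, hmem⟩
    · rintro ⟨u, hu⟩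
      exact hF.pathCylinder_subset u.2 hu
  rw [hunion]
  exact MeasurableSet.iUnion fun u => measurableSet_pathCylinder _ _

end Adapted

/-- The trajectory that follows `x` up to time `k` and then `y`, for a trajectory `y` that starts
at `x k`. -/
def concatPath (k : ℕ) (x y : ℕ → Vertex d) : ℕ → Vertex d := fun i =>
  if i ≤ k then x i else y (i - k)

theorem concatPath_of_le {k i : ℕ} (x y : ℕ → Vertex d) (hi : i ≤ k) :
    concatPath k x y i = x i := if_pos hi

theorem concatPath_add {k : ℕ} {x y : ℕ → Vertex d} (hy : y 0 = x k) (i : ℕ) :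
    concatPath k x y (k + i) = y i := by
  rcases i with _ | i
  · rw [Nat.add_zero, concatPath_of_le x y le_rfl, hy]
  · rw [concatPath, if_neg (by omega), Nat.add_sub_cancel_left]

theorem pathCylinder_inter_preimage_shiftPath {k : ℕ} (n : ℕ) {x y : ℕ → Vertex d}
    (hy : y 0 = x k) :
    pathCylinder k x ∩ shiftPath k ⁻¹' pathCylinder n y
      = pathCylinder (k + n) (concatPath k x y) := by
  ext V
  simp only [pathCylinder, shiftPath, Set.mem_inter_iff, Set.mem_preimage, Set.mem_ofPred_eq]
  constructor
  · rintro ⟨hpast, hfuture⟩ i hi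
    rcases le_total i k with hik | hik
    · rw [concatPath_of_le x y hik, hpast i hik]
    · obtain ⟨j, rfl⟩ := Nat.exists_eq_add_of_le hik
      rw [concatPath_add hy, ← hfuture j (by omega), add_comm]
  · intro hV
    refine ⟨fun i hi => ?_, fun i hi => ?_⟩
    · rw [hV i (by omega), concatPath_of_le x y hi]
    · rw [add_comm, hV (k + i) (by omega), concatPath_add hy]

theorem pathCylinder_inter_preimage_shiftPath_eq_empty {k : ℕ} (n : ℕ) {x y : ℕ → Vertex d}
    (hy : y 0 ≠ x k) :
    pathCylinder k x ∩ shiftPath k ⁻¹' pathCylinder n y = ∅ := by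
  refine Set.eq_empty_of_forall_notMem fun V ⟨hpast, hfuture⟩ => hy ?_
  rw [← hfuture 0 (Nat.zero_le n), shiftPath, Nat.zero_add, hpast k le_rfl]

section Quenched

variable (h : AcceptanceFunction) (β₀ β : ℝ)

theorem quenchedLaw_pathCylinder_inter_pathCylinder (v : Vertex d) (ω : Env d) (k n : ℕ)
    (x y : ℕ → Vertex d) :
    quenchedLaw h β₀ β v ω (pathCylinder k x ∩ shiftPath k ⁻¹' pathCylinder n y)
      = quenchedLaw h β₀ β v ω (pathCylinder k x)
        * quenchedLaw h β₀ β (x k) ω (pathCylinder n y) := by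
  by_cases hy : y 0 = x k
  · have hpast : ∀ i ∈ Finset.range k,
        ENNReal.ofReal (transProb h β₀ β ω (concatPath k x y i) (concatPath k x y (i + 1)))
          = ENNReal.ofReal (transProb h β₀ β ω (x i) (x (i + 1))) := by
      intro i hi
      have hik := Finset.mem_range.1 hi
      rw [concatPath_of_le x y hik.le, concatPath_of_le x y hik]
    rw [pathCylinder_inter_preimage_shiftPath n hy]
    simp only [quenchedLaw_pathCylinder]
    rw [Finset.prod_range_add, Finset.prod_congr rfl hpast, concatPath_of_le x y (Nat.zero_le k)]
    simp only [add_assoc, concatPath_add hy]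
    simp [hy, mul_assoc]
  · rw [pathCylinder_inter_preimage_shiftPath_eq_empty n hy, measure_empty,
      quenchedLaw_pathCylinder _ _ _ (x k)]
    simp [Ne.symm hy]

theorem quenchedLaw_pathCylinder_inter_shiftPath (v : Vertex d) (ω : Env d) (k : ℕ)
    (x : ℕ → Vertex d) {E : Set (ℕ → Vertex d)} (hE : MeasurableSet E) :
    quenchedLaw h β₀ β v ω (pathCylinder k x ∩ shiftPath k ⁻¹' E)
      = quenchedLaw h β₀ β v ω (pathCylinder k x) * quenchedLaw h β₀ β (x k) ω E := by
  have hk := measurable_shiftPath (d := d) k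
  set futureLaw := ((quenchedLaw h β₀ β v ω).restrict (pathCylinder k x)).map (shiftPath k)
    with hfuture
  have futureLaw_apply : ∀ S, MeasurableSet S → futureLaw S
      = quenchedLaw h β₀ β v ω (pathCylinder k x ∩ shiftPath k ⁻¹' S) := fun S hS => by
    rw [hfuture, Measure.map_apply hk hS, Measure.restrict_apply (hk hS), Set.inter_comm]
  have heq : futureLaw
      = quenchedLaw h β₀ β v ω (pathCylinder k x) • quenchedLaw h β₀ β (x k) ω := by
    refine ext_of_generate_finite _ generateFrom_pathCylinder isPiSystem_pathCylinder ?_ ?_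
    · rintro _ ⟨n, y, rfl⟩
      rw [futureLaw_apply _ (measurableSet_pathCylinder n y), Measure.smul_apply, smul_eq_mul,
        quenchedLaw_pathCylinder_inter_pathCylinder]
    · rw [futureLaw_apply _ MeasurableSet.univ, Measure.smul_apply, measure_univ]
      simp
  rw [← futureLaw_apply E hE, heq, Measure.smul_apply, smul_eq_mul]

variable {h β₀ β}

theorem quenchedLaw_ae_start (v : Vertex d) (ω : Env d) :
    ∀ᵐ V ∂quenchedLaw h β₀ β v ω, V 0 = v := by
  have hcylinder : (pathCylinder 0 fun _ => v : Set (ℕ → Vertex d)) = {V | V 0 = v} := by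
    ext V
    simp [pathCylinder]
  refine (prob_compl_eq_zero_iff (measurableSet_eq_fun (by fun_prop) (by fun_prop))).2 ?_
  rw [← hcylinder, quenchedLaw_pathCylinder_zero]
  simp

theorem quenchedLaw_inter_shiftPath_le {v : Vertex d} {ω : Env d} {k : ℕ}
    {F E : Set (ℕ → Vertex d)} (hF : Adapted k F) (hE : MeasurableSet E) {c : ENNReal}
    (hc : ∀ V ∈ F, quenchedLaw h β₀ β (V k) ω E ≤ c) :
    quenchedLaw h β₀ β v ω (F ∩ shiftPath k ⁻¹' E) ≤ quenchedLaw h β₀ β v ω F * c := by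
  have hk := measurable_shiftPath (d := d) k
  rw [measure_eq_tsum_pathCylinder _ k (hF.measurableSet.inter (hk hE)),
    measure_eq_tsum_pathCylinder _ k hF.measurableSet, ← ENNReal.tsum_mul_right]
  refine ENNReal.tsum_le_tsum fun u => ?_
  by_cases hu : extendPath k u ∈ F
  · rw [← Set.inter_assoc, Set.inter_eq_left.2 (hF.pathCylinder_subset hu),
      quenchedLaw_pathCylinder_inter_shiftPath _ _ _ _ _ _ _ hE]
    gcongr
    exact hc _ hu
  · rw [← Set.inter_assoc, hF.pathCylinder_inter_eq_empty hu]
    simp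

theorem quenchedLaw_iUnion_inter_shiftPath_le {v : Vertex d} {ω : Env d}
    {F : ℕ → Set (ℕ → Vertex d)} {E : Set (ℕ → Vertex d)} (hF : ∀ k, Adapted k (F k))
    (hdisj : Pairwise (Function.onFun Disjoint F)) (hE : MeasurableSet E) {c : ENNReal}
    (hc : ∀ k, ∀ V ∈ F k, V 0 = v → quenchedLaw h β₀ β (V k) ω E ≤ c) :
    quenchedLaw h β₀ β v ω (⋃ k, F k ∩ shiftPath k ⁻¹' E)
      ≤ quenchedLaw h β₀ β v ω (⋃ k, F k) * c := by
  let G : ℕ → Set (ℕ → Vertex d) := fun k => F k ∩ {V | V 0 = v}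
  have hG : ∀ k, Adapted k (G k) := fun k x y hxy hx =>
    ⟨hF k x y hxy hx.1, (hxy 0 (Nat.zero_le _)).symm.trans hx.2⟩
  calc quenchedLaw h β₀ β v ω (⋃ k, F k ∩ shiftPath k ⁻¹' E)
      ≤ quenchedLaw h β₀ β v ω (⋃ k, G k ∩ shiftPath k ⁻¹' E) := by
        refine measure_mono_ae ?_
        filter_upwards [quenchedLaw_ae_start v ω] with V hV hmem
        obtain ⟨k, hk⟩ := Set.mem_iUnion.1 hmem
        exact Set.mem_iUnion.2 ⟨k, ⟨hk.1, hV⟩, hk.2⟩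
    _ ≤ ∑' k, quenchedLaw h β₀ β v ω (G k ∩ shiftPath k ⁻¹' E) := measure_iUnion_le _
    _ ≤ ∑' k, quenchedLaw h β₀ β v ω (G k) * c := by
        refine ENNReal.tsum_le_tsum fun k => ?_
        exact quenchedLaw_inter_shiftPath_le (hG k) hE fun V hV => hc k V hV.1 hV.2
    _ = quenchedLaw h β₀ β v ω (⋃ k, G k) * c := by
        rw [ENNReal.tsum_mul_right, measure_iUnion (fun i j hij => (hdisj hij).mono
          Set.inter_subset_left Set.inter_subset_left) fun k => (hG k).measurableSet]
    _ ≤ quenchedLaw h β₀ β v ω (⋃ k, F k) * c := by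
        gcongr with k
        exact Set.inter_subset_left

theorem quenchedLaw_shiftPath_one_le (v : Vertex d) (ω : Env d) {E : Set (ℕ → Vertex d)}
    (hE : MeasurableSet E) :
    quenchedLaw h β₀ β v ω (shiftPath 1 ⁻¹' E) ≤ ∑ w ∈ insert v (neighbors v),
      ENNReal.ofReal (transProb h β₀ β ω v w) * quenchedLaw h β₀ β w ω E := by
  let x : Vertex d → ℕ → Vertex d := fun w n => if n = 0 then v else w
  calc quenchedLaw h β₀ β v ω (shiftPath 1 ⁻¹' E)
      ≤ quenchedLaw h β₀ β v ω (⋃ w, pathCylinder 1 (x w) ∩ shiftPath 1 ⁻¹' E) := by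
        refine measure_mono_ae ?_
        filter_upwards [quenchedLaw_ae_start v ω] with V hV hmem
        refine Set.mem_iUnion.2 ⟨V 1, ?_, hmem⟩
        intro i hi
        rcases Nat.le_one_iff_eq_zero_or_eq_one.1 hi with rfl | rfl
        · simpa [x] using hV
        · simp [x]
    _ ≤ ∑' w, quenchedLaw h β₀ β v ω (pathCylinder 1 (x w) ∩ shiftPath 1 ⁻¹' E) :=
        measure_iUnion_le _
    _ = ∑' w, ENNReal.ofReal (transProb h β₀ β ω v w) * quenchedLaw h β₀ β w ω E := by
        refine tsum_congr fun w => ?_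
        rw [quenchedLaw_pathCylinder_inter_shiftPath _ _ _ _ _ _ _ hE, quenchedLaw_pathCylinder]
        simp [x]
    _ = _ := by
        refine tsum_eq_sum fun w hw => ?_
        rw [Finset.mem_insert, not_or] at hw
        simp [transProb, hw.1, hw.2]

theorem measurableSet_exists_le_notMem (D : Set (Vertex d)) (n : ℕ) :
    MeasurableSet {V : ℕ → Vertex d | ∃ j ≤ n, V j ∉ D} :=
  Adapted.measurableSet (k := n) fun _ _ hxy ⟨j, hj, hx⟩ => ⟨j, hj, hxy j hj ▸ hx⟩

section Superharmonic

variable {D : Set (Vertex d)} {ω : Env d} {F : Vertex d → ℝ}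

theorem quenchedLaw_exists_le_notMem_le_of_superharmonic (hF0 : ∀ u, 0 ≤ F u)
    (hF1 : ∀ u, u ∉ D → 1 ≤ F u)
    (hF : ∀ u ∈ D, ∑ w ∈ insert u (neighbors u), transProb h β₀ β ω u w * F w ≤ F u)
    (n : ℕ) (u : Vertex d) :
    quenchedLaw h β₀ β u ω {V | ∃ j ≤ n, V j ∉ D} ≤ ENNReal.ofReal (F u) := by
  induction n generalizing u with
  | zero =>
    by_cases hu : u ∈ D
    · refine le_of_eq_of_le ?_ zero_le
      rw [measure_eq_zero_iff_ae_notMem]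
      filter_upwards [quenchedLaw_ae_start u ω] with V hV
      rintro ⟨j, hj, hVj⟩
      obtain rfl : j = 0 := Nat.le_zero.1 hj
      exact hVj (hV ▸ hu)
    · exact prob_le_one.trans (by simpa using hF1 u hu)
  | succ n ih =>
    by_cases hu : u ∈ D
    · calc quenchedLaw h β₀ β u ω {V | ∃ j ≤ n + 1, V j ∉ D}
          ≤ quenchedLaw h β₀ β u ω (shiftPath 1 ⁻¹' {V | ∃ j ≤ n, V j ∉ D}) := by
            refine measure_mono_ae ?_
            filter_upwards [quenchedLaw_ae_start u ω] with V hV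
            rintro ⟨_ | j, hj, hVj⟩
            · exact absurd (hV ▸ hu) hVj
            · exact ⟨j, Nat.le_of_succ_le_succ hj, hVj⟩
        _ ≤ _ := quenchedLaw_shiftPath_one_le u ω (measurableSet_exists_le_notMem D n)
        _ ≤ ∑ w ∈ insert u (neighbors u),
              ENNReal.ofReal (transProb h β₀ β ω u w) * ENNReal.ofReal (F w) := by
            gcongr with w
            exact ih w
        _ = ENNReal.ofReal (∑ w ∈ insert u (neighbors u), transProb h β₀ β ω u w * F w) := by
            rw [ENNReal.ofReal_sum_of_nonneg fun w _ =>
              mul_nonneg (transProb_nonneg h β₀ β ω u w) (hF0 w)]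
            exact Finset.sum_congr rfl fun w _ =>
              (ENNReal.ofReal_mul (transProb_nonneg h β₀ β ω u w)).symm
        _ ≤ _ := ENNReal.ofReal_le_ofReal (hF u hu)
    · exact prob_le_one.trans (by simpa using hF1 u hu)

theorem quenchedLaw_exists_notMem_le_of_superharmonic (hF0 : ∀ u, 0 ≤ F u)
    (hF1 : ∀ u, u ∉ D → 1 ≤ F u)
    (hF : ∀ u ∈ D, ∑ w ∈ insert u (neighbors u), transProb h β₀ β ω u w * F w ≤ F u)
    (u : Vertex d) :
    quenchedLaw h β₀ β u ω {V | ∃ j, V j ∉ D} ≤ ENNReal.ofReal (F u) := by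
  have hunion : {V : ℕ → Vertex d | ∃ j, V j ∉ D} = ⋃ n, {V | ∃ j ≤ n, V j ∉ D} := by
    ext V
    simp only [Set.mem_ofPred_eq, Set.mem_iUnion]
    exact ⟨fun ⟨j, hj⟩ => ⟨j, j, le_rfl, hj⟩, fun ⟨_, j, _, hj⟩ => ⟨j, hj⟩⟩
  have hmono : Monotone fun n : ℕ => {V : ℕ → Vertex d | ∃ j ≤ n, V j ∉ D} :=
    fun n m hnm V ⟨j, hj, hV⟩ => ⟨j, hj.trans hnm, hV⟩
  rw [hunion, hmono.measure_iUnion]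
  exact iSup_le fun n => quenchedLaw_exists_le_notMem_le_of_superharmonic hF0 hF1 hF n u

end Superharmonic

end Quenched

/-! ### Escape and backtracking of the quenched walk -/

/-- After time `0` the trajectory does not stay among the strict descendants of its start. -/
def exitEvent (d : ℕ) : Set (ℕ → Vertex d) := {V | ∃ j, ¬StrictDesc (V 0) (V (j + 1))}

/-- `firstReturnEvent d k`: the trajectory is back at its start at time `k`, for the first time. -/
def firstReturnEvent (d k : ℕ) : Set (ℕ → Vertex d) :=
  {V | 0 < k ∧ V k = V 0 ∧ ∀ j, 0 < j → j < k → V j ≠ V 0}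

/-- The trajectory returns at least `r` times to its start. -/
def returnEvent (d : ℕ) : ℕ → Set (ℕ → Vertex d)
  | 0 => Set.univ
  | r + 1 => ⋃ k, firstReturnEvent d k ∩ shiftPath k ⁻¹' returnEvent d r

/-- The trajectory stays among the strict descendants of its start until it is `s` levels below
it, and leaves them afterwards. -/
def backtrackEvent (d s : ℕ) : Set (ℕ → Vertex d) :=
  {V | ∃ k, (∀ j, 0 < j → j ≤ k → StrictDesc (V 0) (V j)) ∧ level (V k) = level (V 0) + s ∧
    ∃ j, ¬StrictDesc (V 0) (V (j + k))}

/-- `firstDescentEvent d s k`: the trajectory stays among the strict descendants of its start up to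
time `k`, and `k` is the first time at which it is `s` levels below its start. -/
def firstDescentEvent (d s k : ℕ) : Set (ℕ → Vertex d) :=
  {V | (∀ j, 0 < j → j ≤ k → StrictDesc (V 0) (V j)) ∧ level (V k) = level (V 0) + s ∧
    ∀ j < k, level (V j) ≠ level (V 0) + s}

theorem measurableSet_exists_notMem (D : Set (Vertex d)) :
    MeasurableSet {V : ℕ → Vertex d | ∃ j, V j ∉ D} := by
  rw [Set.ofPred_exists]
  exact MeasurableSet.iUnion fun j =>
    measurable_pi_apply (X := fun _ => Vertex d) j (MeasurableSet.of_discrete (s := Dᶜ))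

theorem measurableSet_exitEvent : MeasurableSet (exitEvent d) := by
  rw [exitEvent, Set.ofPred_exists]
  refine MeasurableSet.iUnion fun j => Adapted.measurableSet (k := j + 1) fun x y hxy hx => ?_
  simpa [hxy 0 (by omega), hxy (j + 1) le_rfl] using hx

theorem adapted_firstReturnEvent (k : ℕ) : Adapted k (firstReturnEvent d k) := by
  rintro x y hxy ⟨hpos, hreturn, hfirst⟩
  refine ⟨hpos, ?_, fun j hj hjk => ?_⟩
  · rw [← hxy k le_rfl, ← hxy 0 (Nat.zero_le _), hreturn]
  · rw [← hxy j hjk.le, ← hxy 0 (Nat.zero_le _)]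
    exact hfirst j hj hjk

theorem pairwise_disjoint_firstReturnEvent :
    Pairwise (Function.onFun Disjoint (firstReturnEvent d)) := by
  intro k k' hne
  refine Set.disjoint_left.2 ?_
  rintro V ⟨hpos, hreturn, hfirst⟩ ⟨hpos', hreturn', hfirst'⟩
  rcases lt_or_gt_of_ne hne with hlt | hlt
  · exact hfirst' k hpos hlt hreturn
  · exact hfirst k' hpos' hlt hreturn'

theorem firstReturnEvent_subset_exitEvent (k : ℕ) : firstReturnEvent d k ⊆ exitEvent d := by
  rintro V ⟨hpos, hreturn, -⟩
  refine ⟨k - 1, ?_⟩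
  rw [Nat.sub_add_cancel hpos, hreturn]
  exact not_strictDesc_self _

theorem measurableSet_returnEvent (r : ℕ) : MeasurableSet (returnEvent d r) := by
  induction r with
  | zero => exact MeasurableSet.univ
  | succ r ih =>
    exact MeasurableSet.iUnion fun k => (adapted_firstReturnEvent k).measurableSet.inter
      (measurable_shiftPath k ih)

theorem measurableSet_backtrackEvent (s : ℕ) : MeasurableSet (backtrackEvent d s) := by
  have hunion : backtrackEvent d s = ⋃ k, ⋃ j, {V | (∀ j, 0 < j → j ≤ k → StrictDesc (V 0) (V j)) ∧
      level (V k) = level (V 0) + s ∧ ¬StrictDesc (V 0) (V (j + k))} := by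
    ext V
    simp [backtrackEvent]
  rw [hunion]
  refine MeasurableSet.iUnion fun k => MeasurableSet.iUnion fun j =>
    Adapted.measurableSet (k := j + k) ?_
  rintro x y hxy ⟨hdesc, hlevel, hleave⟩
  have hstart : x 0 = y 0 := hxy 0 (Nat.zero_le _)
  refine ⟨fun j hj hjk => ?_, ?_, ?_⟩
  · rw [← hstart, ← hxy j (by omega)]
    exact hdesc j hj hjk
  · rw [← hstart, ← hxy k (by omega)]
    exact hlevel
  · rw [← hstart, ← hxy _ le_rfl]
    exact hleave

theorem adapted_firstDescentEvent (s k : ℕ) : Adapted k (firstDescentEvent d s k) := by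
  rintro x y hxy ⟨hdesc, hlevel, hfirst⟩
  have hstart : x 0 = y 0 := hxy 0 (Nat.zero_le _)
  refine ⟨fun j hj hjk => ?_, ?_, fun j hj => ?_⟩
  · rw [← hstart, ← hxy j hjk]
    exact hdesc j hj hjk
  · rw [← hstart, ← hxy k le_rfl]
    exact hlevel
  · rw [← hstart, ← hxy _ hj.le]
    exact hfirst j hj

theorem pairwise_disjoint_firstDescentEvent (s : ℕ) :
    Pairwise (Function.onFun Disjoint (firstDescentEvent d s)) := by
  intro k k' hne
  refine Set.disjoint_left.2 ?_
  rintro V ⟨-, hlevel, hfirst⟩ ⟨-, hlevel', hfirst'⟩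
  rcases lt_or_gt_of_ne hne with hlt | hlt
  · exact hfirst' k hlt hlevel
  · exact hfirst k' hlt hlevel'

theorem exists_mem_firstDescentEvent_of_mem_backtrackEvent {s : ℕ} {V : ℕ → Vertex d}
    (hV : V ∈ backtrackEvent d s) :
    ∃ k, V ∈ firstDescentEvent d s k ∧ ∃ j, ¬StrictDesc (V 0) (V (j + k)) := by
  classical
  obtain ⟨k, hdesc, hlevel, j, hleave⟩ := hV
  have hex : ∃ k, level (V k) = level (V 0) + s := ⟨k, hlevel⟩
  have hle : Nat.find hex ≤ k := Nat.find_min' hex hlevel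
  refine ⟨Nat.find hex, ⟨fun j hj hjk => hdesc j hj (hjk.trans hle), Nat.find_spec hex,
    fun j hj => Nat.find_min hex hj⟩, j + (k - Nat.find hex), ?_⟩
  rwa [add_assoc, Nat.sub_add_cancel hle]

/-- A child of the given vertex. -/
def firstChild (hd : 2 ≤ d) : Vertex d → Edge d
  | none => (⟨0, by omega⟩, [])
  | some (i, l) => (i, ⟨0, by omega⟩ :: l)

theorem parent_firstChild (hd : 2 ≤ d) (v : Vertex d) : parent (some (firstChild hd v)) = v := by
  rcases v with _ | ⟨i, l⟩ <;> rfl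

theorem firstChild_mem_neighbors (hd : 2 ≤ d) (v : Vertex d) :
    some (firstChild hd v) ∈ neighbors v :=
  mem_neighbors.2 (Or.inl ⟨by simp [root], parent_firstChild hd v⟩)

theorem strictDesc_firstChild (hd : 2 ≤ d) (v : Vertex d) : StrictDesc v (some (firstChild hd v)) :=
  .child (by simp [root]) (parent_firstChild hd v)

theorem mark_firstChild (hd : 2 ≤ d) (v : Vertex d) (ω : Env d) :
    mark ω v (some (firstChild hd v)) = ω (firstChild hd v) := by
  simpa only [parent_firstChild] using mark_parent_left ω (firstChild hd v)

section Quenched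

variable {h : AcceptanceFunction} {β₀ β : ℝ}

theorem quenchedLaw_exists_notMem_le_exitBound (hd : 0 < d) {D : Set (Vertex d)} (hD : IsLower D)
    (ω : Env d) (u : Vertex d) :
    quenchedLaw h β₀ β u ω {V | ∃ j, V j ∉ D} ≤ ENNReal.ofReal (exitBound h β₀ β D ω u) :=
  quenchedLaw_exists_notMem_le_of_superharmonic (exitBound_nonneg hd)
    (fun _ hu => (exitBound_eq_one hD hu).ge) (fun _ hu => (exitBound_harmonic hd hD hu).le) u

theorem sum_transProb_mul_exitBound_le (hd : 2 ≤ d) (v : Vertex d) (ω : Env d) :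
    ∑ w ∈ insert v (neighbors v),
        transProb h β₀ β ω v w * exitBound h β₀ β {w | StrictDesc v w} ω w
      ≤ 1 - escape h β₀ β d (subMarks (firstChild hd v) ω) := by
  have hd₀ : 0 < d := by omega
  have hlower := isLower_strictDesc v
  have hstart : exitBound h β₀ β {w | StrictDesc v w} ω v = 1 :=
    exitBound_eq_one hlower (not_strictDesc_self v)
  have hchild : exitBound h β₀ β {w | StrictDesc v w} ω (some (firstChild hd v))
      = 1 - escapeProb h β₀ β d (subMarks (firstChild hd v) ω) := by
    rw [exitBound_of_mem (D := {w | StrictDesc v w}) (strictDesc_firstChild hd v),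
      parent_firstChild, hstart, mul_one]
  have hnonpos : ∀ w, jumpProb h β₀ β d (mark ω v w)
      * (exitBound h β₀ β {w | StrictDesc v w} ω w - 1) ≤ 0 := fun w =>
    mul_nonpos_of_nonneg_of_nonpos (jumpProb_nonneg h β₀ β _)
      (sub_nonpos.2 (exitBound_le_one hd₀ w))
  rw [sum_transProb_mul, hstart, escape_eq_mul_escapeProb hd₀, subMarks_nil]
  calc 1 + ∑ w ∈ neighbors v, jumpProb h β₀ β d (mark ω v w)
        * (exitBound h β₀ β {w | StrictDesc v w} ω w - 1)
      ≤ 1 + jumpProb h β₀ β d (mark ω v (some (firstChild hd v)))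
        * (exitBound h β₀ β {w | StrictDesc v w} ω (some (firstChild hd v)) - 1) := by
        rw [← Finset.add_sum_erase _ _ (firstChild_mem_neighbors hd v)]
        linarith [Finset.sum_nonpos fun w (_ : w ∈ (neighbors v).erase (some (firstChild hd v))) =>
          hnonpos w]
    _ = _ := by
        rw [hchild, mark_firstChild]
        ring

theorem quenchedLaw_exitEvent_le (hd : 2 ≤ d) (v : Vertex d) (ω : Env d) :
    quenchedLaw h β₀ β v ω (exitEvent d)
      ≤ ENNReal.ofReal (1 - escape h β₀ β d (subMarks (firstChild hd v) ω)) := by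
  have hd₀ : 0 < d := by omega
  set D : Set (Vertex d) := {w | StrictDesc v w}
  calc quenchedLaw h β₀ β v ω (exitEvent d)
      ≤ quenchedLaw h β₀ β v ω (shiftPath 1 ⁻¹' {V | ∃ j, V j ∉ D}) := by
        refine measure_mono_ae ?_
        filter_upwards [quenchedLaw_ae_start v ω] with V hV
        rintro ⟨j, hj⟩
        exact ⟨j, by rwa [hV] at hj⟩
    _ ≤ _ := quenchedLaw_shiftPath_one_le v ω (measurableSet_exists_notMem D)
    _ ≤ ∑ w ∈ insert v (neighbors v), ENNReal.ofReal
          (transProb h β₀ β ω v w * exitBound h β₀ β D ω w) := by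
        gcongr with w
        rw [ENNReal.ofReal_mul (transProb_nonneg h β₀ β ω v w)]
        gcongr
        exact quenchedLaw_exists_notMem_le_exitBound hd₀ (isLower_strictDesc v) ω w
    _ = ENNReal.ofReal (∑ w ∈ insert v (neighbors v),
          transProb h β₀ β ω v w * exitBound h β₀ β D ω w) :=
        (ENNReal.ofReal_sum_of_nonneg fun w _ =>
          mul_nonneg (transProb_nonneg h β₀ β ω v w) (exitBound_nonneg hd₀ w)).symm
    _ ≤ _ := ENNReal.ofReal_le_ofReal (sum_transProb_mul_exitBound_le hd v ω)

theorem quenchedLaw_returnEvent_le (hd : 2 ≤ d) (v : Vertex d) (ω : Env d) (r : ℕ) :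
    quenchedLaw h β₀ β v ω (returnEvent d r)
      ≤ ENNReal.ofReal ((1 - escape h β₀ β d (subMarks (firstChild hd v) ω)) ^ r) := by
  have hnonneg : 0 ≤ 1 - escape h β₀ β d (subMarks (firstChild hd v) ω) :=
    sub_nonneg.2 (escape_le_one _)
  induction r with
  | zero => simp [returnEvent]
  | succ r ih =>
    rw [returnEvent, pow_succ', ENNReal.ofReal_mul hnonneg]
    refine (quenchedLaw_iUnion_inter_shiftPath_le adapted_firstReturnEvent
      pairwise_disjoint_firstReturnEvent (measurableSet_returnEvent r) (c := ENNReal.ofReal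
        ((1 - escape h β₀ β d (subMarks (firstChild hd v) ω)) ^ r)) ?_).trans ?_
    · intro k V hV hstart
      rw [hV.2.1, hstart]
      exact ih
    · gcongr
      exact (measure_mono (Set.iUnion_subset firstReturnEvent_subset_exitEvent)).trans
        (quenchedLaw_exitEvent_le hd v ω)

/-- An upper bound of the quenched probability to backtrack over `s + 1` levels. It is obtained
from the bound `x + (z / x) ^ p` of the exit probability `z` from below, with the sum of the bounds
of the `p`-th powers over the children of the starting vertex. -/
noncomputable def backtrackBound (h : AcceptanceFunction) (β₀ β : ℝ) (d p : ℕ)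
    (σ : Fin (d - 1) → Fin (d - 1)) (x : ℝ) (s : ℕ) (ω : Env d) : Vertex d → ENNReal
  | none => 1
  | some (i, l) => ENNReal.ofReal x + ENNReal.ofReal (x⁻¹ ^ p)
      * ∑ j, backtrackSum h β₀ β d p σ s (subMarks (i, j :: l) ω)

theorem le_add_inv_pow_mul_pow {x z : ℝ} (hx : 0 < x) (hz : 0 ≤ z) (hz1 : z ≤ 1) (p : ℕ) :
    z ≤ x + x⁻¹ ^ p * z ^ p := by
  rcases le_or_gt z x with hzx | hxz
  · exact le_add_of_le_of_nonneg hzx (by positivity)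
  · have hone : 1 ≤ x⁻¹ ^ p * z ^ p := by
      rw [← mul_pow]
      exact one_le_pow₀ ((one_le_inv_mul₀ hx).2 hxz.le)
    linarith

theorem ofReal_exitBound_le_backtrackBound (hd : 0 < d) (p : ℕ) (σ : Fin (d - 1) → Fin (d - 1))
    {x : ℝ} (hx : 0 < x) {v u : Vertex d} (ω : Env d) (hv : v ≠ root) (hu : StrictDesc v u) {s : ℕ}
    (hlevel : level u = level v + (s + 1)) :
    ENNReal.ofReal (exitBound h β₀ β {w | StrictDesc v w} ω u)
      ≤ backtrackBound h β₀ β d p σ x s ω v := by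
  obtain _ | ⟨i, l⟩ := v
  · exact absurd rfl hv
  obtain ⟨t, j, rfl⟩ := hu.exists_append
  obtain rfl : t.length = s := by
    simp only [level, List.length_append, List.length_cons] at hlevel
    omega
  set z := exitBound h β₀ β {w | StrictDesc (some (i, l)) w} ω (some (i, t ++ j :: l))
  have hz0 : 0 ≤ z := exitBound_nonneg hd _
  calc ENNReal.ofReal z
      ≤ ENNReal.ofReal (x + x⁻¹ ^ p * z ^ p) := ENNReal.ofReal_le_ofReal
        (le_add_inv_pow_mul_pow hx hz0 (exitBound_le_one hd _) p)
    _ = ENNReal.ofReal x + ENNReal.ofReal (x⁻¹ ^ p) * ENNReal.ofReal (z ^ p) := by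
        rw [ENNReal.ofReal_add hx.le (by positivity), ENNReal.ofReal_mul (by positivity)]
    _ ≤ _ := by
        rw [backtrackBound]
        gcongr
        exact (ofReal_exitBound_pow_le_backtrackSum hd p σ (isLower_strictDesc _) i t (j :: l)
          (.append i l [j] (by simp)) (not_strictDesc_self _)).trans
          (Finset.single_le_sum
            (f := fun j => backtrackSum h β₀ β d p σ t.length (subMarks (i, j :: l) ω))
            (fun _ _ => zero_le) (Finset.mem_univ j))

theorem quenchedLaw_backtrackEvent_le (hd : 0 < d) (p : ℕ) (σ : Fin (d - 1) → Fin (d - 1))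
    {x : ℝ} (hx : 0 < x) (s : ℕ) (v : Vertex d) (ω : Env d) :
    quenchedLaw h β₀ β v ω (backtrackEvent d (s + 1))
      ≤ backtrackBound h β₀ β d p σ x s ω v := by
  by_cases hv : v = root
  · subst hv
    exact prob_le_one
  set D : Set (Vertex d) := {w | StrictDesc v w}
  set B := backtrackBound h β₀ β d p σ x s ω v
  calc quenchedLaw h β₀ β v ω (backtrackEvent d (s + 1))
      ≤ quenchedLaw h β₀ β v ω
          (⋃ k, firstDescentEvent d (s + 1) k ∩ shiftPath k ⁻¹' {V | ∃ j, V j ∉ D}) := by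
        refine measure_mono_ae ?_
        filter_upwards [quenchedLaw_ae_start v ω] with V hV hback
        obtain ⟨k, hk, j, hj⟩ := exists_mem_firstDescentEvent_of_mem_backtrackEvent hback
        rw [hV] at hj
        exact Set.mem_iUnion.2 ⟨k, hk, j, hj⟩
    _ ≤ quenchedLaw h β₀ β v ω (⋃ k, firstDescentEvent d (s + 1) k) * B := by
        refine quenchedLaw_iUnion_inter_shiftPath_le (adapted_firstDescentEvent _)
          (pairwise_disjoint_firstDescentEvent _) (measurableSet_exists_notMem D) ?_
        rintro k V ⟨hdesc, hlevel, -⟩ hV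
        have hk : 0 < k := by
          rcases Nat.eq_zero_or_pos k with rfl | hk
          · omega
          · exact hk
        rw [hV] at hdesc hlevel
        exact (quenchedLaw_exists_notMem_le_exitBound hd (isLower_strictDesc v) ω _).trans
          (ofReal_exitBound_le_backtrackBound hd p σ hx ω hv (hdesc k hk le_rfl) hlevel)
    _ ≤ B := mul_le_of_le_one_left zero_le prob_le_one

end Quenched

/-! ### The annealed walk discovers fresh subtrees -/

theorem mark_congr {ω ω' : Env d} {a : Vertex d}
    (hω : ∀ e : Edge d, (some e = a ∨ parent (some e) = a) → ω e = ω' e) (u : Vertex d) :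
    mark ω a u = mark ω' a u := by
  rcases a with _ | e <;> rcases u with _ | e' <;> simp only [mark]
  · split_ifs with hparent
    · exact hω e' (Or.inr hparent)
    · rfl
  · rw [hω e (Or.inl rfl)]
  · split_ifs with hparent
    · exact hω e' (Or.inr hparent)
    · rw [hω e (Or.inl rfl)]
    · rfl

theorem transProb_congr (h : AcceptanceFunction) (β₀ β : ℝ) {ω ω' : Env d} {a : Vertex d}
    (hω : ∀ e : Edge d, (some e = a ∨ parent (some e) = a) → ω e = ω' e) (u : Vertex d) :
    transProb h β₀ β ω a u = transProb h β₀ β ω' a u := by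
  unfold transProb
  rw [mark_congr hω u, Finset.sum_congr rfl fun u _ => by rw [mark_congr hω u]]

/-- A nearest-neighbour path from the root up to time `k` (staying put being allowed). -/
def IsPath (k : ℕ) (x : ℕ → Vertex d) : Prop :=
  x 0 = root ∧ ∀ i < k, x (i + 1) = x i ∨ x (i + 1) ∈ neighbors (x i)

-- A path enters the descendants of a vertex only through that vertex.
theorem IsPath.not_strictDesc_of_forall_ne {k : ℕ} {x : ℕ → Vertex d} (hx : IsPath k x)
    (hnew : ∀ i < k, x i ≠ x k) : ∀ i < k, ¬StrictDesc (x k) (x i) := by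
  intro i
  induction i with
  | zero =>
    intro _ hdesc
    rw [hx.1] at hdesc
    exact hdesc.ne_root rfl
  | succ i ih =>
    intro hi hdesc
    have hprev := ih (by omega)
    rcases hx.2 i (by omega) with hstay | hmove
    · exact hprev (hstay ▸ hdesc)
    · rcases mem_neighbors.1 hmove with ⟨-, hdown⟩ | ⟨hroot, hup⟩
      · rcases hdesc.parent_eq_or with hparent | hparent
        · exact hnew i (by omega) (hdown.symm.trans hparent)
        · exact hprev (hdown ▸ hparent)
      · exact hprev (.step hroot (hup ▸ hdesc))

section Annealed

variable {h : AcceptanceFunction} {β₀ β : ℝ} {μ : Measure ℝ} [IsProbabilityMeasure μ]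

/-- The annealed law of the trajectory. -/
noncomputable def walkLaw (d : ℕ) (h : AcceptanceFunction) (β₀ β : ℝ) (μ : Measure ℝ)
    [IsProbabilityMeasure μ] : Measure (ℕ → Vertex d) :=
  (annealedLaw h β₀ β d μ).map Prod.snd

instance : IsProbabilityMeasure (annealedLaw h β₀ β d μ) := by
  unfold annealedLaw; infer_instance

instance : IsProbabilityMeasure (walkLaw d h β₀ β μ) :=
  Measure.isProbabilityMeasure_map measurable_snd.aemeasurable

theorem walkLaw_apply {A : Set (ℕ → Vertex d)} (hA : MeasurableSet A) :
    walkLaw d h β₀ β μ A = ∫⁻ ω, quenchedLaw h β₀ β root ω A ∂envLaw d μ := by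
  rw [walkLaw, Measure.map_apply measurable_snd hA, annealedLaw,
    Measure.compProd_apply (measurable_snd hA)]
  rfl

theorem annealedLaw_le_walkLaw {A B : Set (ℕ → Vertex d)} (hAB : A ⊆ B) :
    annealedLaw h β₀ β d μ {x | x.2 ∈ A} ≤ walkLaw d h β₀ β μ B :=
  (measure_mono (t := Prod.snd ⁻¹' B) fun _ hx => hAB hx).trans
    (Measure.le_map_apply measurable_snd.aemeasurable B)

theorem measurable_quenchedLaw_apply (v : Vertex d) {A : Set (ℕ → Vertex d)}
    (hA : MeasurableSet A) : Measurable fun ω => quenchedLaw h β₀ β v ω A :=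
  (Measure.measurable_coe hA).comp (measurable_quenchedLaw h β₀ β v)

theorem quenchedLaw_pathCylinder_eq_zero {ω : Env d} {k : ℕ} {x : ℕ → Vertex d}
    (hx : ¬IsPath k x) : quenchedLaw h β₀ β root ω (pathCylinder k x) = 0 := by
  rw [quenchedLaw_pathCylinder]
  by_cases hstart : x 0 = root
  · obtain ⟨i, hi, hjump⟩ : ∃ i < k, ¬(x (i + 1) = x i ∨ x (i + 1) ∈ neighbors (x i)) := by
      by_contra! hpath
      exact hx ⟨hstart, fun i hi => hpath i hi⟩
    rw [not_or] at hjump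
    rw [Finset.prod_eq_zero (Finset.mem_range.2 hi), mul_zero]
    simp [transProb, hjump.1, hjump.2]
  · simp [Ne.symm hstart]

theorem walkLaw_ae_isPath : ∀ᵐ V ∂walkLaw d h β₀ β μ, ∀ k, IsPath k V := by
  rw [ae_all_iff]
  intro k
  have hadapted : Adapted k {V : ℕ → Vertex d | ¬IsPath k V} := by
    intro x y hxy hx hy
    refine hx ⟨(hxy 0 (Nat.zero_le _)).trans hy.1, fun i hi => ?_⟩
    rw [hxy i hi.le, hxy (i + 1) hi]
    exact hy.2 i hi
  change walkLaw d h β₀ β μ {V : ℕ → Vertex d | ¬IsPath k V} = 0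
  rw [walkLaw_apply hadapted.measurableSet]
  refine (lintegral_congr fun ω => ?_).trans lintegral_zero
  rw [measure_eq_tsum_pathCylinder _ k hadapted.measurableSet]
  refine ENNReal.tsum_eq_zero.2 fun u => ?_
  by_cases hu : IsPath k (extendPath k u)
  · rw [hadapted.pathCylinder_inter_eq_empty (not_not_intro hu), measure_empty]
  · exact measure_mono_null Set.inter_subset_left (quenchedLaw_pathCylinder_eq_zero hu)

/-- The edges strictly below a vertex. -/
def edgesBelow (v : Vertex d) : Set (Edge d) := {e | StrictDesc v (some e)}

theorem dependsOn_quenchedLaw_pathCylinder {k : ℕ} {x : ℕ → Vertex d}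
    (hnew : ∀ i < k, x i ≠ x k) :
    DependsOn (fun ω : Env d => quenchedLaw h β₀ β root ω (pathCylinder k x))
      (edgesBelow (x k))ᶜ := by
  intro ω ω' hω
  by_cases hx : IsPath k x
  · simp only [quenchedLaw_pathCylinder]
    congr 1
    refine Finset.prod_congr rfl fun i hi => ?_
    have hik := Finset.mem_range.1 hi
    have havoid := hx.not_strictDesc_of_forall_ne hnew i hik
    rw [transProb_congr h β₀ β]
    rintro e he
    refine hω e fun hdesc => ?_
    rcases he with htop | hbottom
    · exact havoid (htop ▸ hdesc)
    · rcases hdesc.parent_eq_or with hparent | hparent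
      · exact hnew i hik (hbottom.symm.trans hparent)
      · exact havoid (hbottom ▸ hparent)
  · simp only [quenchedLaw_pathCylinder_eq_zero hx]

/-- A family of bounds for the quenched probabilities of an event, which only involve the part
of the environment strictly below the starting point. -/
structure FreshBound (h : AcceptanceFunction) (β₀ β : ℝ) (E : Set (ℕ → Vertex d)) where
  toFun : Vertex d → Env d → ENNReal
  measurable : ∀ v, Measurable (toFun v)
  dependsOn : ∀ v, DependsOn (toFun v) (edgesBelow v)
  quenchedLaw_le : ∀ v ω, quenchedLaw h β₀ β v ω E ≤ toFun v ω

theorem walkLaw_pathCylinder_inter_shiftPath_le {k : ℕ} {x : ℕ → Vertex d}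
    (hnew : ∀ i < k, x i ≠ x k) {E : Set (ℕ → Vertex d)} (hE : MeasurableSet E)
    (g : FreshBound h β₀ β E) :
    walkLaw d h β₀ β μ (pathCylinder k x ∩ shiftPath k ⁻¹' E)
      ≤ walkLaw d h β₀ β μ (pathCylinder k x) * ∫⁻ ω, g.toFun (x k) ω ∂envLaw d μ := by
  rw [walkLaw_apply ((measurableSet_pathCylinder _ _).inter (measurable_shiftPath k hE)),
    walkLaw_apply (measurableSet_pathCylinder _ _)]
  calc ∫⁻ ω, quenchedLaw h β₀ β root ω (pathCylinder k x ∩ shiftPath k ⁻¹' E) ∂envLaw d μ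
      ≤ ∫⁻ ω, quenchedLaw h β₀ β root ω (pathCylinder k x) * g.toFun (x k) ω ∂envLaw d μ := by
        refine lintegral_mono fun ω => ?_
        rw [quenchedLaw_pathCylinder_inter_shiftPath _ _ _ _ _ _ _ hE]
        gcongr
        exact g.quenchedLaw_le _ _
    _ = (∫⁻ ω, quenchedLaw h β₀ β root ω (pathCylinder k x) ∂envLaw d μ)
          * ∫⁻ ω, g.toFun (x k) ω ∂envLaw d μ :=
      lintegral_infinitePi_mul_of_dependsOn (fun _ : Edge d => μ) disjoint_compl_left
        (measurable_quenchedLaw_apply root (measurableSet_pathCylinder _ _))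
        (g.measurable _) (dependsOn_quenchedLaw_pathCylinder hnew) (g.dependsOn _)

theorem walkLaw_inter_shiftPath_le {k : ℕ} {F E : Set (ℕ → Vertex d)} (hF : Adapted k F)
    (hnew : ∀ V ∈ F, ∀ i < k, V i ≠ V k) (hE : MeasurableSet E) (g : FreshBound h β₀ β E)
    {c : ENNReal} (hc : ∀ V ∈ F, ∫⁻ ω, g.toFun (V k) ω ∂envLaw d μ ≤ c) :
    walkLaw d h β₀ β μ (F ∩ shiftPath k ⁻¹' E) ≤ walkLaw d h β₀ β μ F * c := by
  rw [measure_eq_tsum_pathCylinder _ k (hF.measurableSet.inter (measurable_shiftPath k hE)),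
    measure_eq_tsum_pathCylinder _ k hF.measurableSet, ← ENNReal.tsum_mul_right]
  refine ENNReal.tsum_le_tsum fun u => ?_
  by_cases hu : extendPath k u ∈ F
  · rw [← Set.inter_assoc, Set.inter_eq_left.2 (hF.pathCylinder_subset hu)]
    refine (walkLaw_pathCylinder_inter_shiftPath_le (hnew _ hu) hE g).trans ?_
    gcongr
    exact hc _ hu
  · rw [← Set.inter_assoc, hF.pathCylinder_inter_eq_empty hu]
    simp

theorem walkLaw_iUnion_inter_shiftPath_le {F : ℕ → Set (ℕ → Vertex d)} {E : Set (ℕ → Vertex d)}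
    (hF : ∀ k, Adapted k (F k)) (hdisj : Pairwise (Function.onFun Disjoint F))
    (hnew : ∀ k, ∀ V ∈ F k, ∀ i < k, V i ≠ V k) (hE : MeasurableSet E)
    (g : FreshBound h β₀ β E) {c : ENNReal}
    (hc : ∀ k, ∀ V ∈ F k, ∫⁻ ω, g.toFun (V k) ω ∂envLaw d μ ≤ c) :
    walkLaw d h β₀ β μ (⋃ k, F k ∩ shiftPath k ⁻¹' E) ≤ walkLaw d h β₀ β μ (⋃ k, F k) * c := by
  calc walkLaw d h β₀ β μ (⋃ k, F k ∩ shiftPath k ⁻¹' E)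
      ≤ ∑' k, walkLaw d h β₀ β μ (F k ∩ shiftPath k ⁻¹' E) := measure_iUnion_le _
    _ ≤ ∑' k, walkLaw d h β₀ β μ (F k) * c :=
        ENNReal.tsum_le_tsum fun k =>
          walkLaw_inter_shiftPath_le (hF k) (hnew k) hE g (hc k)
    _ = _ := by
        rw [ENNReal.tsum_mul_right, measure_iUnion hdisj fun k => (hF k).measurableSet]

theorem walkLaw_iUnion_le_pow {C : ℕ → ℕ → Set (ℕ → Vertex d)} (hC : ∀ j k, Adapted k (C j k))
    (hdisj : ∀ j, Pairwise (Function.onFun Disjoint (C j)))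
    (hnew : ∀ j k, ∀ V ∈ C j k, ∀ i < k, V i ≠ V k)
    (hstep : ∀ j k, ∀ V ∈ C (j + 1) k, (∀ n, IsPath n V) →
      ∃ k', V ∈ C j k' ∧ shiftPath k' V ∈ exitEvent d)
    (g : FreshBound h β₀ β (exitEvent d)) {c : ENNReal}
    (hc : ∀ v, ∫⁻ ω, g.toFun v ω ∂envLaw d μ ≤ c) (j : ℕ) :
    walkLaw d h β₀ β μ (⋃ k, C j k) ≤ c ^ j := by
  induction j with
  | zero => simpa using prob_le_one
  | succ j ih =>
    calc walkLaw d h β₀ β μ (⋃ k, C (j + 1) k)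
        ≤ walkLaw d h β₀ β μ (⋃ k, C j k ∩ shiftPath k ⁻¹' exitEvent d) := by
          refine measure_mono_ae ?_
          filter_upwards [walkLaw_ae_isPath (h := h) (β₀ := β₀) (β := β) (μ := μ)] with V hV hmem
          obtain ⟨k, hk⟩ := Set.mem_iUnion.1 hmem
          exact Set.mem_iUnion.2 (hstep j k V hk hV)
      _ ≤ walkLaw d h β₀ β μ (⋃ k, C j k) * c :=
          walkLaw_iUnion_inter_shiftPath_le (hC j) (hdisj j) (hnew j) measurableSet_exitEvent g
            fun k V _ => hc _
      _ ≤ _ := by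
          rw [pow_succ]
          gcongr

/-! ### Fresh bounds for escape and backtracking -/

theorem strictDesc_append_firstChild (hd : 2 ≤ d) (v : Vertex d) (l : List (Fin (d - 1))) :
    StrictDesc v (some ((firstChild hd v).1, l ++ (firstChild hd v).2)) := by
  rcases l with _ | ⟨j, l⟩
  · exact strictDesc_firstChild hd v
  · exact (strictDesc_firstChild hd v).trans (.append _ _ _ (by simp))

theorem dependsOn_subMarks_firstChild (hd : 2 ≤ d) (v : Vertex d) :
    DependsOn (fun ω : Env d => subMarks (firstChild hd v) ω) (edgesBelow v) :=
  fun _ _ hω => funext fun l => hω _ (strictDesc_append_firstChild hd v l)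

/-- The bound of the probability to leave the strict descendants of the start through the escape
weight of one child. -/
noncomputable def exitFreshBound (hd : 2 ≤ d) : FreshBound h β₀ β (exitEvent d) where
  toFun v ω := ENNReal.ofReal (1 - escape h β₀ β d (subMarks (firstChild hd v) ω))
  measurable v := (measurable_const.sub
    (measurable_escape.comp (measurable_subMarks _))).ennreal_ofReal
  dependsOn v _ _ hω := by
    simp only [show subMarks (firstChild hd v) _ = _ from dependsOn_subMarks_firstChild hd v hω]
  quenchedLaw_le v ω := quenchedLaw_exitEvent_le hd v ω

/-- The bound of the probability to return `r` times to the start through the escape weight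
of one child. -/
noncomputable def returnFreshBound (hd : 2 ≤ d) (r : ℕ) :
    FreshBound h β₀ β (returnEvent d r) where
  toFun v ω := ENNReal.ofReal ((1 - escape h β₀ β d (subMarks (firstChild hd v) ω)) ^ r)
  measurable v := ((measurable_const.sub
    (measurable_escape.comp (measurable_subMarks _))).pow_const r).ennreal_ofReal
  dependsOn v _ _ hω := by
    simp only [show subMarks (firstChild hd v) _ = _ from dependsOn_subMarks_firstChild hd v hω]
  quenchedLaw_le v ω := quenchedLaw_returnEvent_le hd v ω r

/-- The bound `backtrackBound` of the probability to backtrack over `s + 1` levels. -/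
noncomputable def backtrackFreshBound (hd : 0 < d) (p : ℕ) (σ : Fin (d - 1) → Fin (d - 1))
    {x : ℝ} (hx : 0 < x) (s : ℕ) : FreshBound h β₀ β (backtrackEvent d (s + 1)) where
  toFun v ω := backtrackBound h β₀ β d p σ x s ω v
  measurable v := by
    rcases v with _ | ⟨i, l⟩
    · exact measurable_const
    · exact measurable_const.add ((Finset.measurable_sum _ fun j _ =>
        (measurable_backtrackSum p σ s).comp (measurable_subMarks _)).const_mul _)
  dependsOn v ω ω' hω := by
    rcases v with _ | ⟨i, l⟩
    · rfl
    · have hsub : ∀ j, subMarks (i, j :: l) ω = subMarks (i, j :: l) ω' := by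
        refine fun j => funext fun t => hω _ ?_
        change StrictDesc _ (some (i, t ++ ([j] ++ l)))
        rw [← List.append_assoc]
        exact .append i l _ (by simp)
      simp only [backtrackBound, hsub]
  quenchedLaw_le v ω := quenchedLaw_backtrackEvent_le hd p σ hx s v ω

theorem lintegral_exitFreshBound (hd : 2 ≤ d) (v : Vertex d) :
    ∫⁻ ω, (exitFreshBound (h := h) (β₀ := β₀) (β := β) hd).toFun v ω ∂envLaw d μ
      = ∫⁻ ξ, ENNReal.ofReal (1 - escape h β₀ β d ξ) ∂marksLaw (d - 1) μ :=
  lintegral_subMarks μ (firstChild hd v)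
    (f := fun ξ => ENNReal.ofReal (1 - escape h β₀ β d ξ))
    (measurable_const.sub measurable_escape).ennreal_ofReal

theorem lintegral_returnFreshBound (hd : 2 ≤ d) (r : ℕ) (v : Vertex d) :
    ∫⁻ ω, (returnFreshBound (h := h) (β₀ := β₀) (β := β) hd r).toFun v ω ∂envLaw d μ
      = ∫⁻ ξ, ENNReal.ofReal ((1 - escape h β₀ β d ξ) ^ r) ∂marksLaw (d - 1) μ :=
  lintegral_subMarks μ (firstChild hd v)
    (f := fun ξ => ENNReal.ofReal ((1 - escape h β₀ β d ξ) ^ r))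
    ((measurable_const.sub measurable_escape).pow_const r).ennreal_ofReal

theorem lintegral_backtrackFreshBound_le (hd : 0 < d) {K : ℝ} (e : EnvEstimates d μ β₀ h K)
    (hβ : |β| ≤ K) {σ : Fin (d - 1) → Fin (d - 1)} (hσ : ∀ i, σ i ≠ i) {x : ℝ} (hx : 0 < x)
    (s : ℕ) {v : Vertex d} (hv : v ≠ root) :
    ∫⁻ ω, (backtrackFreshBound (h := h) (β₀ := β₀) (β := β) hd e.p σ hx s).toFun v ω ∂envLaw d μ
      ≤ ENNReal.ofReal (x + x⁻¹ ^ e.p * (d * (1 / 4) ^ s)) := by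
  rcases v with _ | ⟨i, l⟩
  · exact absurd rfl hv
  have hmeas : ∀ j : Fin (d - 1),
      Measurable fun ω => backtrackSum h β₀ β d e.p σ s (subMarks (i, j :: l) ω) := fun j =>
    (measurable_backtrackSum e.p σ s).comp (measurable_subMarks _)
  have hchild : ∀ j : Fin (d - 1), ∫⁻ ω, backtrackSum h β₀ β d e.p σ s (subMarks (i, j :: l) ω)
      ∂envLaw d μ ≤ ENNReal.ofReal (1 / 4) ^ s := fun j => by
    rw [lintegral_subMarks μ _ (measurable_backtrackSum e.p σ s), lintegral_backtrackSum e.p hσ]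
    gcongr
    exact e.lintegral_backtrack β hβ
  calc ∫⁻ ω, (ENNReal.ofReal x + ENNReal.ofReal (x⁻¹ ^ e.p)
        * ∑ j, backtrackSum h β₀ β d e.p σ s (subMarks (i, j :: l) ω)) ∂envLaw d μ
      = ENNReal.ofReal x + ENNReal.ofReal (x⁻¹ ^ e.p)
        * ∑ j, ∫⁻ ω, backtrackSum h β₀ β d e.p σ s (subMarks (i, j :: l) ω) ∂envLaw d μ := by
        rw [lintegral_add_left measurable_const, lintegral_const_mul _
          (Finset.measurable_sum _ fun j _ => hmeas j), lintegral_finsetSum _ fun j _ => hmeas j,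
          lintegral_const, measure_univ, mul_one]
    _ ≤ ENNReal.ofReal x + ENNReal.ofReal (x⁻¹ ^ e.p)
        * ∑ _j : Fin (d - 1), ENNReal.ofReal (1 / 4) ^ s := by
        gcongr with j
        exact hchild j
    _ ≤ ENNReal.ofReal x + ENNReal.ofReal (x⁻¹ ^ e.p) * (d * ENNReal.ofReal (1 / 4) ^ s) := by
        rw [Finset.sum_const, Finset.card_univ, Fintype.card_fin, nsmul_eq_mul]
        gcongr
        omega
    _ = _ := by
        rw [ENNReal.ofReal_add hx.le (by positivity), ENNReal.ofReal_mul (p := x⁻¹ ^ e.p)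
          (by positivity), ENNReal.ofReal_mul (p := (d : ℝ)) (by positivity),
          ENNReal.ofReal_natCast, ENNReal.ofReal_pow (p := 1 / 4) (by norm_num)]

end Annealed

/-! ### Levels along a trajectory -/

theorem level_le_of_mem_neighbors {v w : Vertex d} (hw : w ∈ neighbors v) :
    level w ≤ level v + 1 ∧ level v ≤ level w + 1 := by
  rcases mem_neighbors.1 hw with ⟨hroot, rfl⟩ | ⟨hroot, rfl⟩ <;>
    have := level_eq_level_parent_add_one hroot <;> omega

namespace IsPath

variable {V : ℕ → Vertex d} {k : ℕ}

theorem mono (hV : IsPath k V) {j : ℕ} (hj : j ≤ k) : IsPath j V :=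
  ⟨hV.1, fun i hi => hV.2 i (hi.trans_le hj)⟩

theorem level_succ_le (hV : IsPath (k + 1) V) :
    level (V (k + 1)) ≤ level (V k) + 1 ∧ level (V k) ≤ level (V (k + 1)) + 1 := by
  rcases hV.2 k k.lt_succ_self with hstay | hmove
  · rw [hstay]; omega
  · exact level_le_of_mem_neighbors hmove

theorem level_zero (hV : IsPath k V) : level (V 0) = 0 := by
  rw [hV.1]; rfl

theorem level_le (hV : IsPath k V) : level (V k) ≤ k := by
  induction k with
  | zero => exact hV.level_zero.le
  | succ k ih => exact hV.level_succ_le.1.trans (Nat.succ_le_succ (ih (hV.mono k.le_succ)))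

theorem exists_level_eq (hV : IsPath k V) {L : ℕ} (hL : L ≤ level (V k)) :
    ∃ i ≤ k, level (V i) = L := by
  induction k with
  | zero => exact ⟨0, le_rfl, by have := hV.level_zero; omega⟩
  | succ k ih =>
    rcases le_or_gt L (level (V k)) with hle | hlt
    · obtain ⟨i, hi, hiL⟩ := ih (hV.mono k.le_succ) hle
      exact ⟨i, by omega, hiL⟩
    · exact ⟨k + 1, le_rfl, by have := hV.level_succ_le; omega⟩

end IsPath

/-- Time `k` is the first visit of level `L`. -/
def FirstHit (L k : ℕ) (V : ℕ → Vertex d) : Prop :=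
  level (V k) = L ∧ ∀ i < k, level (V i) ≠ L

/-- A new vertex is visited at time `k`. -/
def NewVertex (k : ℕ) (V : ℕ → Vertex d) : Prop := ∀ i < k, V i ≠ V k

theorem FirstHit.newVertex {L k : ℕ} {V : ℕ → Vertex d} (hk : FirstHit L k V) : NewVertex k V :=
  fun i hi heq => hk.2 i hi (heq ▸ hk.1)

theorem FirstHit.unique {L k k' : ℕ} {V : ℕ → Vertex d} (hk : FirstHit L k V)
    (hk' : FirstHit L k' V) : k = k' :=
  le_antisymm (not_lt.1 fun hlt => hk.2 k' hlt hk'.1) (not_lt.1 fun hlt => hk'.2 k hlt hk.1)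

theorem IsPath.exists_firstHit {V : ℕ → Vertex d} {L k : ℕ} (hV : IsPath k V)
    (hL : L ≤ level (V k)) : ∃ i ≤ k, FirstHit L i V := by
  classical
  obtain ⟨i, hi, hiL⟩ := hV.exists_level_eq hL
  have hex : ∃ i, level (V i) = L := ⟨i, hiL⟩
  exact ⟨Nat.find hex, (Nat.find_min' hex hiL).trans hi, Nat.find_spec hex,
    fun i hi => Nat.find_min hex hi⟩

theorem FirstHit.lt_of_lt {V : ℕ → Vertex d} {L L' k k' : ℕ} (hV : IsPath k' V)
    (hk : FirstHit L k V) (hk' : FirstHit L' k' V) (hL : L < L') : k < k' := by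
  obtain ⟨i, hi, hiL⟩ := hV.exists_firstHit (hL.le.trans_eq hk'.1.symm)
  rw [hk.unique hiL]
  refine hi.lt_of_ne fun heq => hL.ne ?_
  rw [← hiL.1, heq, hk'.1]

theorem adapted_firstHit (L k : ℕ) : Adapted k {V : ℕ → Vertex d | FirstHit L k V} := by
  rintro x y hxy ⟨hlevel, hfirst⟩
  refine ⟨by rw [← hxy k le_rfl, hlevel], fun i hi => ?_⟩
  rw [← hxy i hi.le]
  exact hfirst i hi

theorem newVertex_congr {k : ℕ} {x y : ℕ → Vertex d} (hxy : ∀ i ≤ k, x i = y i) :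
    NewVertex k x ↔ NewVertex k y := by
  refine forall₂_congr fun i hi => ?_
  rw [hxy i hi.le, hxy k le_rfl]

/-! ### Distinct vertices visited on a level -/

open Classical in
/-- The times before `k` at which a new vertex of level `L` is visited. -/
noncomputable def newTimes (L k : ℕ) (V : ℕ → Vertex d) : Finset ℕ :=
  {i ∈ Finset.range k | NewVertex i V ∧ level (V i) = L}

theorem mem_newTimes {L k i : ℕ} {V : ℕ → Vertex d} :
    i ∈ newTimes L k V ↔ i < k ∧ NewVertex i V ∧ level (V i) = L := by
  simp [newTimes]

theorem newTimes_mono (L : ℕ) (V : ℕ → Vertex d) : Monotone fun k => newTimes L k V :=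
  fun _ _ hk _ hi => mem_newTimes.2 ((mem_newTimes.1 hi).imp_left fun hlt => hlt.trans_le hk)

/-- Time `k` is the `(j + 1)`-st time at which a new vertex of level `L` is visited. -/
def newVertexEvent (d L j k : ℕ) : Set (ℕ → Vertex d) :=
  {V | NewVertex k V ∧ level (V k) = L ∧ (newTimes L k V).card = j}

theorem adapted_newVertexEvent (L j k : ℕ) : Adapted k (newVertexEvent d L j k) := by
  rintro x y hxy ⟨hnew, hlevel, hcard⟩
  refine ⟨(newVertex_congr hxy).1 hnew, by rw [← hxy k le_rfl, hlevel], ?_⟩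
  rw [← hcard]
  congr 1
  ext i
  simp only [mem_newTimes]
  refine and_congr_right fun hi => ?_
  rw [newVertex_congr fun j hj => hxy j (by omega), hxy i hi.le]

theorem pairwise_disjoint_newVertexEvent (L j : ℕ) :
    Pairwise (Function.onFun Disjoint (newVertexEvent d L j)) := by
  refine pairwise_disjoint_on _ |>.2 fun k k' hlt => Set.disjoint_left.2 ?_
  rintro V ⟨hnew, hlevel, hcard⟩ ⟨-, -, hcard'⟩
  have hlt : newTimes L k V ⊂ newTimes L k' V :=
    (Finset.ssubset_iff_of_subset (newTimes_mono L V hlt.le)).2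
      ⟨k, mem_newTimes.2 ⟨hlt, hnew, hlevel⟩, fun hk => (mem_newTimes.1 hk).1.false⟩
  exact (Finset.card_lt_card hlt).ne (hcard.trans hcard'.symm)

theorem newTimes_eq_erase_of_isGreatest {L k k' : ℕ} {V : ℕ → Vertex d}
    (hk' : IsGreatest (newTimes L k V) k') : newTimes L k' V = (newTimes L k V).erase k' := by
  ext i
  rw [Finset.mem_erase, mem_newTimes]
  constructor
  · rintro ⟨hlt, hi⟩
    exact ⟨hlt.ne, mem_newTimes.2 ⟨hlt.trans (mem_newTimes.1 hk'.1).1, hi⟩⟩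
  · rintro ⟨hne, hi⟩
    exact ⟨(hk'.2 hi).lt_of_ne hne, (mem_newTimes.1 hi).2⟩

theorem shiftPath_mem_exitEvent {k i : ℕ} {V : ℕ → Vertex d} (hi : k < i)
    (hnot : ¬StrictDesc (V k) (V i)) : shiftPath k V ∈ exitEvent d := by
  refine ⟨i - k - 1, ?_⟩
  have hsum : i - k - 1 + 1 + k = i := by omega
  simpa only [shiftPath, hsum, Nat.zero_add] using hnot

-- To see another new vertex of level `L`, the walk must leave the subtree below the last one.
theorem exists_exit_of_mem_newVertexEvent_succ {L j k : ℕ} {V : ℕ → Vertex d}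
    (hV : V ∈ newVertexEvent d L (j + 1) k) :
    ∃ k', V ∈ newVertexEvent d L j k' ∧ shiftPath k' V ∈ exitEvent d := by
  obtain ⟨-, hlevel, hcard⟩ := hV
  have hne : (newTimes L k V).Nonempty := Finset.card_pos.1 (by omega)
  have hmax := (newTimes L k V).isGreatest_max' hne
  obtain ⟨hlt, hnew', hlevel'⟩ := mem_newTimes.1 hmax.1
  refine ⟨_, ⟨hnew', hlevel', ?_⟩, shiftPath_mem_exitEvent hlt fun hdesc => ?_⟩
  · rw [newTimes_eq_erase_of_isGreatest hmax, Finset.card_erase_of_mem hmax.1, hcard]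
    rfl
  · exact hdesc.level_lt.ne (hlevel'.trans hlevel.symm)

theorem card_newTimes_le {L q : ℕ} {V : ℕ → Vertex d}
    (hV : V ∉ ⋃ k, newVertexEvent d L q k) (N : ℕ) : (newTimes L N V).card ≤ q := by
  classical
  induction N with
  | zero => simp [newTimes]
  | succ N ih =>
    rw [newTimes, Finset.range_add_one, Finset.filter_insert, ← newTimes]
    split_ifs with hN
    · have hne : (newTimes L N V).card ≠ q := fun hcard =>
        hV (Set.mem_iUnion.2 ⟨N, hN.1, hN.2, hcard⟩)
      exact (Finset.card_insert_le _ _).trans (ih.lt_of_ne hne)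
    · exact ih

/-! ### Number of visits -/

theorem apply_eq_iff_shiftPath_apply_eq {k j : ℕ} (hkj : k ≤ j) (V : ℕ → Vertex d) :
    V j = V k ↔ shiftPath k V (j - k) = shiftPath k V 0 := by
  simp only [shiftPath, Nat.sub_add_cancel hkj, Nat.zero_add]

open Classical in
theorem card_visits_start_le {r : ℕ} {V : ℕ → Vertex d} (hV : V ∉ returnEvent d r)
    (S : Finset ℕ) : (S.filter fun j => V j = V 0).card ≤ r := by
  induction r generalizing V S with
  | zero => exact absurd (Set.mem_univ V) hV
  | succ r ih =>
    by_cases hex : ∃ k, 0 < k ∧ V k = V 0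
    · obtain ⟨hpos, hreturn⟩ := Nat.find_spec hex
      set k := Nat.find hex
      have hmin : ∀ j, 0 < j → j < k → V j ≠ V 0 := fun j hj hjk heq =>
        Nat.find_min hex hjk ⟨hj, heq⟩
      have hshift : shiftPath k V ∉ returnEvent d r := fun hr =>
        hV (Set.mem_iUnion.2 ⟨k, ⟨hpos, hreturn, hmin⟩, hr⟩)
      have hsub : S.filter (fun j => V j = V 0) ⊆ insert 0
          ((((S.image (· - k)).filter fun j => shiftPath k V j = shiftPath k V 0)).image
            (· + k)) := by
        intro j hj
        obtain ⟨hjS, hj0⟩ := Finset.mem_filter.1 hj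
        refine Finset.mem_insert.2 (j.eq_zero_or_pos.imp_right fun hjpos => ?_)
        have hkj : k ≤ j := not_lt.1 fun hlt => hmin j hjpos hlt hj0
        refine Finset.mem_image.2 ⟨j - k, Finset.mem_filter.2
          ⟨Finset.mem_image_of_mem _ hjS, ?_⟩, Nat.sub_add_cancel hkj⟩
        exact (apply_eq_iff_shiftPath_apply_eq hkj V).1 (hj0.trans hreturn.symm)
      refine (Finset.card_le_card hsub).trans ((Finset.card_insert_le _ _).trans ?_)
      exact Nat.succ_le_succ (Finset.card_image_le.trans (ih hshift _))
    · push Not at hex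
      have hsub : S.filter (fun j => V j = V 0) ⊆ {0} := fun j hj =>
        Finset.mem_singleton.2 (not_not.1 fun hj0 =>
          hex j (Nat.pos_of_ne_zero hj0) (Finset.mem_filter.1 hj).2)
      exact (Finset.card_le_card hsub).trans (by simp)

open Classical in
theorem card_visits_le {r k : ℕ} {V : ℕ → Vertex d} (hnew : NewVertex k V)
    (hV : shiftPath k V ∉ returnEvent d r) (S : Finset ℕ) :
    (S.filter fun j => V j = V k).card ≤ r := by
  have hsub : S.filter (fun j => V j = V k) ⊆
      ((S.image (· - k)).filter fun j => shiftPath k V j = shiftPath k V 0).image (· + k) := by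
    intro j hj
    obtain ⟨hjS, hjk⟩ := Finset.mem_filter.1 hj
    have hkj : k ≤ j := not_lt.1 fun hlt => hnew j hlt hjk
    exact Finset.mem_image.2 ⟨j - k, Finset.mem_filter.2 ⟨Finset.mem_image_of_mem _ hjS,
      (apply_eq_iff_shiftPath_apply_eq hkj V).1 hjk⟩, Nat.sub_add_cancel hkj⟩
  exact (Finset.card_le_card hsub).trans (Finset.card_image_le.trans (card_visits_start_le hV _))

/-- The first time at which the vertex visited at time `j` is visited. -/
noncomputable def firstVisit (V : ℕ → Vertex d) (j : ℕ) : ℕ := sInf {i | V i = V j}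

theorem apply_firstVisit (V : ℕ → Vertex d) (j : ℕ) : V (firstVisit V j) = V j :=
  Nat.sInf_mem (s := {i | V i = V j}) ⟨j, rfl⟩

theorem firstVisit_le (V : ℕ → Vertex d) (j : ℕ) : firstVisit V j ≤ j := Nat.sInf_le rfl

theorem newVertex_firstVisit (V : ℕ → Vertex d) (j : ℕ) : NewVertex (firstVisit V j) V :=
  fun _ hi heq => Nat.notMem_of_lt_sInf hi (heq.trans (apply_firstVisit V j))

-- Each time in `S` is a visit of a vertex, and each vertex lies on one of the levels in `A`.
theorem card_le_of_level_mem {V : ℕ → Vertex d} {r q : ℕ} {S A : Finset ℕ}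
    (hvisits : ∀ j ∈ S, shiftPath (firstVisit V j) V ∉ returnEvent d r)
    (hvertices : ∀ l ∈ A, V ∉ ⋃ k, newVertexEvent d l q k) (hlevel : ∀ j ∈ S, level (V j) ∈ A) :
    S.card ≤ r * (q * A.card) := by
  classical
  have htimes : S.card ≤ r * (S.image (firstVisit V)).card := by
    refine Finset.card_le_mul_card_image S r fun i hi => ?_
    obtain ⟨j, hj, rfl⟩ := Finset.mem_image.1 hi
    refine (Finset.card_le_card fun j' hj' => ?_).trans
      (card_visits_le (newVertex_firstVisit V j) (hvisits j hj) S)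
    rw [Finset.mem_filter] at hj' ⊢
    exact ⟨hj'.1, hj'.2 ▸ (apply_firstVisit V j').symm⟩
  have hfirst : (S.image (firstVisit V)).card ≤ q * A.card := by
    refine Finset.card_le_mul_card_image_of_maps_to (f := fun i => level (V i)) ?_ q ?_
    · intro i hi
      obtain ⟨j, hj, rfl⟩ := Finset.mem_image.1 hi
      simpa only [apply_firstVisit] using hlevel j hj
    · intro l hl
      refine (Finset.card_le_card fun i hi => ?_).trans
        (card_newTimes_le (hvertices l hl) (S.sup id + 1))
      obtain ⟨himage, hil⟩ := Finset.mem_filter.1 hi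
      obtain ⟨j, hj, rfl⟩ := Finset.mem_image.1 himage
      have hjsup : j ≤ S.sup id := Finset.le_sup (f := id) hj
      exact mem_newTimes.2 ⟨Nat.lt_succ_of_le ((firstVisit_le V j).trans hjsup),
        newVertex_firstVisit V j, hil⟩
  exact htimes.trans (Nat.mul_le_mul_left r hfirst)

theorem exists_level_ge {V : ℕ → Vertex d} (hV : ∀ k, IsPath k V) {r q N n k L : ℕ}
    (hvisits : ∀ i ≤ k + n, NewVertex i V → shiftPath i V ∉ returnEvent d r)
    (hvertices : ∀ l ≤ k + n, V ∉ ⋃ i, newVertexEvent d l q i)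
    (hL : ∀ j > k, L ≤ level (V j)) (hn : r * (q * N) < n) :
    ∃ j ≤ k + n, L + N ≤ level (V j) := by
  by_contra! hlow
  have hcard : (Finset.Ioc k (k + n)).card
      ≤ r * (q * (Finset.Ico L (min (L + N) (k + n + 1))).card) := by
    refine card_le_of_level_mem (V := V) (fun j hj => ?_) (fun l hl => ?_) fun j hj => ?_
    · exact hvisits _ ((firstVisit_le V j).trans (Finset.mem_Ioc.1 hj).2)
        (newVertex_firstVisit V j)
    · exact hvertices l (by have := (Finset.mem_Ico.1 hl).2; omega)
    · obtain ⟨hkj, hjn⟩ := Finset.mem_Ioc.1 hj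
      exact Finset.mem_Ico.2 ⟨hL j hkj,
        lt_min (hlow j hjn) (Nat.lt_succ_of_le ((hV j).level_le.trans hjn))⟩
  have hlevels : (Finset.Ico L (min (L + N) (k + n + 1))).card ≤ N := by
    rw [Nat.card_Ico]; omega
  have hbound : r * (q * (Finset.Ico L (min (L + N) (k + n + 1))).card) ≤ r * (q * N) := by
    gcongr
  rw [Nat.card_Ioc] at hcard
  omega

/-! ### Regeneration attempts -/

/-- The regeneration attempts on the levels `L, L + s, …, L + (j - 1) s` have failed before the
first visit of level `L + j s`, which takes place at time `k`. -/
def failEvent (d L s : ℕ) : ℕ → ℕ → Set (ℕ → Vertex d)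
  | 0, k => {V | FirstHit L k V}
  | j + 1, k => {V | FirstHit (L + (j + 1) * s) k V ∧ ∃ k' < k, V ∈ failEvent d L s j k' ∧
      ∃ i, k' < i ∧ i ≤ k ∧ ¬StrictDesc (V k') (V i)}

theorem firstHit_of_mem_failEvent {L s j k : ℕ} {V : ℕ → Vertex d}
    (hV : V ∈ failEvent d L s j k) : FirstHit (L + j * s) k V := by
  cases j with
  | zero => simpa [failEvent] using hV
  | succ j => exact hV.1

theorem adapted_failEvent (L s j k : ℕ) : Adapted k (failEvent d L s j k) := by
  induction j generalizing k with
  | zero => exact adapted_firstHit L k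
  | succ j ih =>
    rintro x y hxy ⟨hhit, k', hk', hfail, i, hi, hik, hnot⟩
    refine ⟨adapted_firstHit _ k x y hxy hhit, k', hk',
      ih k' x y (fun i hi => hxy i (by omega)) hfail, i, hi, hik, ?_⟩
    rwa [← hxy k' hk'.le, ← hxy i hik]

theorem pairwise_disjoint_failEvent (L s j : ℕ) :
    Pairwise (Function.onFun Disjoint (failEvent d L s j)) :=
  fun _ _ hne => Set.disjoint_left.2 fun _ hk hk' =>
    hne ((firstHit_of_mem_failEvent hk).unique (firstHit_of_mem_failEvent hk'))

theorem exists_exit_of_mem_failEvent_succ {L s j k : ℕ} {V : ℕ → Vertex d}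
    (hV : V ∈ failEvent d L s (j + 1) k) :
    ∃ k', V ∈ failEvent d L s j k' ∧ shiftPath k' V ∈ exitEvent d := by
  obtain ⟨-, k', -, hfail, i, hi, -, hnot⟩ := hV
  exact ⟨k', hfail, shiftPath_mem_exitEvent hi hnot⟩

theorem exists_successful_attempt {V : ℕ → Vertex d} (hV : ∀ k, IsPath k V) {L s m T : ℕ}
    (hs : 0 < s) (hfail : V ∉ ⋃ k, failEvent d L s m k) (hT : L + m * s ≤ level (V T)) :
    ∃ j a b, FirstHit (L + j * s) a V ∧ FirstHit (L + (j + 1) * s) b V ∧ a < b ∧ b ≤ T ∧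
      ∀ i, a < i → i ≤ b → StrictDesc (V a) (V i) := by
  by_contra! hcon
  have hallfail : ∀ j ≤ m, ∃ k ≤ T, V ∈ failEvent d L s j k := by
    intro j hj
    induction j with
    | zero => exact (hV T).exists_firstHit (by omega)
    | succ j ih =>
      obtain ⟨a, -, ha⟩ := ih (by omega)
      have hhit := firstHit_of_mem_failEvent ha
      have hlevel : L + (j + 1) * s ≤ L + m * s := by gcongr
      obtain ⟨b, hb, hhit'⟩ := (hV T).exists_firstHit (hlevel.trans hT)
      have hab : a < b := hhit.lt_of_lt (hV b) hhit' (by gcongr; omega)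
      obtain ⟨i, hai, hib, hnot⟩ := hcon j a b hhit hhit' hab hb
      exact ⟨b, hb, hhit', a, hab, ha, i, hai, hib, hnot⟩
  obtain ⟨k, -, hk⟩ := hallfail m le_rfl
  exact hfail (Set.mem_iUnion.2 ⟨k, hk⟩)

theorem forall_strictDesc_of_not_backtrack {V : ℕ → Vertex d} {a b t : ℕ} (hab : a ≤ b)
    (hdesc : ∀ i, a < i → i ≤ b → StrictDesc (V a) (V i))
    (hlevel : level (V b) = level (V a) + t) (hV : shiftPath a V ∉ backtrackEvent d t) :
    ∀ i > a, StrictDesc (V a) (V i) := by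
  intro i hi
  rcases le_or_gt i b with hib | hib
  · exact hdesc i hi hib
  · by_contra hnot
    refine hV ⟨b - a, fun j hj hjb => ?_, ?_, i - b, ?_⟩
    · simp only [shiftPath, Nat.zero_add]
      exact hdesc _ (by omega) (by omega)
    · simp only [shiftPath, Nat.zero_add, Nat.sub_add_cancel hab, hlevel]
    · have hsum : i - b + (b - a) + a = i := by omega
      simpa only [shiftPath, Nat.zero_add, hsum] using hnot

theorem FirstHit.isLevelRegeneration {V : ℕ → Vertex d} {L a : ℕ} (ha : FirstHit L a V)
    (hV : IsPath (a + 1) V) (hdesc : ∀ i > a, StrictDesc (V a) (V i)) :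
    IsLevelRegeneration V a := by
  refine ⟨fun i hi => ha.1 ▸ ha.2 i hi, ?_, fun i hi => (hdesc i hi).level_lt.ne'⟩
  have := (hdesc (a + 1) a.lt_succ_self).level_lt
  have := hV.level_succ_le.1
  omega

/-- The level at time `k` separates the past from the future. -/
structure IsCutTime (V : ℕ → Vertex d) (k : ℕ) : Prop where
  level_le : ∀ j ≤ k, level (V j) ≤ level (V k)
  le_level : ∀ j > k, level (V k) ≤ level (V j)

theorem IsLevelRegeneration.isCutTime {V : ℕ → Vertex d} (hV : ∀ k, IsPath k V) {k : ℕ}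
    (hk : IsLevelRegeneration V k) : IsCutTime V k where
  level_le j hj := by
    by_contra! hlt
    obtain ⟨i, hi, hlevel⟩ := (hV j).exists_level_eq hlt.le
    have hne : i ≠ j := by rintro rfl; omega
    exact hk.1 i (by omega) hlevel
  le_level j hj := by
    induction j, hj using Nat.le_induction with
    | base => rw [hk.2.1]; omega
    | succ j hj ih =>
      have := hk.2.2 j hj
      have := (hV (j + 1)).level_succ_le
      omega

/-- The trajectories on which, up to time `T`, no vertex is visited more than `t` times, no level
has more than `t` visited vertices, no backtracking over `t` levels occurs, and no `t` regeneration
attempts at distance `t` fail in a row. -/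
structure IsGood (d T t : ℕ) (V : ℕ → Vertex d) : Prop where
  isPath : ∀ k, IsPath k V
  visits : ∀ k ≤ T, NewVertex k V → shiftPath k V ∉ returnEvent d t
  vertices : ∀ L ≤ T, V ∉ ⋃ k, newVertexEvent d L t k
  backtrack : ∀ L ≤ T, 0 < L → ∀ k, FirstHit L k V → shiftPath k V ∉ backtrackEvent d t
  attempts : ∀ L ≤ T, V ∉ ⋃ k, failEvent d (L + 1) t t k

namespace IsGood

variable {T t n k : ℕ} {V : ℕ → Vertex d}

theorem exists_regeneration (hV : IsGood d T t V) (ht : 0 < t) (hn : t ^ 2 * (t ^ 2 + 1) < n)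
    (hT : k + n ≤ T) (hk : IsCutTime V k) : ∃ a, k < a ∧ a ≤ k + n ∧ IsLevelRegeneration V a := by
  set L := level (V k)
  have hLk : L ≤ k := (hV.isPath k).level_le
  obtain ⟨T', hT', hLT'⟩ := exists_level_ge (r := t) (q := t) (N := t ^ 2 + 1) hV.isPath
    (fun i hi => hV.visits i (hi.trans hT)) (fun l hl => hV.vertices l (hl.trans hT)) hk.le_level
    (by rwa [← mul_assoc, ← sq])
  obtain ⟨j, a, b, ha, hb, hab, hbT', hdesc⟩ := exists_successful_attempt hV.isPath ht
    (hV.attempts L (by omega)) (T := T') (by rw [← sq]; omega)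
  have hka : k < a := by
    by_contra! hle
    have := hk.level_le a hle
    rw [ha.1] at this
    omega
  have hLT : L + 1 + j * t ≤ T := by
    rw [← ha.1]
    exact (hV.isPath a).level_le.trans (by omega)
  have hforever := forall_strictDesc_of_not_backtrack hab.le hdesc (by rw [ha.1, hb.1]; ring)
    (hV.backtrack _ hLT (by omega) a ha)
  exact ⟨a, hka, by omega, ha.isLevelRegeneration (hV.isPath _) hforever⟩

theorem exists_regenTime_succ_eq (hV : IsGood d T t V) (ht : 0 < t)
    (hn : t ^ 2 * (t ^ 2 + 1) < n) {m : ℕ} (hm : regenTime V m = k) (hT : k + n ≤ T)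
    (hk : IsCutTime V k) :
    ∃ k' ≤ k + n, regenTime V (m + 1) = k' ∧ IsLevelRegeneration V k' := by
  classical
  obtain ⟨a, hka, han, ha⟩ := hV.exists_regeneration ht hn hT hk
  have hex : ∃ k', k < k' ∧ IsLevelRegeneration V k' := ⟨a, hka, ha⟩
  refine ⟨Nat.find hex, (Nat.find_min' hex ⟨hka, ha⟩).trans han, ?_, (Nat.find_spec hex).2⟩
  simp only [regenTime, hm, Nat.cast_lt]
  exact le_antisymm (iInf₂_le (Nat.find hex) (Nat.find_spec hex))
    (le_iInf₂ fun j hj => Nat.cast_le.2 (Nat.find_min' hex hj))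

theorem exists_isCutTime_regenTime_eq (hV : IsGood d T t V) (ht : 0 < t)
    (hn : t ^ 2 * (t ^ 2 + 1) < n) {m : ℕ} (hT : m * n ≤ T) :
    ∃ k ≤ m * n, regenTime V m = k ∧ IsCutTime V k := by
  induction m with
  | zero =>
    refine ⟨0, Nat.zero_le _, rfl, fun j hj => by rw [Nat.le_zero.1 hj], fun j _ => ?_⟩
    rw [(hV.isPath 0).level_zero]
    exact Nat.zero_le _
  | succ m ih =>
    rw [add_one_mul] at hT ⊢
    obtain ⟨k, hk, hm, hcut⟩ := ih (by omega)
    obtain ⟨k', hk', hm', hreg⟩ := hV.exists_regenTime_succ_eq ht hn hm (by omega) hcut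
    exact ⟨k', by omega, hm', hreg.isCutTime hV.isPath⟩

theorem regenTime_succ_sub_le (hV : IsGood d T t V) (ht : 0 < t)
    (hn : t ^ 2 * (t ^ 2 + 1) < n) {m : ℕ} (hT : (m + 1) * n ≤ T) :
    regenTime V (m + 1) - regenTime V m ≤ n := by
  rw [add_one_mul] at hT
  obtain ⟨k, hk, hm, hcut⟩ := hV.exists_isCutTime_regenTime_eq ht hn (m := m) (by omega)
  obtain ⟨k', hk', hm', -⟩ := hV.exists_regenTime_succ_eq ht hn hm (by omega) hcut
  rw [tsub_le_iff_left, hm, hm']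
  exact_mod_cast hk'

end IsGood

/-! ### The probability that a trajectory is not good -/

section Bounds

variable {h : AcceptanceFunction} {β₀ β K : ℝ} {μ : Measure ℝ} [IsProbabilityMeasure μ]

theorem walkLaw_newVertex_inter_returnEvent_le (hd : 2 ≤ d) (e : EnvEstimates d μ β₀ h K)
    (hβ : |β| ≤ K) (k : ℕ) {r : ℕ} (hr : 0 < r) :
    walkLaw d h β₀ β μ ({V | NewVertex k V} ∩ shiftPath k ⁻¹' returnEvent d r)
      ≤ ENNReal.ofReal (2 * Real.exp (-(e.c * (r : ℝ) ^ e.a))) :=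
  (walkLaw_inter_shiftPath_le (fun _ _ hxy => (newVertex_congr hxy).1) (fun _ hV => hV)
    (measurableSet_returnEvent r) (returnFreshBound hd r) fun V _ =>
      (lintegral_returnFreshBound hd r (V k)).trans_le (e.lintegral_pow β hβ r hr)).trans
    (mul_le_of_le_one_left' prob_le_one)

theorem walkLaw_iUnion_newVertexEvent_le (hd : 2 ≤ d) (e : EnvEstimates d μ β₀ h K)
    (hβ : |β| ≤ K) (L j : ℕ) :
    walkLaw d h β₀ β μ (⋃ k, newVertexEvent d L j k) ≤ ENNReal.ofReal (e.ρ ^ j) :=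
  (walkLaw_iUnion_le_pow (adapted_newVertexEvent L) (pairwise_disjoint_newVertexEvent L)
    (fun _ _ _ hV => hV.1) (fun _ _ _ hV _ => exists_exit_of_mem_newVertexEvent_succ hV)
    (exitFreshBound hd) (fun v => (lintegral_exitFreshBound hd v).trans_le
      (e.lintegral_one_sub β hβ)) j).trans_eq (ENNReal.ofReal_pow e.ρ_pos.le j).symm

theorem walkLaw_iUnion_failEvent_le (hd : 2 ≤ d) (e : EnvEstimates d μ β₀ h K)
    (hβ : |β| ≤ K) (L s j : ℕ) :
    walkLaw d h β₀ β μ (⋃ k, failEvent d L s j k) ≤ ENNReal.ofReal (e.ρ ^ j) :=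
  (walkLaw_iUnion_le_pow (adapted_failEvent L s) (pairwise_disjoint_failEvent L s)
    (fun _ _ _ hV => (firstHit_of_mem_failEvent hV).newVertex)
    (fun _ _ _ hV _ => exists_exit_of_mem_failEvent_succ hV)
    (exitFreshBound hd) (fun v => (lintegral_exitFreshBound hd v).trans_le
      (e.lintegral_one_sub β hβ)) j).trans_eq (ENNReal.ofReal_pow e.ρ_pos.le j).symm

theorem walkLaw_firstHit_inter_backtrackEvent_le (hd : 3 ≤ d) (e : EnvEstimates d μ β₀ h K)
    (hβ : |β| ≤ K) (L s : ℕ) {x : ℝ} (hx : 0 < x) :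
    walkLaw d h β₀ β μ
        (⋃ k, {V | 0 < L ∧ FirstHit L k V} ∩ shiftPath k ⁻¹' backtrackEvent d (s + 1))
      ≤ ENNReal.ofReal (x + x⁻¹ ^ e.p * (d * (1 / 4) ^ s)) := by
  have : Nontrivial (Fin (d - 1)) := Fin.nontrivial_iff_two_le.2 (by omega)
  choose σ hσ using fun i : Fin (d - 1) => exists_ne i
  refine (walkLaw_iUnion_inter_shiftPath_le (F := fun k => {V | 0 < L ∧ FirstHit L k V})
    (fun k x y hxy hV => ⟨hV.1, adapted_firstHit L k x y hxy hV.2⟩)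
    (fun i j hij => Set.disjoint_left.2 fun V hi hj => hij (hi.2.unique hj.2))
    (fun k V hV => hV.2.newVertex) (measurableSet_backtrackEvent (s + 1))
    (backtrackFreshBound (by omega) e.p σ hx s) fun k V hV =>
      lintegral_backtrackFreshBound_le (by omega) e hβ hσ hx s fun hroot => ?_).trans
    (mul_le_of_le_one_left' prob_le_one)
  have hlevel := hV.2.1
  rw [hroot] at hlevel
  exact hV.1.ne hlevel

theorem compl_isGood_subset (T t : ℕ) :
    {V : ℕ → Vertex d | ¬IsGood d T t V} ⊆ {V | ¬∀ k, IsPath k V} ∪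
      ⋃ k ∈ Finset.range (T + 1), ({V | NewVertex k V} ∩ shiftPath k ⁻¹' returnEvent d t) ∪
        (⋃ i, newVertexEvent d k t i) ∪
        (⋃ i, {V | 0 < k ∧ FirstHit k i V} ∩ shiftPath i ⁻¹' backtrackEvent d t) ∪
        ⋃ i, failEvent d (k + 1) t t i := by
  intro V hV
  by_contra hcon
  simp only [Set.mem_union, not_or, Set.mem_iUnion₂, not_exists] at hcon
  obtain ⟨hpath, hcon⟩ := hcon
  have hle := fun k (hk : k ≤ T) => hcon k (Finset.mem_range.2 (Nat.lt_succ_of_le hk))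
  exact hV
    { isPath := not_not.1 hpath
      visits := fun k hk hnew hreturn => (hle k hk).1.1.1 ⟨hnew, hreturn⟩
      vertices := fun L hL => (hle L hL).1.1.2
      backtrack := fun L hL hpos k hk hback =>
        (hle L hL).1.2 (Set.mem_iUnion.2 ⟨k, ⟨hpos, hk⟩, hback⟩)
      attempts := fun L hL => (hle L hL).2 }

theorem walkLaw_not_isGood_le (hd : 3 ≤ d) (e : EnvEstimates d μ β₀ h K) (hβ : |β| ≤ K)
    (T s : ℕ) {x : ℝ} (hx : 0 < x) :
    walkLaw d h β₀ β μ {V | ¬IsGood d T (s + 1) V} ≤ ENNReal.ofReal ((T + 1 : ℕ) *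
      (2 * Real.exp (-(e.c * ((s + 1 : ℕ) : ℝ) ^ e.a)) + e.ρ ^ (s + 1)
        + (x + x⁻¹ ^ e.p * (d * (1 / 4) ^ s)) + e.ρ ^ (s + 1))) := by
  have hρ : 0 ≤ e.ρ := e.ρ_pos.le
  have hpath : walkLaw d h β₀ β μ {V | ¬∀ k, IsPath k V} = 0 := walkLaw_ae_isPath
  refine (measure_mono (compl_isGood_subset T (s + 1))).trans ((measure_union_le _ _).trans ?_)
  rw [hpath, zero_add, ENNReal.ofReal_mul (by positivity), ENNReal.ofReal_natCast,
    ENNReal.ofReal_add (by positivity) (by positivity),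
    ENNReal.ofReal_add (by positivity) (by positivity),
    ENNReal.ofReal_add (by positivity) (by positivity), ← nsmul_eq_mul]
  refine (measure_biUnion_finset_le _ _).trans ((Finset.sum_le_card_nsmul _ _ _
    fun k _ => ?_).trans_eq (by rw [Finset.card_range]))
  refine (measure_union_le _ _).trans (add_le_add ((measure_union_le _ _).trans
    (add_le_add ((measure_union_le _ _).trans (add_le_add ?_ ?_)) ?_)) ?_)
  · exact walkLaw_newVertex_inter_returnEvent_le (by omega) e hβ k s.succ_pos
  · exact walkLaw_iUnion_newVertexEvent_le (by omega) e hβ k (s + 1)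
  · exact walkLaw_firstHit_inter_backtrackEvent_le hd e hβ k s hx
  · exact walkLaw_iUnion_failEvent_le (by omega) e hβ (k + 1) (s + 1) (s + 1)

theorem exists_lt_one_half_le_pow {p : ℕ} (hp : 0 < p) :
    ∃ y : ℝ, 1 / 2 ≤ y ∧ y < 1 ∧ 1 / 2 ≤ y ^ p := by
  have hp' : (1 : ℝ) ≤ p := by exact_mod_cast hp
  have hpos : 0 < 1 / (2 * (p : ℝ)) := by positivity
  have hle : 1 / (2 * (p : ℝ)) ≤ 1 / 2 := one_div_le_one_div_of_le two_pos (by linarith)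
  refine ⟨1 + -(1 / (2 * p)), by linarith, by linarith, ?_⟩
  refine le_trans (le_of_eq ?_) (one_add_mul_le_pow (by linarith) p)
  field_simp
  ring

theorem pow_add_inv_pow_mul_le {p : ℕ} {y : ℝ} (hy : 1 / 2 ≤ y) (hyp : 1 / 2 ≤ y ^ p) (d s : ℕ) :
    y ^ s + (y ^ s)⁻¹ ^ p * (d * (1 / 4) ^ s) ≤ (d + 1) * y ^ s := by
  have hinv : (y ^ s)⁻¹ ^ p ≤ 2 ^ s := by
    rw [inv_pow, ← pow_mul, mul_comm, pow_mul, ← inv_pow]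
    refine pow_le_pow_left₀ (by positivity) ?_ s
    rw [inv_le_comm₀ (by linarith) two_pos]
    linarith
  calc y ^ s + (y ^ s)⁻¹ ^ p * (d * (1 / 4) ^ s)
      ≤ y ^ s + 2 ^ s * (d * (1 / 4) ^ s) := by gcongr
    _ = y ^ s + d * (1 / 2) ^ s := by
        rw [mul_left_comm, ← mul_pow]
        norm_num
    _ ≤ y ^ s + d * y ^ s := by gcongr
    _ = (d + 1) * y ^ s := by ring

theorem pow_le_exp_neg_mul_rpow {y a c : ℝ} (hy : 0 < y) (hc : c ≤ -Real.log y) (hc0 : 0 ≤ c)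
    (ha : a ≤ 1) {t : ℕ} (ht : 0 < t) : y ^ t ≤ Real.exp (-(c * (t : ℝ) ^ a)) := by
  have ht' : (1 : ℝ) ≤ t := by exact_mod_cast ht
  have hrpow : (t : ℝ) ^ a ≤ t := by
    simpa using Real.rpow_le_rpow_of_exponent_le ht' ha
  rw [← Real.exp_log (pow_pos hy t), Real.log_pow, Real.exp_le_exp, mul_comm (t : ℝ), le_neg,
    ← neg_mul]
  gcongr
  exact hc0.trans hc

namespace EnvEstimates

theorem exists_sum_le_exp (e : EnvEstimates d μ β₀ h K) :
    ∃ C > 0, ∃ c > 0, ∀ s : ℕ, ∃ x > 0,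
      2 * Real.exp (-(e.c * ((s + 1 : ℕ) : ℝ) ^ e.a)) + e.ρ ^ (s + 1)
        + (x + x⁻¹ ^ e.p * (d * (1 / 4) ^ s)) + e.ρ ^ (s + 1)
      ≤ C * Real.exp (-(c * ((s + 1 : ℕ) : ℝ) ^ e.a)) := by
  obtain ⟨y, hy, hy1, hyp⟩ := exists_lt_one_half_le_pow e.p_pos
  have hy0 : 0 < y := by linarith
  have hlogρ := Real.log_neg e.ρ_pos e.ρ_lt_one
  have hlogy := Real.log_neg hy0 hy1
  obtain ⟨c, hc0, hce, hcρ, hcy⟩ :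
      ∃ c > 0, c ≤ e.c ∧ c ≤ -Real.log e.ρ ∧ c ≤ -Real.log y :=
    ⟨min e.c (min (-Real.log e.ρ) (-Real.log y)),
      lt_min e.c_pos (lt_min (by linarith) (by linarith)), min_le_left _ _,
      (min_le_right _ _).trans (min_le_left _ _), (min_le_right _ _).trans (min_le_right _ _)⟩
  refine ⟨4 + (d + 1) / y, by positivity, c, hc0, fun s => ⟨y ^ s, by positivity, ?_⟩⟩
  set E := Real.exp (-(c * ((s + 1 : ℕ) : ℝ) ^ e.a))
  have hreturn : Real.exp (-(e.c * ((s + 1 : ℕ) : ℝ) ^ e.a)) ≤ E := by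
    refine Real.exp_le_exp.2 (neg_le_neg ?_)
    gcongr
  have hexit : e.ρ ^ (s + 1) ≤ E :=
    pow_le_exp_neg_mul_rpow e.ρ_pos hcρ hc0.le e.a_le_one s.succ_pos
  have hback : y ^ s + (y ^ s)⁻¹ ^ e.p * (d * (1 / 4) ^ s) ≤ (d + 1) / y * E :=
    calc y ^ s + (y ^ s)⁻¹ ^ e.p * (d * (1 / 4) ^ s)
        ≤ (d + 1) * y ^ s := pow_add_inv_pow_mul_le hy hyp d s
      _ = (d + 1) / y * y ^ (s + 1) := by rw [pow_succ]; field_simp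
      _ ≤ (d + 1) / y * E := by
          gcongr
          exact pow_le_exp_neg_mul_rpow hy0 hcy hc0.le e.a_le_one s.succ_pos
  linarith [add_mul 4 ((d + 1) / y) E]

theorem exists_walkLaw_not_isGood_le (hd : 3 ≤ d) (e : EnvEstimates d μ β₀ h K) :
    ∃ C > 0, ∃ c > 0, ∀ β, |β| ≤ K → ∀ T t : ℕ, 0 < t →
      walkLaw d h β₀ β μ {V | ¬IsGood d T t V}
        ≤ ENNReal.ofReal ((T + 1 : ℕ) * (C * Real.exp (-(c * (t : ℝ) ^ e.a)))) := by
  obtain ⟨C, hC, c, hc, hsum⟩ := e.exists_sum_le_exp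
  refine ⟨C, hC, c, hc, fun β hβ T t ht => ?_⟩
  obtain ⟨s, rfl⟩ := Nat.exists_eq_succ_of_ne_zero ht.ne'
  obtain ⟨x, hx, hle⟩ := hsum s
  refine (walkLaw_not_isGood_le hd e hβ T s hx).trans (ENNReal.ofReal_le_ofReal ?_)
  gcongr

end EnvEstimates

end Bounds

/-! ### Choice of the parameters -/

section Parameters

open Filter Topology

theorem tendsto_mul_exp_neg_rpow {a : ℝ} (ha : 0 < a) :
    Tendsto (fun x : ℝ => x * Real.exp (-x ^ a)) atTop (𝓝 0) := by
  refine ((tendsto_rpow_mul_exp_neg_mul_atTop_nhds_zero a⁻¹ 1 one_pos).comp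
    (tendsto_rpow_atTop ha)).congr' ?_
  filter_upwards [eventually_ge_atTop 0] with x hx
  simp only [Function.comp_apply, Real.rpow_rpow_inv hx ha.ne', neg_one_mul]

theorem exists_pow_five_le {n : ℕ} (hn : 32 ≤ n) :
    ∃ t : ℕ, 2 ≤ t ∧ t ^ 5 ≤ n ∧ (n : ℝ) ^ (1 / 5 : ℝ) / 2 ≤ t := by
  set u : ℝ := (n : ℝ) ^ (1 / 5 : ℝ) with hu
  have hu0 : 0 ≤ u := by positivity
  have hu5 : u ^ 5 = n := by
    rw [hu, ← Real.rpow_natCast, ← Real.rpow_mul (Nat.cast_nonneg n)]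
    norm_num
  have hu2 : 2 ≤ u := by
    refine le_of_pow_le_pow_left₀ (by norm_num : 5 ≠ 0) hu0 ?_
    rw [hu5]
    exact_mod_cast hn
  have hfloor : (⌊u⌋₊ : ℝ) ≤ u := Nat.floor_le hu0
  refine ⟨⌊u⌋₊, Nat.le_floor (by exact_mod_cast hu2), ?_, by linarith [Nat.lt_floor_add_one u]⟩
  have : (⌊u⌋₊ : ℝ) ^ 5 ≤ n := hu5 ▸ pow_le_pow_left₀ (Nat.cast_nonneg _) hfloor 5
  exact_mod_cast this

theorem sq_rpow_le_two_mul_rpow {n t : ℕ} {a : ℝ} (ha : 0 ≤ a) (ha1 : a ≤ 1)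
    (ht : (n : ℝ) ^ (1 / 5 : ℝ) / 2 ≤ t) : ((n : ℝ) ^ (a / 10)) ^ 2 ≤ 2 * (t : ℝ) ^ a := by
  calc ((n : ℝ) ^ (a / 10)) ^ 2 = ((n : ℝ) ^ (1 / 5 : ℝ)) ^ a := by
        rw [← Real.rpow_natCast, ← Real.rpow_mul n.cast_nonneg, ← Real.rpow_mul n.cast_nonneg]
        congr 1
        push_cast
        ring
    _ ≤ (2 * t) ^ a := Real.rpow_le_rpow (by positivity) (by linarith) ha
    _ = 2 ^ a * (t : ℝ) ^ a := Real.mul_rpow two_pos.le t.cast_nonneg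
    _ ≤ 2 * (t : ℝ) ^ a := by
        gcongr
        simpa using Real.rpow_le_rpow_of_exponent_le one_le_two ha1

-- With `t` of order `n ^ (1/5)`, `exp (-c t ^ a)` is at most `exp (-2 n ^ (a/10))`, one half of
-- which absorbs the factor in front.
theorem exists_parameter {C c a : ℝ} (hC : 0 < C) (hc : 0 < c) (ha : 0 < a) (ha1 : a ≤ 1)
    (M : ℕ) : ∃ N : ℕ, ∀ n : ℕ, N < n → ∃ t : ℕ, 0 < t ∧ t ^ 2 * (t ^ 2 + 1) < n ∧
      (M * n + 1 : ℕ) * (C * Real.exp (-(c * (t : ℝ) ^ a))) ≤ Real.exp (-(n : ℝ) ^ (a / 10)) := by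
  have hz : Tendsto (fun n : ℕ => (n : ℝ) ^ (a / 10)) atTop atTop :=
    (tendsto_rpow_atTop (by positivity)).comp tendsto_natCast_atTop_atTop
  have hsmall : ∀ᶠ n : ℕ in atTop,
      (n : ℝ) * Real.exp (-(n : ℝ) ^ (a / 10)) < 1 / ((M + 1) * C) :=
    ((tendsto_mul_exp_neg_rpow (by positivity)).comp
      tendsto_natCast_atTop_atTop).eventually_lt_const (by positivity)
  obtain ⟨N, hN⟩ := eventually_atTop.1
    ((hsmall.and (hz.eventually_ge_atTop (4 / c))).and (eventually_ge_atTop 32))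
  refine ⟨N, fun n hn => ?_⟩
  obtain ⟨⟨hsmall, hlarge⟩, hn32⟩ := hN n hn.le
  obtain ⟨t, ht2, ht5, htn⟩ := exists_pow_five_le hn32
  refine ⟨t, by omega, lt_of_lt_of_le ?_ ht5, ?_⟩
  · rw [show t ^ 5 = t ^ 2 * t ^ 3 by ring]
    gcongr
    nlinarith
  set z : ℝ := (n : ℝ) ^ (a / 10)
  have hz2 : z ^ 2 ≤ 2 * (t : ℝ) ^ a := sq_rpow_le_two_mul_rpow ha.le ha1 htn
  have hzpos : 0 < z := lt_of_lt_of_le (by positivity) hlarge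
  have hexp : Real.exp (-(c * (t : ℝ) ^ a)) ≤ Real.exp (-z) * Real.exp (-z) := by
    rw [div_le_iff₀ hc] at hlarge
    rw [← Real.exp_add, Real.exp_le_exp]
    linarith [mul_le_mul_of_nonneg_left hz2 hc.le, mul_le_mul_of_nonneg_left hlarge hzpos.le]
  have hfactor : ((M * n + 1 : ℕ) : ℝ) ≤ n * (M + 1) := by
    exact_mod_cast (by lia : M * n + 1 ≤ n * (M + 1))
  rw [lt_div_iff₀ (by positivity)] at hsmall
  calc (M * n + 1 : ℕ) * (C * Real.exp (-(c * (t : ℝ) ^ a)))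
      ≤ n * (M + 1) * (C * (Real.exp (-z) * Real.exp (-z))) := by gcongr
    _ = n * Real.exp (-z) * ((M + 1) * C) * Real.exp (-z) := by ring
    _ ≤ 1 * Real.exp (-z) := by gcongr
    _ = Real.exp (-z) := one_mul _

end Parameters

end MetropolisTree

open MeasureTheory MetropolisTree in
theorem mainTheorem3_general {d : ℕ} (hd : 3 ≤ d) (μ : Measure ℝ) [IsProbabilityMeasure μ]
    (hbdd : EssBounded μ) {β₀ : ℝ} (hrev : ReversibleAt μ β₀)
    (hΛ : 0 < logLaplace d μ (β₀ / 2)) (h : AcceptanceFunction) (K : ℝ) :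
    ∃ a > (0 : ℝ), ∀ m : ℕ, ∃ N > 0, ∀ n : ℕ, N < n → ∀ β, |β| ≤ K →
      annealedLaw h β₀ β d μ
          {x | ∃ i ≤ m, (n : ℕ∞) < regenTime x.2 (i + 1) - regenTime x.2 i}
        ≤ ENNReal.ofReal (Real.exp (-(n : ℝ) ^ a)) := by
  obtain ⟨e⟩ := exists_envEstimates hd hbdd hrev hΛ h K
  obtain ⟨C, hC, c, hc, hgood⟩ := e.exists_walkLaw_not_isGood_le hd
  refine ⟨e.a / 10, div_pos e.a_pos (by norm_num), fun m => ?_⟩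
  obtain ⟨N, hN⟩ := exists_parameter hC hc e.a_pos e.a_le_one (m + 1)
  refine ⟨N + 1, N.succ_pos, fun n hn β hβ => ?_⟩
  obtain ⟨t, ht, htn, hexp⟩ := hN n (by omega)
  refine (annealedLaw_le_walkLaw (A := {V | ∃ i ≤ m,
    (n : ℕ∞) < regenTime V (i + 1) - regenTime V i}) ?_).trans
    ((hgood β hβ ((m + 1) * n) t ht).trans (ENNReal.ofReal_le_ofReal hexp))
  rintro V ⟨i, hi, hlt⟩ hV
  exact hlt.not_ge (hV.regenTime_succ_sub_le ht htn (by gcongr))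

theorem mainTheorem3 (d : ℕ) (hd : 3 ≤ d)
    (μ : MeasureTheory.Measure ℝ) [MeasureTheory.IsProbabilityMeasure μ]
    (hXS : MetropolisTree.EssBounded μ)
    (β₀ : ℝ) (hβ₀ : 0 < β₀) (hXR : MetropolisTree.ReversibleAt μ β₀)
    (hXM : ∃ c > 0, ∀ β : ℝ, 0 ≤ β → c ≤ MetropolisTree.logLaplace d μ β)
    (h : MetropolisTree.AcceptanceFunction) :
    ∀ K : ℝ, 0 < K → ∃ a : ℝ, 0 < a ∧ ∃ nₐ : ℕ, 0 < nₐ ∧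
      ∀ n : ℕ, nₐ < n → ∀ β : ℝ, |β| ≤ K →
        MetropolisTree.annealedLaw h β₀ β d μ
            {x | (n : ℕ∞) < MetropolisTree.regenTime x.2 1}
          ≤ ENNReal.ofReal (Real.exp (-((n : ℝ) ^ a))) ∧
        MetropolisTree.annealedLaw h β₀ β d μ
            {x | (n : ℕ∞) < MetropolisTree.regenTime x.2 2 - MetropolisTree.regenTime x.2 1}
          ≤ ENNReal.ofReal (Real.exp (-((n : ℝ) ^ a))) := by
  obtain ⟨c, hc, hΛ⟩ := hXM
  intro K _
  obtain ⟨a, ha, hregen⟩ := mainTheorem3_general hd μ hXS hXR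
    (hc.trans_le (hΛ (β₀ / 2) (by positivity))) h K
  obtain ⟨N, hN, hregen⟩ := hregen 1
  refine ⟨a, ha, N, hN, fun n hn β hβ => ⟨?_, ?_⟩⟩ <;>
    refine (MeasureTheory.measure_mono ?_).trans (hregen n hn β hβ)
  · exact fun x hx => ⟨0, zero_le_one, by simpa [MetropolisTree.regenTime] using hx⟩
  · exact fun x hx => ⟨1, le_rfl, hx⟩
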